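/- Let $\mathsf M$ be a symmetric monoidal category (product written as juxtaposition or $\otimes$, unit $I$, symmetry $c$) in which equalizers exist and are preserved by taking the monoidal product with any object. Bimonoids, bimonoid morphisms and Hopf monoids (bimonoids with an antipode $z$) are taken in $\mathsf M$; $m,u$ denote multiplication and unit, $\delta,\varepsilon$ comultiplication and counit. Composition is written from right to left, $f.g$ meaning "first $g$", and $1$ denotes identity morphisms. Let $\mathcal S$ be the class of spans of bimonoids $X\xleftarrow{f}A\xrightarrow{g}Y$ with $(f\otimes g).\delta=(f\otimes g).c.\delta$. The $\mathcal S$-relative pullback of a cospan $A\xrightarrow{f}B\xleftarrow{g}D$ of bimonoids is a span $A\xleftarrow{p_1}A\,\Box_B D\xrightarrow{p_2}D$ in $\mathcal S$ with $f.p_1=g.p_2$, universal among the spans in $\mathcal S$ with this property, and such that a span one of whose legs is a morphism $h$ to $A\,\Box_BD$ belongs to $\mathcal S$ whenever the two spans obtained by replacing $h$ with $p_1.h$ and with $p_2.h$ do. A reflexive graph of bimonoids consists of bimonoid morphisms $s,t:A\to B$ and $i:B\to A$ with $s.i=1=t.i$; its morphisms are pairs of bimonoid morphisms $(b:B\to B',a:A\to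 A')$ compatible with $s,t,i$. For such a graph let $j:A\,\Box_BI\to A$ be the equalizer in $\mathsf M$ of $(1\otimes s).\delta$ and $1\otimes u:A\to A\otimes B$, and put $q:=m.(j\otimes i):(A\,\Box_BI)\otimes B\to A$. An $\mathcal S$-relative category in bimonoids is a reflexive graph such that the spans $A=A\xrightarrow{s}B$ and $B\xleftarrow{t}A=A$ belong to $\mathcal S$, together with a bimonoid morphism $d:A\,\Box_BA\to A$ on the $\mathcal S$-relative pullback of $A\xrightarrow{s}B\xleftarrow{t}A$, with $s.d=s.p_2$ and $t.d=t.p_1$, which is associative and has $i$ as a two-sided unit. An $\mathcal S$-relative functor is a morphism of reflexive graphs with $a.d=d'.(a\,\Box\,a)$. A crossed module of bimonoids consists of a cocommutative bimonoid $B$, a bimonoid $Y$, a left $B$-action $l:B\otimes Y\to Y$ making $Y$ a $B$-module monoid and a $B$-module comonoid, and a bimonoid morphism $k:Y\to B$, such that $$(k\otimes1).c.\delta=(k\otimes 1).\delta,\qquad m.(k\otimes1).(l\otimes 1).(1\otimes c).(\delta\otimes1)=m.(1\otimes k),\qquad m.(l\otimes1).(k\otimes1\otimes1).(1\otimes c).(\delta\otimes1)=m$$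 (morphisms $Y\to B\otimes Y$, $B\otimes Y\to B$, $Y\otimes Y\to Y$, respectively). Its morphisms are pairs of bimonoid morphisms $(b:B\to B',y:Y\to Y')$ with $k'.y=b.k$ and $l'.(b\otimes y)=y.l$. **Proposition.** The following categories are equivalent. 1. The category of those $\mathcal S$-relative categories in bimonoids for which $q$ is invertible and $B$ is a Hopf monoid, and of $\mathcal S$-relative functors. 2. The full subcategory of the category of crossed modules of bimonoids whose objects are those for which $B$ is a Hopf monoid. 3. The full subcategory of the category of reflexive graphs of bimonoids whose objects are those for which the span $A=A\xrightarrow{s}B$ belongs to $\mathcal S$ (that is, $(1\otimes s).\delta=(1\otimes s).c.\delta$), $q$ is invertible, $B$ is a Hopf monoid (with antipode $z$), $(t\otimes1).\delta=(t\otimes1).c.\delta$, and the morphisms $$\overrightarrow s:=m.(1\otimes i).(1\otimes z).(1\otimes s).\delta,\qquad \overleftarrow t:=m.(i\otimes1).(z\otimes1).(t\otimes1).\delta\ :\ A\to A$$ satisfy $m.c.(\overrightarrow s\otimes\overleftarrow t)=m.(\overrightarrow s\otimes\overleftarrow t)$. More precisely, forgetting $d$ gives an equivalence from category 1 to category 3;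 and there is an equivalence from category 3 to category 2 sending a reflexive graph to a crossed module with the same $B$ (up to natural isomorphism) and with $Y=A\,\Box_BI$ (where $j:Y\to A$ is a bimonoid morphism natural in the graph), $k=t.j$, and the action $l$ satisfying $m.(i\otimes j)=m.(j\otimes i).(l\otimes1).(1\otimes c).(\delta\otimes 1):B\otimes Y\to A$. Under the latter, $Y$ is a Hopf monoid if and only if $A$ is, and $Y$ is cocommutative if and only if $A$ is; hence there are further equivalences between the full subcategories in whose objects both occurring bimonoids are Hopf monoids (the setting of Villanueva's equivalence of $\mathsf{Cat}^1$-Hopf algebras and crossed modules of Hopf algebras), and between those in whose objects both are cocommutative Hopf monoids. -/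

import Mathlib

open CategoryTheory MonoidalCategory Limits
open scoped MonObj ComonObj

universe v u

namespace RelXMod

/-! ### Spans, relative pullbacks, reflexive graphs and relative categories in a category -/

section General

variable {C : Type u} [Category.{v} C]

/-- An admissible class of spans `X ⟵ A ⟶ Y` in a category: it is closed under postcomposing the
two legs with arbitrary morphisms and under precomposing both legs with the same morphism. -/
structure AdmissibleSpans (C : Type u) [Category.{v} C] where
  /-- `mem f g` says that the span with legs `f` and `g` belongs to the class. -/
  mem : ∀ {A X Y : C}, (A ⟶ X) → (A ⟶ Y) → Prop
  post : ∀ {A X Y X' Y' : C} {f : A ⟶ X} {g : A ⟶ Y} (f' : X ⟶ X') (g' : Y ⟶ Y'),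
    mem f g → mem (f ≫ f') (g ≫ g')
  pre : ∀ {A A' X Y : C} {f : A ⟶ X} {g : A ⟶ Y} (h : A' ⟶ A), mem f g → mem (h ≫ f) (h ≫ g)

/-- A pullback of the cospan `A ⟶ B ⟵ D` relative to a class `S` of spans: a commutative square
whose span `A ⟵ pt ⟶ D` is in `S`, which is universal among such squares, and whose projections
jointly reflect membership in `S`. -/
structure RelPullback (S : AdmissibleSpans C) {A B D : C} (f : A ⟶ B) (g : D ⟶ B) where
  pt : C
  fst : pt ⟶ A
  snd : pt ⟶ D
  condition : fst ≫ f = snd ≫ g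
  mem : S.mem fst snd
  existsUnique : ∀ {X : C} (a : X ⟶ A) (c : X ⟶ D), S.mem a c → a ≫ f = c ≫ g →
    ∃! h : X ⟶ pt, h ≫ fst = a ∧ h ≫ snd = c
  reflect_left : ∀ {X E : C} (h : X ⟶ pt) (k : X ⟶ E),
    S.mem (h ≫ fst) k → S.mem (h ≫ snd) k → S.mem h k
  reflect_right : ∀ {X E : C} (k : X ⟶ E) (h : X ⟶ pt),
    S.mem k (h ≫ fst) → S.mem k (h ≫ snd) → S.mem k h

namespace RelPullback

variable {S : AdmissibleSpans C} {A B D : C} {f : A ⟶ B} {g : D ⟶ B} (P : RelPullback S f g)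

/-- The morphism into a relative pullback induced by a span in the class. -/
noncomputable def lift {X : C} (a : X ⟶ A) (c : X ⟶ D) (hS : S.mem a c) (w : a ≫ f = c ≫ g) :
    X ⟶ P.pt :=
  (P.existsUnique a c hS w).choose

theorem lift_fst {X : C} (a : X ⟶ A) (c : X ⟶ D) (hS : S.mem a c) (w : a ≫ f = c ≫ g) :
    P.lift a c hS w ≫ P.fst = a :=
  (P.existsUnique a c hS w).choose_spec.1.1

theorem lift_snd {X : C} (a : X ⟶ A) (c : X ⟶ D) (hS : S.mem a c) (w : a ≫ f = c ≫ g) :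
    P.lift a c hS w ≫ P.snd = c :=
  (P.existsUnique a c hS w).choose_spec.1.2

theorem hom_ext {X : C} {h h' : X ⟶ P.pt} (h₁ : h ≫ P.fst = h' ≫ P.fst)
    (h₂ : h ≫ P.snd = h' ≫ P.snd) : h = h' :=
  (P.existsUnique (h' ≫ P.fst) (h' ≫ P.snd) (S.pre h' P.mem)
    (by rw [Category.assoc, Category.assoc, P.condition])).unique ⟨h₁, h₂⟩ ⟨rfl, rfl⟩

end RelPullback

/-- A reflexive graph: two morphisms `s t : A ⟶ B` with a common section `i : B ⟶ A`. -/
structure ReflGraph (C : Type u) [Category.{v} C] where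
  B : C
  A : C
  s : A ⟶ B
  t : A ⟶ B
  i : B ⟶ A
  i_s : i ≫ s = 𝟙 B
  i_t : i ≫ t = 𝟙 B

namespace ReflGraph

/-- A morphism of reflexive graphs: a pair of morphisms compatible with `s`, `t` and `i`. -/
@[ext]
structure Hom (X Y : ReflGraph C) where
  b : X.B ⟶ Y.B
  a : X.A ⟶ Y.A
  a_s : a ≫ Y.s = X.s ≫ b
  a_t : a ≫ Y.t = X.t ≫ b
  b_i : b ≫ Y.i = X.i ≫ a

instance : Category (ReflGraph C) where
  Hom := Hom
  id X := ⟨𝟙 _, 𝟙 _, by simp, by simp, by simp⟩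
  comp f g := ⟨f.b ≫ g.b, f.a ≫ g.a,
    by rw [Category.assoc, g.a_s, ← Category.assoc, f.a_s, Category.assoc],
    by rw [Category.assoc, g.a_t, ← Category.assoc, f.a_t, Category.assoc],
    by rw [Category.assoc, g.b_i, ← Category.assoc, f.b_i, Category.assoc]⟩
  id_comp f := by apply Hom.ext <;> simp
  comp_id f := by apply Hom.ext <;> simp
  assoc f g h := by apply Hom.ext <;> simp

/-- The functor sending a reflexive graph to its object of vertices. -/
def vertices : ReflGraph C ⥤ C where
  obj X := X.B
  map f := f.b

/-- The functor sending a reflexive graph to its object of arrows. -/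
def arrows : ReflGraph C ⥤ C where
  obj X := X.A
  map f := f.a

end ReflGraph

/-- The span with legs `(x, (y, z))` is in `S` if `(x, y)` and `(x, z)` are. -/
theorem AdmissibleSpans.mem_lift (S : AdmissibleSpans C) {A B D X E : C} {f : A ⟶ B} {g : D ⟶ B}
    (P : RelPullback S f g) (k : X ⟶ E) (a : X ⟶ A) (c : X ⟶ D) (hS : S.mem a c)
    (w : a ≫ f = c ≫ g) (h₁ : S.mem k a) (h₂ : S.mem k c) : S.mem k (P.lift a c hS w) :=
  P.reflect_right _ _ (by rwa [P.lift_fst]) (by rwa [P.lift_snd])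

theorem AdmissibleSpans.post_left (S : AdmissibleSpans C) {A X Y X' : C} {f : A ⟶ X} {g : A ⟶ Y}
    (f' : X ⟶ X') (h : S.mem f g) : S.mem (f ≫ f') g := by
  simpa using S.post f' (𝟙 _) h

theorem AdmissibleSpans.post_right (S : AdmissibleSpans C) {A X Y Y' : C} {f : A ⟶ X} {g : A ⟶ Y}
    (g' : Y ⟶ Y') (h : S.mem f g) : S.mem f (g ≫ g') := by
  simpa using S.post (𝟙 _) g' h

/-- The data of a composition for a reflexive graph `s t : A ⟶ B` both of whose legs are in `S`:
the relative pullbacks `A □ A` and `(A □ A) □ A` over `B`, and a morphism `d : A □ A ⟶ A` of spans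
over `B`. -/
structure PreRelCategory (S : AdmissibleSpans C) extends ReflGraph C where
  mem_s : S.mem (𝟙 A) s
  mem_t : S.mem t (𝟙 A)
  /-- `A □ A`, the relative pullback of `s` and `t` -/
  sq : RelPullback S s t
  /-- `(A □ A) □ A` -/
  cube : RelPullback S (sq.snd ≫ s) t
  /-- the composition -/
  d : sq.pt ⟶ A
  d_s : d ≫ s = sq.snd ≫ s
  d_t : d ≫ t = sq.fst ≫ t

namespace PreRelCategory

variable {S : AdmissibleSpans C} (X : PreRelCategory S)

/-- `i □ 1 : A ⟶ A □ A` -/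
noncomputable def unitLeft : X.A ⟶ X.sq.pt :=
  X.sq.lift (X.t ≫ X.i) (𝟙 X.A) (S.post_left X.i X.mem_t) (by simp [X.i_s])

/-- `1 □ i : A ⟶ A □ A` -/
noncomputable def unitRight : X.A ⟶ X.sq.pt :=
  X.sq.lift (𝟙 X.A) (X.s ≫ X.i) (S.post_right X.i X.mem_s) (by simp [X.i_t])

/-- `d □ 1 : (A □ A) □ A ⟶ A □ A` -/
noncomputable def compLeft : X.cube.pt ⟶ X.sq.pt :=
  X.sq.lift (X.cube.fst ≫ X.d) X.cube.snd (S.post_left X.d X.cube.mem)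
    (by rw [Category.assoc, X.d_s, X.cube.condition])

/-- The projection of `(A □ A) □ A` to the last two factors. -/
noncomputable def lastTwo : X.cube.pt ⟶ X.sq.pt :=
  X.sq.lift (X.cube.fst ≫ X.sq.snd) X.cube.snd (S.post_left X.sq.snd X.cube.mem)
    (by rw [Category.assoc, X.cube.condition])

theorem mem_lastTwo : S.mem (X.cube.fst ≫ X.sq.fst) X.lastTwo :=
  S.mem_lift X.sq _ _ _ _ _ (S.pre X.cube.fst X.sq.mem) (S.post_left X.sq.fst X.cube.mem)

/-- `1 □ d : A □ (A □ A) ⟶ A □ A`, precomposed with the associativity isomorphism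
`(A □ A) □ A ≅ A □ (A □ A)` -/
noncomputable def compRight : X.cube.pt ⟶ X.sq.pt :=
  X.sq.lift (X.cube.fst ≫ X.sq.fst) (X.lastTwo ≫ X.d) (S.post_right X.d X.mem_lastTwo) (by
    rw [Category.assoc, Category.assoc, X.d_t, X.sq.condition, ← Category.assoc, ← Category.assoc,
      lastTwo, X.sq.lift_fst])

end PreRelCategory

/-- An `S`-relative category, that is, a monoid with respect to the relative pullback product in
the category of spans over `B` whose legs are in `S`. The relative pullbacks `A □ A` and
`(A □ A) □ A` are a choice (they are unique up to isomorphism), ignored by the morphisms. -/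
structure RelCategory (S : AdmissibleSpans C) extends PreRelCategory S where
  unitLeft_d : toPreRelCategory.unitLeft ≫ d = 𝟙 A
  unitRight_d : toPreRelCategory.unitRight ≫ d = 𝟙 A
  assoc : toPreRelCategory.compLeft ≫ d = toPreRelCategory.compRight ≫ d

namespace RelCategory

variable {S : AdmissibleSpans C}

/-- `a □ a`, for a morphism `(b, a)` of reflexive graphs -/
noncomputable def mapSq {X Y : RelCategory S} (f : X.toReflGraph ⟶ Y.toReflGraph) :
    X.sq.pt ⟶ Y.sq.pt :=
  Y.sq.lift (X.sq.fst ≫ f.a) (X.sq.snd ≫ f.a) (S.post f.a f.a X.sq.mem) (by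
    rw [Category.assoc, Category.assoc, f.a_s, f.a_t, ← Category.assoc, ← Category.assoc,
      X.sq.condition])

/-- A relative functor: a morphism of reflexive graphs which is compatible with compositions. -/
@[ext]
structure Hom (X Y : RelCategory S) where
  graph : X.toReflGraph ⟶ Y.toReflGraph
  d_comp : mapSq graph ≫ Y.d = X.d ≫ graph.a

theorem mapSq_id (X : RelCategory S) : mapSq (𝟙 X.toReflGraph) = 𝟙 X.sq.pt := by
  apply X.sq.hom_ext
  · rw [mapSq, X.sq.lift_fst, Category.id_comp]; exact Category.comp_id _
  · rw [mapSq, X.sq.lift_snd, Category.id_comp]; exact Category.comp_id _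

theorem mapSq_comp {X Y Z : RelCategory S} (f : X.toReflGraph ⟶ Y.toReflGraph)
    (g : Y.toReflGraph ⟶ Z.toReflGraph) : mapSq (X := X) (Y := Z) (f ≫ g) =
      mapSq (X := X) (Y := Y) f ≫ mapSq g := by
  apply Z.sq.hom_ext
  · rw [Category.assoc]
    simp only [mapSq, RelPullback.lift_fst]
    rw [← Category.assoc, Y.sq.lift_fst, Category.assoc]; rfl
  · rw [Category.assoc]
    simp only [mapSq, RelPullback.lift_snd]
    rw [← Category.assoc, Y.sq.lift_snd, Category.assoc]; rfl

instance : Category (RelCategory S) where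
  Hom := Hom
  id X := ⟨𝟙 X.toReflGraph, by
    rw [mapSq_id, Category.id_comp]; exact (Category.comp_id _).symm⟩
  comp {X Y Z} f g := ⟨f.graph ≫ g.graph, by
    rw [mapSq_comp, Category.assoc, g.d_comp, ← Category.assoc, f.d_comp, Category.assoc]; rfl⟩
  id_comp f := by apply Hom.ext; exact Category.id_comp _
  comp_id f := by apply Hom.ext; exact Category.comp_id _
  assoc f g h := by apply Hom.ext; exact Category.assoc _ _ _

/-- Forgetting the composition of a relative category. -/
def forget (S : AdmissibleSpans C) : RelCategory S ⥤ ReflGraph C where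
  obj X := X.toReflGraph
  map f := f.graph

end RelCategory

end General

/-! ### Bimonoids -/

section Bimonoids

variable {M : Type u} [Category.{v} M] [MonoidalCategory M] [SymmetricCategory M]

/-- The object of `M` underlying a bimonoid. -/
abbrev car (A : Bimon M) : M := A.X.X

/-- The morphism of `M` underlying a bimonoid morphism. -/
abbrev und {A B : Bimon M} (f : A ⟶ B) : car A ⟶ car B := f.hom.hom

theorem und_mul {A B : Bimon M} (f : A ⟶ B) : μ[car A] ≫ und f = (und f ⊗ₘ und f) ≫ μ[car B] :=
  IsMonHom.mul_hom _

theorem und_one {A B : Bimon M} (f : A ⟶ B) : η[car A] ≫ und f = η[car B] :=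
  IsMonHom.one_hom _

theorem und_comul {A B : Bimon M} (f : A ⟶ B) : und f ≫ Δ[car B] = Δ[car A] ≫ (und f ⊗ₘ und f) :=
  congrArg Mon.Hom.hom (Comon.Hom.isComonHom_hom f).hom_comul

theorem und_counit {A B : Bimon M} (f : A ⟶ B) : und f ≫ ε[car B] = ε[car A] :=
  congrArg Mon.Hom.hom (Comon.Hom.isComonHom_hom f).hom_counit

instance {A B : Bimon M} (f : A ⟶ B) : IsBimonHom (und f) where
  mul_hom := und_mul f
  one_hom := und_one f
  hom_comul := und_comul f
  hom_counit := und_counit f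

/-- A morphism in `M` between bimonoids which respects both structures is a morphism of bimonoids. -/
def ofUnd {A B : Bimon M} (f : car A ⟶ car B) [IsBimonHom f] : A ⟶ B :=
  Comon.Hom.mk' (Mon.Hom.mk' f)
    (by apply Mon.Hom.ext; exact IsComonHom.hom_counit f)
    (by apply Mon.Hom.ext; exact IsComonHom.hom_comul f)

theorem und_ofUnd {A B : Bimon M} (f : car A ⟶ car B) [IsBimonHom f] :
    und (ofUnd f : A ⟶ B) = f := rfl

/-- A span `X ⟵ A ⟶ Y` of bimonoids belongs to the class if its legs `f` and `g` satisfy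
`(f ⊗ g) ∘ δ = (f ⊗ g) ∘ c ∘ δ`, where `c` is the symmetry. -/
def coSpans (M : Type u) [Category.{v} M] [MonoidalCategory M] [SymmetricCategory M] :
    AdmissibleSpans (Bimon M) where
  mem {A _ _} f g :=
    Δ[car A] ≫ (und f ⊗ₘ und g) = Δ[car A] ≫ (β_ (car A) (car A)).hom ≫ (und f ⊗ₘ und g)
  post {A X Y X' Y' f g} f' g' h := by
    change Δ[car A] ≫ ((und f ≫ und f') ⊗ₘ (und g ≫ und g')) =
      Δ[car A] ≫ (β_ (car A) (car A)).hom ≫ ((und f ≫ und f') ⊗ₘ (und g ≫ und g'))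
    rw [← MonoidalCategory.tensorHom_comp_tensorHom, reassoc_of% h]
  pre {A A' X Y f g} h w := by
    change Δ[car A'] ≫ ((und h ≫ und f) ⊗ₘ (und h ≫ und g)) =
      Δ[car A'] ≫ (β_ (car A') (car A')).hom ≫ ((und h ≫ und f) ⊗ₘ (und h ≫ und g))
    rw [← MonoidalCategory.tensorHom_comp_tensorHom, ← BraidedCategory.braiding_naturality_assoc,
      ← reassoc_of% (und_comul h), ← reassoc_of% (und_comul h), w]

/-- `z` is an antipode of the bimonoid `B`. -/
def IsAntipode (B : Bimon M) (z : car B ⟶ car B) : Prop :=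
  Δ[car B] ≫ z ▷ car B ≫ μ[car B] = ε[car B] ≫ η[car B] ∧
    Δ[car B] ≫ car B ◁ z ≫ μ[car B] = ε[car B] ≫ η[car B]

/-- The bimonoid `B` is a Hopf monoid. -/
def IsHopf (B : Bimon M) : Prop := ∃ z : car B ⟶ car B, IsAntipode B z

/-- The cotensor product `A □_B I` as an object of `M`: the equalizer of `(1 ⊗ s) ∘ δ` and `1 ⊗ u`
from `A` to `A ⊗ B`. -/
noncomputable abbrev ker [HasEqualizers M] {A B : Bimon M} (s : A ⟶ B) : M :=
  equalizer (Δ[car A] ≫ car A ◁ und s) ((ρ_ (car A)).inv ≫ car A ◁ η[car B])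

/-- The morphism `q = m ∘ (j ⊗ i) : (A □_B I) ⊗ B ⟶ A`, where `j` is the equalizer morphism. -/
noncomputable def q [HasEqualizers M] (G : ReflGraph (Bimon M)) : ker G.s ⊗ car G.B ⟶ car G.A :=
  (equalizer.ι (Δ[car G.A] ≫ car G.A ◁ und G.s) ((ρ_ (car G.A)).inv ≫ car G.A ◁ η[car G.B]) ⊗ₘ
    und G.i) ≫ μ[car G.A]

/-- The relative categories in the category of bimonoids for which `q` is invertible. -/
def catMon (M : Type u) [Category.{v} M] [MonoidalCategory M] [SymmetricCategory M]
    [HasEqualizers M] : ObjectProperty (RelCategory (coSpans M)) :=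
  fun X => IsIso (q X.toReflGraph)

/-- The reflexive graphs of bimonoids for which the span `A = A ⟶ B` with second leg `s` belongs to
the class, and `q` is invertible. -/
def reflGraphMon (M : Type u) [Category.{v} M] [MonoidalCategory M] [SymmetricCategory M]
    [HasEqualizers M] : ObjectProperty (ReflGraph (Bimon M)) :=
  fun G => (coSpans M).mem (𝟙 G.A) G.s ∧ IsIso (q G)

/-- The morphism `m ∘ (1 ⊗ i) ∘ (1 ⊗ z) ∘ (1 ⊗ s) ∘ δ : A ⟶ A`. -/
def sArrow (G : ReflGraph (Bimon M)) (z : car G.B ⟶ car G.B) : car G.A ⟶ car G.A :=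
  Δ[car G.A] ≫ car G.A ◁ und G.s ≫ car G.A ◁ z ≫ car G.A ◁ und G.i ≫ μ[car G.A]

/-- The morphism `m ∘ (i ⊗ 1) ∘ (z ⊗ 1) ∘ (t ⊗ 1) ∘ δ : A ⟶ A`. -/
def tArrow (G : ReflGraph (Bimon M)) (z : car G.B ⟶ car G.B) : car G.A ⟶ car G.A :=
  Δ[car G.A] ≫ und G.t ▷ car G.A ≫ z ▷ car G.A ≫ und G.i ▷ car G.A ≫ μ[car G.A]

/-- `B` has an antipode `z`, the comultiplication of `A` satisfies
`(t ⊗ 1) ∘ δ = (t ⊗ 1) ∘ c ∘ δ`, and the images of `sArrow` and `tArrow` commute. -/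
def Villanueva (G : ReflGraph (Bimon M)) : Prop :=
  ∃ z : car G.B ⟶ car G.B, IsAntipode G.B z ∧
    Δ[car G.A] ≫ und G.t ▷ car G.A =
      Δ[car G.A] ≫ (β_ (car G.A) (car G.A)).hom ≫ und G.t ▷ car G.A ∧
    (sArrow G z ⊗ₘ tArrow G z) ≫ (β_ (car G.A) (car G.A)).hom ≫ μ[car G.A] =
      (sArrow G z ⊗ₘ tArrow G z) ≫ μ[car G.A]

/-! ### Crossed modules of bimonoids -/

/-- For `l : B ⊗ Y ⟶ Y`, the morphism `(l ⊗ 1) ∘ (1 ⊗ c) ∘ (δ ⊗ 1) : B ⊗ Y ⟶ Y ⊗ B`. -/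
def exchange {B Y : Bimon M} (l : car B ⊗ car Y ⟶ car Y) : car B ⊗ car Y ⟶ car Y ⊗ car B :=
  Δ[car B] ▷ car Y ≫ (α_ _ _ _).hom ≫ car B ◁ (β_ (car B) (car Y)).hom ≫ (α_ _ _ _).inv ≫
    l ▷ car B

/-- The diagonal action of `B` on `Y ⊗ Y` induced by `l : B ⊗ Y ⟶ Y`. -/
def diagonal {B Y : Bimon M} (l : car B ⊗ car Y ⟶ car Y) :
    car B ⊗ (car Y ⊗ car Y) ⟶ car Y ⊗ car Y :=
  Δ[car B] ▷ (car Y ⊗ car Y) ≫ tensorμ (car B) (car B) (car Y) (car Y) ≫ (l ⊗ₘ l)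

/-- A crossed module of bimonoids: a cocommutative bimonoid `B`, a bimonoid `Y` which is a
`B`-module monoid and a `B`-module comonoid via the left action `l`, and a bimonoid morphism
`k : Y ⟶ B`, satisfying the conditions below. -/
structure XMod (M : Type u) [Category.{v} M] [MonoidalCategory M] [SymmetricCategory M] where
  B : Bimon M
  Y : Bimon M
  l : car B ⊗ car Y ⟶ car Y
  k : Y ⟶ B
  cocomm : IsCommComonObj (car B)
  one_act : η[car B] ▷ car Y ≫ l = (λ_ (car Y)).hom
  mul_act : μ[car B] ▷ car Y ≫ l = (α_ (car B) (car B) (car Y)).hom ≫ car B ◁ l ≫ l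
  act_one : car B ◁ η[car Y] ≫ l = (ρ_ (car B)).hom ≫ ε[car B] ≫ η[car Y]
  act_mul : car B ◁ μ[car Y] ≫ l = diagonal l ≫ μ[car Y]
  act_counit : l ≫ ε[car Y] = (ε[car B] ⊗ₘ ε[car Y]) ≫ (λ_ (𝟙_ M)).hom
  act_comul : l ≫ Δ[car Y] = car B ◁ Δ[car Y] ≫ diagonal l
  /-- `(k ⊗ 1) ∘ c ∘ δ = (k ⊗ 1) ∘ δ` -/
  k_comul : Δ[car Y] ≫ (β_ (car Y) (car Y)).hom ≫ und k ▷ car Y = Δ[car Y] ≫ und k ▷ car Y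
  /-- `m ∘ (k ⊗ 1) ∘ (l ⊗ 1) ∘ (1 ⊗ c) ∘ (δ ⊗ 1) = m ∘ (1 ⊗ k)` -/
  k_act : exchange l ≫ und k ▷ car B ≫ μ[car B] = car B ◁ und k ≫ μ[car B]
  /-- The Peiffer condition `m ∘ (l ⊗ 1) ∘ (k ⊗ 1 ⊗ 1) ∘ (1 ⊗ c) ∘ (δ ⊗ 1) = m` -/
  peiffer : Δ[car Y] ▷ car Y ≫ (α_ _ _ _).hom ≫ car Y ◁ (β_ (car Y) (car Y)).hom ≫
    (α_ _ _ _).inv ≫ (und k ▷ car Y) ▷ car Y ≫ l ▷ car Y ≫ μ[car Y] = μ[car Y]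

namespace XMod

/-- A morphism of crossed modules: a pair of bimonoid morphisms compatible with the actions and
with the morphisms `k`. -/
@[ext]
structure Hom (X X' : XMod M) where
  b : X.B ⟶ X'.B
  y : X.Y ⟶ X'.Y
  k_comp : y ≫ X'.k = X.k ≫ b
  l_comp : (und b ⊗ₘ und y) ≫ X'.l = X.l ≫ und y

instance : Category (XMod M) where
  Hom := Hom
  id X := ⟨𝟙 _, 𝟙 _, by simp, by
    change (𝟙 (car X.B) ⊗ₘ 𝟙 (car X.Y)) ≫ X.l = X.l ≫ 𝟙 (car X.Y)
    simp⟩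
  comp f g := ⟨f.b ≫ g.b, f.y ≫ g.y,
    by rw [Category.assoc, g.k_comp, ← Category.assoc, f.k_comp, Category.assoc], by
    change ((und f.b ≫ und g.b) ⊗ₘ (und f.y ≫ und g.y)) ≫ _ = _ ≫ und f.y ≫ und g.y
    rw [← MonoidalCategory.tensorHom_comp_tensorHom, Category.assoc, g.l_comp, ← Category.assoc,
      f.l_comp, Category.assoc]⟩
  id_comp f := by apply Hom.ext <;> simp
  comp_id f := by apply Hom.ext <;> simp
  assoc f g h := by apply Hom.ext <;> simp

/-- The functor sending a crossed module `k : Y ⟶ B` to `B`. -/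
def base : XMod M ⥤ Bimon M where
  obj X := X.B
  map f := f.b

/-- The functor sending a crossed module `k : Y ⟶ B` to `Y`. -/
def fibre : XMod M ⥤ Bimon M where
  obj X := X.Y
  map f := f.y

end XMod

/-- Suppose given a reflexive graph `G` of bimonoids and a crossed module `X`, with bimonoid
morphisms `b` between the objects `B` and `j` from `Y` to `A`. The data exhibit `X` as the crossed
module of `G` if `j` is the cotensor product `A □_B I` (that is, the equalizer of `(1 ⊗ s) ∘ δ` and
`1 ⊗ u`), if `k` corresponds to `t ∘ j`, and if the action `l` is determined by the multiplication
of `A`: in terms of elements, `i(b) j(y) = ∑ j(b₁ y) i(b₂)`. -/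
structure IsCrossedModuleOf (G : ReflGraph (Bimon M)) (X : XMod M) (b : X.B ⟶ G.B)
    (j : X.Y ⟶ G.A) : Prop where
  condition : und j ≫ (Δ[car G.A] ≫ car G.A ◁ und G.s) =
    und j ≫ ((ρ_ (car G.A)).inv ≫ car G.A ◁ η[car G.B])
  isLimit : Nonempty (IsLimit (Fork.ofι (und j) condition))
  k_comp : X.k ≫ b = j ≫ G.t
  act : (und (b ≫ G.i) ⊗ₘ und j) ≫ μ[car G.A] =
    exchange X.l ≫ (und j ⊗ₘ und (b ≫ G.i)) ≫ μ[car G.A]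

/-! ### The three categories -/

section Three

variable (M) [HasEqualizers M]

/-- Relative categories in bimonoids with `q` invertible and `B` a Hopf monoid. -/
def hopfCat : ObjectProperty (RelCategory (coSpans M)) :=
  fun X => catMon M X ∧ IsHopf X.B

/-- Crossed modules of bimonoids with `B` a Hopf monoid. -/
def hopfXMod (M : Type u) [Category.{v} M] [MonoidalCategory M] [SymmetricCategory M] :
    ObjectProperty (XMod M) :=
  fun X => IsHopf X.B

/-- The objects of `reflGraphMon` with `B` a Hopf monoid which satisfy the condition on `t` and the
commutation condition. -/
def hopfGraph : ObjectProperty (ReflGraph (Bimon M)) :=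
  fun G => reflGraphMon M G ∧ Villanueva G

end Three

end Bimonoids

end RelXMod

/-! Computations are carried out in the convolution monoids of morphisms from a comonoid to a
monoid. Through `pair`, `copair`, `fst`, `snd`, `inl` and `inr`, a diagram in `M` becomes a product
of simple factors, and the basic rearrangement is swapping two neighbours. `Coc.commute` permits it:
`f ≫ a` and `g ≫ b` commute when the span `(f, g)` is in the class (`Coc`) and the images of `a` and
`b` commute (`ComIm`). Uniqueness of inverses gives most properties of antipodes.

If `B` is Hopf, put σ(a) = a₁ · izs(a₂) (`sArr`). It lands in the kernel `Y` of `s`, fixes `Y`, and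
satisfies a = σ(a₁) · is(a₂) (`sArr_pair`, `comp_sArr_of_pair_eq`, `sArr_mul`). So `A` is `Y ⊗ B` as
a comonoid, and `q` is invertible automatically (`isIso_copair`).

Categories 1 and 3. In a relative category, the identity of `A □ A` is the convolution product of σ
on the first factor followed by `1 □ i` and of the second projection followed by `i □ 1`. Applying
`d` and the unit laws forces d(a, a') = σ(a) · a' (`RelCategory.und_d`), so every graph morphism is
a functor. The images of σ and τ (`tArr`) commute because `1 □ i` and `i □ 1` send them to different
tensor factors (`RelCategory.isHopfGraph`). Conversely, this commutation makes the formula for `d`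
multiplicative (`isBimonHom_comp_sArr_mul`). The relative pullbacks exist as equalizers in `A ⊗ D`
(`exists_relPullback`).

Categories 3 and 2. The kernel `Y` carries the adjoint action of `B`; the Peiffer identity is the
commutation of σ and τ restricted to `Y` (`IsKer.peiffer`). The rule i(b) j(y) = j(b₁ y) i(b₂)
identifies the multiplication of `A` with that of a smash product, so bimonoid morphisms out of `A`
are given by compatible pairs on `Y` and `B`; this makes the functor fully faithful
(`exists_of_ker`). For essential surjectivity, the smash product of a crossed module receives t(y b)
= k(y) b, and Peiffer together with the exchange rule gives back the commutation condition
(`IsSmash.comIm_sArr_tArr`). The Hopf and cocommutative refinements follow from the decomposition of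
`A` into `Y` and `B`. -/

namespace RelXMod

/-! ### Convolution monoids, pairings, projections and inclusions -/

section Convolution

variable {M : Type u} [Category.{v} M] [MonoidalCategory M]

/-- Morphisms from a comonoid to a monoid form a monoid under convolution. -/
instance convMonoid (C R : M) [ComonObj C] [MonObj R] : Monoid (C ⟶ R) :=
  inferInstanceAs (Monoid (Conv C R))

/-- The morphism `C ⟶ X ⊗ Y` with components `f` and `g`. -/
def pair {C X Y : M} [ComonObj C] (f : C ⟶ X) (g : C ⟶ Y) : C ⟶ X ⊗ Y := Δ[C] ≫ (f ⊗ₘ g)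

/-- The morphism `X ⊗ Y ⟶ R` with components `f` and `g`. -/
def copair {R X Y : M} [MonObj R] (f : X ⟶ R) (g : Y ⟶ R) : X ⊗ Y ⟶ R := (f ⊗ₘ g) ≫ μ[R]

theorem mul_def {C R : M} [ComonObj C] [MonObj R] (f g : C ⟶ R) :
    f * g = Δ[C] ≫ (f ⊗ₘ g) ≫ μ[R] := by
  rw [MonoidalCategory.tensorHom_def, Category.assoc]; rfl

theorem one_def {C R : M} [ComonObj C] [MonObj R] : (1 : C ⟶ R) = ε[C] ≫ η[R] := rfl

theorem pair_copair {C X Y R : M} [ComonObj C] [MonObj R] (f : C ⟶ X) (g : C ⟶ Y)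
    (a : X ⟶ R) (b : Y ⟶ R) : pair f g ≫ copair a b = (f ≫ a) * (g ≫ b) := by
  simp [pair, copair, mul_def]

theorem pair_mul {C R : M} [ComonObj C] [MonObj R] (f g : C ⟶ R) :
    pair f g ≫ μ[R] = f * g := by
  simp [pair, mul_def]

theorem comul_copair {C R : M} [ComonObj C] [MonObj R] (f g : C ⟶ R) :
    Δ[C] ≫ copair f g = f * g := by
  simp [copair, mul_def]

theorem pair_tensorHom {C X Y X' Y' : M} [ComonObj C] (f : C ⟶ X) (g : C ⟶ Y)
    (a : X ⟶ X') (b : Y ⟶ Y') : pair f g ≫ (a ⊗ₘ b) = pair (f ≫ a) (g ≫ b) := by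
  simp [pair]

theorem tensorHom_copair {R X Y X' Y' : M} [MonObj R] (f : X ⟶ R) (g : Y ⟶ R)
    (a : X' ⟶ X) (b : Y' ⟶ Y) : (a ⊗ₘ b) ≫ copair f g = copair (a ≫ f) (b ≫ g) := by
  simp [copair]

theorem comp_pair {C D X Y : M} [ComonObj C] [ComonObj D] (h : D ⟶ C) [IsComonHom h]
    (f : C ⟶ X) (g : C ⟶ Y) : h ≫ pair f g = pair (h ≫ f) (h ≫ g) := by
  simp [pair]

theorem copair_comp {R S X Y : M} [MonObj R] [MonObj S] (h : R ⟶ S) [IsMonHom h]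
    (f : X ⟶ R) (g : Y ⟶ R) : copair f g ≫ h = copair (f ≫ h) (g ≫ h) := by
  simp [copair]

theorem mul_cancel_left {C R : M} [ComonObj C] [MonObj R] {a b : C ⟶ R} (h : a * b = 1)
    (c : C ⟶ R) : a * (b * c) = c := by
  rw [← mul_assoc, h, one_mul]

theorem comp_mul {C D R : M} [ComonObj C] [ComonObj D] [MonObj R] (h : D ⟶ C) [IsComonHom h]
    (f g : C ⟶ R) : h ≫ (f * g) = (h ≫ f) * (h ≫ g) := by
  simp [mul_def]

theorem mul_comp {C R S : M} [ComonObj C] [MonObj R] [MonObj S] (f g : C ⟶ R)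
    (h : R ⟶ S) [IsMonHom h] : (f * g) ≫ h = (f ≫ h) * (g ≫ h) := by
  simp [mul_def]

theorem comp_one {C D R : M} [ComonObj C] [ComonObj D] [MonObj R] (h : D ⟶ C) [IsComonHom h] :
    h ≫ (1 : C ⟶ R) = 1 := by
  simp [one_def]

theorem one_comp {C R S : M} [ComonObj C] [MonObj R] [MonObj S] (h : R ⟶ S) [IsMonHom h] :
    (1 : C ⟶ R) ≫ h = 1 := by
  simp [one_def]

/-- `X ⟶ X ⊗ Y` -/
def inl (X Y : M) [MonObj Y] : X ⟶ X ⊗ Y := (ρ_ X).inv ≫ X ◁ η[Y]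

/-- `Y ⟶ X ⊗ Y` -/
def inr (X Y : M) [MonObj X] : Y ⟶ X ⊗ Y := (λ_ Y).inv ≫ η[X] ▷ Y

/-- `X ⊗ Y ⟶ X` -/
def fst (X Y : M) [ComonObj Y] : X ⊗ Y ⟶ X := X ◁ ε[Y] ≫ (ρ_ X).hom

/-- `X ⊗ Y ⟶ Y` -/
def snd (X Y : M) [ComonObj X] : X ⊗ Y ⟶ Y := ε[X] ▷ Y ≫ (λ_ Y).hom

theorem pair_fst {C X Y : M} [ComonObj C] [ComonObj Y] (f : C ⟶ X) (g : C ⟶ Y) [IsComonHom g] :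
    pair f g ≫ fst X Y = f := by
  simp [pair, fst, ← id_tensorHom]

theorem pair_snd {C X Y : M} [ComonObj C] [ComonObj X] (f : C ⟶ X) (g : C ⟶ Y) [IsComonHom f] :
    pair f g ≫ snd X Y = g := by
  simp [pair, snd, ← tensorHom_id]

theorem inl_copair {X Y R : M} [MonObj Y] [MonObj R] (f : X ⟶ R) (g : Y ⟶ R) [IsMonHom g] :
    inl X Y ≫ copair f g = f := by
  simp [copair, inl, ← id_tensorHom]

theorem inr_copair {X Y R : M} [MonObj X] [MonObj R] (f : X ⟶ R) (g : Y ⟶ R) [IsMonHom f] :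
    inr X Y ≫ copair f g = g := by
  simp [copair, inr, ← tensorHom_id]

theorem tensorHom_fst {X X' Y Y' : M} [ComonObj Y] [ComonObj Y'] (f : X ⟶ X') (g : Y ⟶ Y')
    [IsComonHom g] : (f ⊗ₘ g) ≫ fst X' Y' = fst X Y ≫ f := by
  rw [MonoidalCategory.tensorHom_def', fst, Category.assoc, ← whisker_exchange_assoc,
    ← MonoidalCategory.whiskerLeft_comp_assoc, IsComonHom.hom_counit]
  simp [fst]

theorem tensorHom_snd {X X' Y Y' : M} [ComonObj X] [ComonObj X'] (f : X ⟶ X') (g : Y ⟶ Y')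
    [IsComonHom f] : (f ⊗ₘ g) ≫ snd X' Y' = snd X Y ≫ g := by
  rw [MonoidalCategory.tensorHom_def, snd, Category.assoc, whisker_exchange_assoc,
    ← comp_whiskerRight_assoc, IsComonHom.hom_counit]
  simp [snd]

theorem whiskerLeft_fst {X Y Y' : M} [ComonObj Y] [ComonObj Y'] (g : Y ⟶ Y')
    [IsComonHom g] : X ◁ g ≫ fst X Y' = fst X Y := by
  rw [← id_tensorHom, tensorHom_fst, Category.comp_id]

theorem whiskerLeft_snd {X Y Y' : M} [ComonObj X] (g : Y ⟶ Y') :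
    X ◁ g ≫ snd X Y' = snd X Y ≫ g := by
  rw [← id_tensorHom, tensorHom_snd]

theorem whiskerRight_fst {X X' Y : M} [ComonObj Y] (f : X ⟶ X') :
    f ▷ Y ≫ fst X' Y = fst X Y ≫ f := by
  rw [← tensorHom_id, tensorHom_fst]

theorem whiskerRight_snd {X X' Y : M} [ComonObj X] [ComonObj X'] (f : X ⟶ X')
    [IsComonHom f] : f ▷ Y ≫ snd X' Y = snd X Y := by
  rw [← tensorHom_id, tensorHom_snd, Category.comp_id]

theorem inl_eq_pair (X Y : M) [ComonObj X] [MonObj Y] : inl X Y = pair (𝟙 X) 1 := by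
  simp [pair, one_def, inl]

theorem inr_eq_pair (X Y : M) [MonObj X] [ComonObj Y] : inr X Y = pair 1 (𝟙 Y) := by
  simp [pair, one_def, inr]

section

attribute [local instance] ComonObj.instTensorUnit

theorem isComonHom_counit (X : M) [ComonObj X] : IsComonHom ε[X] :=
  (default : Comon.mk X ⟶ Comon.trivial M).isComonHom_hom

end

theorem isMonHom_unit (X : M) [MonObj X] : IsMonHom η[X] where
  mul_hom := by simp [← unitors_equal]

theorem associator_snd_fst (X Y Z : M) [ComonObj X] [ComonObj Z] :
    (α_ X Y Z).hom ≫ snd X (Y ⊗ Z) ≫ fst Y Z = fst (X ⊗ Y) Z ≫ snd X Y := by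
  have h : (α_ X Y Z).hom ≫ snd X (Y ⊗ Z) = snd X Y ▷ Z := by simp [snd]
  rw [reassoc_of% h, whiskerRight_fst]

theorem tensorHom_fst_assoc {X X' Y Y' : M} [ComonObj Y] [ComonObj Y'] (f : X ⟶ X')
    (g : Y ⟶ Y') [IsComonHom g] {W : M}
    (k : X' ⟶ W) : (f ⊗ₘ g) ≫ fst X' Y' ≫ k = fst X Y ≫ f ≫ k := by
  simpa only [Category.assoc, Category.id_comp] using congrArg (· ≫ k) (tensorHom_fst f g)

theorem tensorHom_snd_assoc {X X' Y Y' : M} [ComonObj X] [ComonObj X'] (f : X ⟶ X')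
    (g : Y ⟶ Y') [IsComonHom f] {W : M}
    (k : Y' ⟶ W) : (f ⊗ₘ g) ≫ snd X' Y' ≫ k = snd X Y ≫ g ≫ k := by
  simpa only [Category.assoc, Category.id_comp] using congrArg (· ≫ k) (tensorHom_snd f g)

theorem whiskerLeft_fst_assoc {X Y Y' : M} [ComonObj Y] [ComonObj Y'] (g : Y ⟶ Y')
    [IsComonHom g] {W : M}
    (k : X ⟶ W) : X ◁ g ≫ fst X Y' ≫ k = fst X Y ≫ k := by
  simpa only [Category.assoc, Category.id_comp] using congrArg (· ≫ k) (whiskerLeft_fst g)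

theorem whiskerLeft_snd_assoc {X Y Y' : M} [ComonObj X] (g : Y ⟶ Y') {W : M}
    (k : Y' ⟶ W) : X ◁ g ≫ snd X Y' ≫ k = snd X Y ≫ g ≫ k := by
  simpa only [Category.assoc, Category.id_comp] using congrArg (· ≫ k) (whiskerLeft_snd g)

theorem whiskerRight_fst_assoc {X X' Y : M} [ComonObj Y] (f : X ⟶ X') {W : M}
    (k : X' ⟶ W) : f ▷ Y ≫ fst X' Y ≫ k = fst X Y ≫ f ≫ k := by
  simpa only [Category.assoc, Category.id_comp] using congrArg (· ≫ k) (whiskerRight_fst f)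

theorem whiskerRight_snd_assoc {X X' Y : M} [ComonObj X] [ComonObj X'] (f : X ⟶ X')
    [IsComonHom f] {W : M}
    (k : Y ⟶ W) : f ▷ Y ≫ snd X' Y ≫ k = snd X Y ≫ k := by
  simpa only [Category.assoc, Category.id_comp] using congrArg (· ≫ k) (whiskerRight_snd f)

theorem associator_snd_fst_assoc (X Y Z : M) [ComonObj X] [ComonObj Z] {W : M}
    (k : Y ⟶ W) : (α_ X Y Z).hom ≫ snd X (Y ⊗ Z) ≫ fst Y Z ≫ k = fst (X ⊗ Y) Z ≫ snd X Y ≫ k := by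
  simpa only [Category.assoc, Category.id_comp] using congrArg (· ≫ k) (associator_snd_fst X Y Z)

end Convolution

/-! ### Tensor products of comonoids, monoids and bimonoids in the symmetric case -/

section Symmetric

variable {M : Type u} [Category.{v} M] [MonoidalCategory M] [SymmetricCategory M]

/-- The tensor product of monoids. -/
instance tensorMon (X Y : M) [MonObj X] [MonObj Y] : MonObj (X ⊗ Y) :=
  MonObj.tensorObj.instTensorObj

theorem tensor_mul (X Y : M) [MonObj X] [MonObj Y] :
    μ[X ⊗ Y] = tensorμ X Y X Y ≫ (μ[X] ⊗ₘ μ[Y]) := rfl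

theorem tensor_one (X Y : M) [MonObj X] [MonObj Y] :
    η[X ⊗ Y] = (λ_ (𝟙_ M)).inv ≫ (η[X] ⊗ₘ η[Y]) := rfl

instance isComonHom_tensorHom {X Y X' Y' : M} [ComonObj X] [ComonObj Y] [ComonObj X'] [ComonObj Y']
    (f : X ⟶ X') (g : Y ⟶ Y') [IsComonHom f] [IsComonHom g] : IsComonHom (f ⊗ₘ g) where
  hom_counit := by simp
  hom_comul := by
    simp only [Comon.tensorObj_comul, Category.assoc, tensorHom_comp_tensorHom_assoc,
      IsComonHom.hom_comul, ← tensorμ_natural]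

instance isComonHom_whiskerLeft {X Y Y' : M} [ComonObj X] [ComonObj Y] [ComonObj Y']
    (g : Y ⟶ Y') [IsComonHom g] : IsComonHom (X ◁ g) := by
  rw [← id_tensorHom]; infer_instance

instance isComonHom_whiskerRight {X X' Y : M} [ComonObj X] [ComonObj X'] [ComonObj Y]
    (f : X ⟶ X') [IsComonHom f] : IsComonHom (f ▷ Y) := by
  rw [← tensorHom_id]; infer_instance

instance isComonHom_associator (X Y Z : M) [ComonObj X] [ComonObj Y] [ComonObj Z] :
    IsComonHom (α_ X Y Z).hom where
  hom_counit := by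
    simp only [Comon.tensorObj_counit]
    monoidal
  hom_comul := by
    simp only [Comon.tensorObj_comul, Category.assoc]
    have h := tensor_associativity X X Y Y Z Z
    calc (α_ X Y Z).hom ≫ (Δ[X] ⊗ₘ (Δ[Y] ⊗ₘ Δ[Z]) ≫ tensorμ Y Y Z Z) ≫ tensorμ X X (Y ⊗ Z) (Y ⊗ Z)
        = ((Δ[X] ⊗ₘ Δ[Y]) ⊗ₘ Δ[Z]) ≫ (α_ _ _ _).hom ≫
            (X ⊗ X) ◁ tensorμ Y Y Z Z ≫ tensorμ X X (Y ⊗ Z) (Y ⊗ Z) := by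
          rw [associator_naturality_assoc, ← id_tensorHom, tensorHom_comp_tensorHom_assoc,
            Category.comp_id]
      _ = _ := by
          rw [← h, ← tensorHom_id, tensorHom_comp_tensorHom_assoc, Category.comp_id]

section

attribute [local instance] ComonObj.instTensorUnit

theorem isComonHom_rightUnitor (X : M) [ComonObj X] : IsComonHom (ρ_ X).hom where
  hom_counit := by simp [unitors_equal]
  hom_comul := by
    rw [← rightUnitor_naturality, tensor_right_unitality, Comon.tensorObj_comul,
      show Δ[𝟙_ M] = (λ_ (𝟙_ M)).inv from rfl, MonoidalCategory.tensorHom_def Δ[X]]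
    simp only [Category.assoc]

theorem isComonHom_leftUnitor (X : M) [ComonObj X] : IsComonHom (λ_ X).hom where
  hom_counit := by simp
  hom_comul := by
    rw [← leftUnitor_naturality, tensor_left_unitality, Comon.tensorObj_comul,
      show Δ[𝟙_ M] = (λ_ (𝟙_ M)).inv from rfl, MonoidalCategory.tensorHom_def' _ Δ[X]]
    simp only [Category.assoc]

theorem isComonHom_one (X : M) [BimonObj X] : IsComonHom η[X] where
  hom_comul := by simp [Mon.one_def]

instance isComonHom_fst (X Y : M) [ComonObj X] [ComonObj Y] : IsComonHom (fst X Y) := by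
  have := isComonHom_counit Y
  have := isComonHom_rightUnitor X
  unfold fst; infer_instance

instance isComonHom_snd (X Y : M) [ComonObj X] [ComonObj Y] : IsComonHom (snd X Y) := by
  have := isComonHom_counit X
  have := isComonHom_leftUnitor Y
  unfold snd; infer_instance

instance isComonHom_inl (X Y : M) [ComonObj X] [BimonObj Y] : IsComonHom (inl X Y) := by
  have := isComonHom_one Y
  have := isComonHom_rightUnitor X
  unfold inl; infer_instance

instance isComonHom_inr (X Y : M) [BimonObj X] [ComonObj Y] : IsComonHom (inr X Y) := by
  have := isComonHom_one X
  have := isComonHom_leftUnitor Y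
  unfold inr; infer_instance

end

instance isMonHom_counit (X : M) [BimonObj X] : IsMonHom ε[X] where
  one_hom := by simp
  mul_hom := by simp

instance isMonHom_comul (X : M) [BimonObj X] : IsMonHom Δ[X] where
  one_hom := BimonObj.one_comul X
  mul_hom := BimonObj.mul_comul X

instance isComonHom_mul (X : M) [BimonObj X] : IsComonHom μ[X] where
  hom_counit := BimonObj.mul_counit X
  hom_comul := by rw [BimonObj.mul_comul, Comon.tensorObj_comul, Category.assoc]

instance isMonHom_fst (X Y : M) [MonObj X] [BimonObj Y] : IsMonHom (fst X Y) := by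
  unfold fst; infer_instance

instance isMonHom_snd (X Y : M) [BimonObj X] [MonObj Y] : IsMonHom (snd X Y) := by
  unfold snd; infer_instance

instance isMonHom_inl (X Y : M) [MonObj X] [MonObj Y] : IsMonHom (inl X Y) := by
  have := isMonHom_unit Y
  unfold inl; infer_instance

instance isMonHom_inr (X Y : M) [MonObj X] [MonObj Y] : IsMonHom (inr X Y) := by
  have := isMonHom_unit X
  unfold inr; infer_instance

instance isMonHom_tensorμ (X Y X' Y' : M) [MonObj X] [MonObj Y] [MonObj X'] [MonObj Y'] :
    IsMonHom (tensorμ X Y X' Y') := by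
  unfold tensorμ; infer_instance

instance bimonTensor (X Y : M) [BimonObj X] [BimonObj Y] : BimonObj (X ⊗ Y) :=
  have h : IsMonHom Δ[X ⊗ Y] := by
    rw [Comon.tensorObj_comul]; infer_instance
  have h' : IsMonHom ε[X ⊗ Y] := by
    rw [Comon.tensorObj_counit]; infer_instance
  { mul_comul := h.mul_hom
    one_comul := h.one_hom
    mul_counit := h'.mul_hom
    one_counit := h'.one_hom }

theorem tensorμ_unit (X Y : M) : tensorμ X (𝟙_ M) (𝟙_ M) Y = 𝟙 _ := by
  rw [tensorμ, braiding_tensorUnit_left]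
  monoidal

/-- With trivial outer factors the middle-four shuffle reduces to the braiding; this is how the
symmetry arises in `pair_snd_fst` and `copair_inr_inl`. -/
theorem tensorμ_unit' (X Y : M) :
    tensorμ (𝟙_ M) X Y (𝟙_ M) = ((λ_ X).hom ⊗ₘ (ρ_ Y).hom) ≫ (β_ X Y).hom ≫
      ((λ_ Y).inv ⊗ₘ (ρ_ X).inv) := by
  rw [tensorμ]
  calc _ = 𝟙 _ ⊗≫ (β_ X Y).hom ⊗≫ 𝟙 _ := by monoidal
    _ = _ := by monoidal

theorem pair_fst_snd (X Y : M) [ComonObj X] [ComonObj Y] :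
    pair (fst X Y) (snd X Y) = 𝟙 (X ⊗ Y) := by
  have h : (X ◁ ε[Y] ⊗ₘ ε[X] ▷ Y) = (𝟙 X ⊗ₘ ε[Y]) ⊗ₘ (ε[X] ⊗ₘ 𝟙 Y) := by simp
  rw [pair, fst, snd, ← tensorHom_comp_tensorHom, Comon.tensorObj_comul, Category.assoc, h,
    ← tensorμ_natural_assoc, tensorμ_unit]
  simp

theorem pair_snd_fst (X Y : M) [ComonObj X] [ComonObj Y] :
    pair (snd X Y) (fst X Y) = (β_ X Y).hom := by
  have h : (ε[X] ▷ Y ⊗ₘ X ◁ ε[Y]) = (ε[X] ⊗ₘ 𝟙 Y) ⊗ₘ (𝟙 X ⊗ₘ ε[Y]) := by simp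
  rw [pair, fst, snd, ← tensorHom_comp_tensorHom, Comon.tensorObj_comul, Category.assoc, h,
    ← tensorμ_natural_assoc, tensorμ_unit']
  simp only [tensorHom_comp_tensorHom_assoc, tensorHom_comp_tensorHom, Category.assoc,
    Iso.inv_hom_id, id_tensorHom_id, Category.comp_id, ComonObj.counit_comul_hom_assoc,
    ComonObj.comul_counit_hom_assoc, Category.id_comp]

theorem copair_inl_inr (X Y : M) [MonObj X] [MonObj Y] :
    copair (inl X Y) (inr X Y) = 𝟙 (X ⊗ Y) := by
  have h : (X ◁ η[Y] ⊗ₘ η[X] ▷ Y) = (𝟙 X ⊗ₘ η[Y]) ⊗ₘ (η[X] ⊗ₘ 𝟙 Y) := by simp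
  rw [copair, inl, inr, ← tensorHom_comp_tensorHom, tensor_mul, Category.assoc, h,
    tensorμ_natural_assoc, tensorμ_unit]
  simp

theorem copair_inr_inl (X Y : M) [MonObj X] [MonObj Y] :
    copair (inr X Y) (inl X Y) = (β_ Y X).hom := by
  have h : (η[X] ▷ Y ⊗ₘ X ◁ η[Y]) = (η[X] ⊗ₘ 𝟙 Y) ⊗ₘ (𝟙 X ⊗ₘ η[Y]) := by simp
  rw [copair, inl, inr, ← tensorHom_comp_tensorHom, tensor_mul, Category.assoc, h,
    tensorμ_natural_assoc, tensorμ_unit']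
  simp only [tensorHom_comp_tensorHom_assoc, tensorHom_comp_tensorHom, Category.assoc,
    id_tensorHom, tensorHom_id]
  simp

end Symmetric

/-! ### Calculus of convolution products and of commuting morphisms -/

section Calculus

variable {M : Type u} [Category.{v} M] [MonoidalCategory M] [SymmetricCategory M]

theorem pair_eq_mul {C X Y : M} [ComonObj C] [MonObj X] [MonObj Y] (f : C ⟶ X) (g : C ⟶ Y) :
    pair f g = (f ≫ inl X Y) * (g ≫ inr X Y) := by
  rw [← pair_copair, copair_inl_inr, Category.comp_id]

theorem copair_eq_mul {X Y R : M} [ComonObj X] [ComonObj Y] [MonObj R] (f : X ⟶ R) (g : Y ⟶ R) :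
    copair f g = (fst X Y ≫ f) * (snd X Y ≫ g) := by
  rw [← pair_copair, pair_fst_snd, Category.id_comp]

theorem mul_eq_fst_mul_snd (R : M) [BimonObj R] : μ[R] = fst R R * snd R R := by
  rw [← pair_mul, pair_fst_snd, Category.id_comp]

theorem comul_eq_inl_mul_inr (R : M) [BimonObj R] : Δ[R] = inl R R * inr R R := by
  rw [← comul_copair, copair_inl_inr, Category.comp_id]

theorem mul_comp_eq {R S : M} [BimonObj R] [MonObj S] (f : R ⟶ S) [IsMonHom f] :
    μ[R] ≫ f = (fst R R ≫ f) * (snd R R ≫ f) := by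
  rw [mul_eq_fst_mul_snd, mul_comp]

theorem comp_comul_eq {R S : M} [BimonObj R] [ComonObj S] (f : S ⟶ R) [IsComonHom f] :
    f ≫ Δ[R] = (f ≫ inl R R) * (f ≫ inr R R) := by
  rw [comul_eq_inl_mul_inr, comp_mul]

theorem isMonHom_of_mul {R S : M} [BimonObj R] [MonObj S] (f : R ⟶ S) (h₁ : η[R] ≫ f = η[S])
    (h₂ : μ[R] ≫ f = (fst R R ≫ f) * (snd R R ≫ f)) : IsMonHom f :=
  ⟨h₁, by rw [h₂, ← copair_eq_mul]; rfl⟩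

theorem isComonHom_of_comul {R S : M} [BimonObj R] [ComonObj S] (f : S ⟶ R)
    (h₁ : f ≫ ε[R] = ε[S]) (h₂ : f ≫ Δ[R] = (f ≫ inl R R) * (f ≫ inr R R)) : IsComonHom f :=
  ⟨h₁, by rw [h₂, ← pair_eq_mul]; rfl⟩

/-! ### Projections and inclusions -/

theorem inl_fst (X Y : M) [BimonObj Y] : inl X Y ≫ fst X Y = 𝟙 X := by
  simp [inl, fst, ← MonoidalCategory.whiskerLeft_comp_assoc]

theorem inr_snd (X Y : M) [BimonObj X] : inr X Y ≫ snd X Y = 𝟙 Y := by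
  simp [inr, snd, ← comp_whiskerRight_assoc]

theorem inl_snd (X Y : M) [ComonObj X] [MonObj Y] : inl X Y ≫ snd X Y = 1 := by
  simp [inl, snd, one_def, whisker_exchange_assoc, unitors_equal]

theorem inr_fst (X Y : M) [MonObj X] [ComonObj Y] : inr X Y ≫ fst X Y = 1 := by
  simp [inr, fst, one_def, ← whisker_exchange_assoc, ← unitors_equal]

theorem whiskerLeft_fst_fst (X Y Z : M) [ComonObj Y] [ComonObj Z] :
    X ◁ fst Y Z ≫ fst X Y = fst X (Y ⊗ Z) := by
  have h := IsComonHom.hom_counit (fst Y Z)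
  rw [fst.eq_def X Y, fst.eq_def X (Y ⊗ Z), ← MonoidalCategory.whiskerLeft_comp_assoc, h]

theorem whiskerRight_snd_snd (X Y Z : M) [ComonObj X] [ComonObj Y] :
    snd X Y ▷ Z ≫ snd Y Z = snd (X ⊗ Y) Z := by
  have h := IsComonHom.hom_counit (snd X Y)
  rw [snd.eq_def Y, snd.eq_def (X ⊗ Y), ← comp_whiskerRight_assoc, h]

theorem associator_fst (X Y Z : M) [ComonObj Y] [ComonObj Z] :
    (α_ X Y Z).hom ≫ fst X (Y ⊗ Z) = fst (X ⊗ Y) Z ≫ fst X Y := by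
  have h : (α_ X Y Z).hom ≫ X ◁ fst Y Z = fst (X ⊗ Y) Z := by simp [fst]
  rw [← whiskerLeft_fst_fst, reassoc_of% h]

theorem associator_snd_snd (X Y Z : M) [ComonObj X] [ComonObj Y] :
    (α_ X Y Z).hom ≫ snd X (Y ⊗ Z) ≫ snd Y Z = snd (X ⊗ Y) Z := by
  have h : (α_ X Y Z).hom ≫ snd X (Y ⊗ Z) = snd X Y ▷ Z := by simp [snd]
  rw [reassoc_of% h, whiskerRight_snd_snd]

/-! ### Commuting morphisms -/

/-- The span with legs `f` and `g` satisfies `(f ⊗ g) ∘ δ = (f ⊗ g) ∘ c ∘ δ`. -/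
def Coc {C X Y : M} [ComonObj C] (f : C ⟶ X) (g : C ⟶ Y) : Prop :=
  pair f g = pair g f ≫ (β_ Y X).hom

/-- The images of `f` and `g` commute. -/
def ComIm {X Y R : M} [MonObj R] (f : X ⟶ R) (g : Y ⟶ R) : Prop :=
  copair f g = (β_ X Y).hom ≫ copair g f

/-- Both products factor as a `pair` followed by a `copair`. Swapping the pair costs one braiding,
swapping the copair another, and the two cancel. All later reorderings of unlike factors rest on
this. -/
theorem Coc.commute {C X Y R : M} [ComonObj C] [MonObj R] {f : C ⟶ X} {g : C ⟶ Y}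
    {a : X ⟶ R} {b : Y ⟶ R} (h : Coc f g) (k : ComIm a b) : Commute (f ≫ a) (g ≫ b) := by
  rw [Commute, SemiconjBy, ← pair_copair, ← pair_copair, h, k]
  simp

theorem Coc.symm {C X Y : M} [ComonObj C] {f : C ⟶ X} {g : C ⟶ Y} (h : Coc f g) : Coc g f := by
  rw [Coc, h]; simp

theorem ComIm.symm {X Y R : M} [MonObj R] {f : X ⟶ R} {g : Y ⟶ R} (h : ComIm f g) :
    ComIm g f := by
  rw [ComIm, h]; simp

theorem comIm_inl_inr (X Y : M) [MonObj X] [MonObj Y] : ComIm (inl X Y) (inr X Y) := by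
  rw [ComIm, copair_inl_inr, copair_inr_inl, SymmetricCategory.symmetry]

theorem coc_fst_snd (X Y : M) [ComonObj X] [ComonObj Y] : Coc (fst X Y) (snd X Y) := by
  rw [Coc, pair_fst_snd, pair_snd_fst, SymmetricCategory.symmetry]

/-- `inl` and `inr` are the universal pair with commuting images, so they detect `Coc`. Closure
properties of the class then come from those of `Commute`. -/
theorem coc_iff {C X Y : M} [ComonObj C] [MonObj X] [MonObj Y] {f : C ⟶ X} {g : C ⟶ Y} :
    Coc f g ↔ Commute (f ≫ inl X Y) (g ≫ inr X Y) := by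
  refine ⟨fun h => h.commute (comIm_inl_inr X Y), fun h => ?_⟩
  rw [Coc, pair_eq_mul, h.eq, ← pair_copair, copair_inr_inl]

theorem comIm_iff {X Y R : M} [ComonObj X] [ComonObj Y] [MonObj R] {f : X ⟶ R} {g : Y ⟶ R} :
    ComIm f g ↔ Commute (fst X Y ≫ f) (snd X Y ≫ g) := by
  refine ⟨fun h => (coc_fst_snd X Y).commute h, fun h => ?_⟩
  rw [ComIm, copair_eq_mul, h.eq, ← pair_copair, pair_snd_fst]

theorem Coc.pre {C D X Y : M} [ComonObj C] [ComonObj D] {f : C ⟶ X} {g : C ⟶ Y} (h : Coc f g)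
    (a : D ⟶ C) [IsComonHom a] : Coc (a ≫ f) (a ≫ g) := by
  rw [Coc, ← comp_pair, h, ← comp_pair, Category.assoc]

theorem Coc.post {C X Y X' Y' : M} [ComonObj C] {f : C ⟶ X} {g : C ⟶ Y} (h : Coc f g)
    (a : X ⟶ X') (b : Y ⟶ Y') : Coc (f ≫ a) (g ≫ b) := by
  rw [Coc, ← pair_tensorHom, h, ← pair_tensorHom, Category.assoc, Category.assoc,
    BraidedCategory.braiding_naturality]

theorem Coc.post_left {C X Y X' : M} [ComonObj C] {f : C ⟶ X} {g : C ⟶ Y} (h : Coc f g)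
    (a : X ⟶ X') : Coc (f ≫ a) g := by
  simpa using h.post a (𝟙 _)

theorem Coc.post_right {C X Y Y' : M} [ComonObj C] {f : C ⟶ X} {g : C ⟶ Y} (h : Coc f g)
    (b : Y ⟶ Y') : Coc f (g ≫ b) := by
  simpa using h.post (𝟙 _) b

theorem ComIm.post {X Y R S : M} [MonObj R] [MonObj S] {f : X ⟶ R} {g : Y ⟶ R} (h : ComIm f g)
    (a : R ⟶ S) [IsMonHom a] : ComIm (f ≫ a) (g ≫ a) := by
  rw [ComIm, ← copair_comp, h, ← copair_comp, Category.assoc]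

theorem ComIm.pre {X Y X' Y' R : M} [MonObj R] {f : X ⟶ R} {g : Y ⟶ R} (h : ComIm f g)
    (a : X' ⟶ X) (b : Y' ⟶ Y) : ComIm (a ≫ f) (b ≫ g) := by
  rw [ComIm, ← tensorHom_copair, h, ← tensorHom_copair,
    BraidedCategory.braiding_naturality_assoc]

theorem ComIm.pre_left {X Y X' R : M} [MonObj R] {f : X ⟶ R} {g : Y ⟶ R} (h : ComIm f g)
    (a : X' ⟶ X) : ComIm (a ≫ f) g := by
  simpa using h.pre a (𝟙 _)

theorem ComIm.pre_right {X Y Y' R : M} [MonObj R] {f : X ⟶ R} {g : Y ⟶ R} (h : ComIm f g)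
    (b : Y' ⟶ Y) : ComIm f (b ≫ g) := by
  simpa using h.pre (𝟙 _) b

theorem Coc.mul_right {C X Y : M} [ComonObj C] [MonObj X] [MonObj Y] {f : C ⟶ X} {g g' : C ⟶ Y}
    (h : Coc f g) (h' : Coc f g') : Coc f (g * g') := by
  rw [coc_iff] at *
  rw [mul_comp]
  exact h.mul_right h'

theorem Coc.mul_left {C X Y : M} [ComonObj C] [MonObj X] [MonObj Y] {f f' : C ⟶ X} {g : C ⟶ Y}
    (h : Coc f g) (h' : Coc f' g) : Coc (f * f') g :=
  (h.symm.mul_right h'.symm).symm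

theorem Coc.pair_right {C X Y Z : M} [ComonObj C] [MonObj X] [MonObj Y] [MonObj Z]
    {f : C ⟶ X} {g : C ⟶ Y} {g' : C ⟶ Z} (h : Coc f g) (h' : Coc f g') : Coc f (pair g g') := by
  rw [pair_eq_mul]
  exact (h.post_right _).mul_right (h'.post_right _)

theorem Coc.pair_left {C X Y Z : M} [ComonObj C] [MonObj X] [MonObj Y] [MonObj Z]
    {f : C ⟶ X} {g : C ⟶ Y} {g' : C ⟶ Z} (h : Coc g f) (h' : Coc g' f) : Coc (pair g g') f :=
  (h.symm.pair_right h'.symm).symm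

/-- Multiplicativity is the exchange f(x)f(y)g(x)g(y) = f(x)g(x)f(y)g(y), for which only f(y) and
g(x) have to commute. -/
theorem isMonHom_mul {R S : M} [BimonObj R] [MonObj S] (f g : R ⟶ S) [IsMonHom f] [IsMonHom g]
    (h : ComIm f g) : IsMonHom (f * g) := by
  refine isMonHom_of_mul _ ?_ ?_
  · rw [mul_def, BimonObj.one_comul_assoc, Mon.one_def]
    simp [← unitors_equal]
  · rw [comp_mul, mul_comp_eq, mul_comp_eq, comp_mul, comp_mul]
    exact Commute.mul_mul_mul_comm ((coc_fst_snd R R).symm.commute h) _ _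

/-- Dual to `isMonHom_mul`: with the comultiplication written as `inl * inr`, only the `inr` part of
`f` has to pass the `inl` part of `g`. -/
theorem isComonHom_mul' {R S : M} [BimonObj R] [ComonObj S] (f g : S ⟶ R) [IsComonHom f]
    [IsComonHom g] (h : Coc f g) : IsComonHom (f * g) := by
  refine isComonHom_of_comul _ ?_ ?_
  · rw [mul_def, Category.assoc, Category.assoc, BimonObj.mul_counit, Comon.tensorObj_counit]
    simp [unitors_equal]
  · rw [mul_comp, comp_comul_eq, comp_comul_eq, mul_comp, mul_comp]
    exact Commute.mul_mul_mul_comm (h.commute (comIm_inl_inr R R).symm) _ _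

instance isComonHom_one' {R S : M} [BimonObj R] [ComonObj S] : IsComonHom (1 : S ⟶ R) where
  hom_counit := by simp [one_def]
  hom_comul := by
    rw [one_comp]
    have h : Δ[S] ≫ (ε[S] ⊗ₘ ε[S]) = ε[S] ≫ (λ_ (𝟙_ M)).inv :=
      (isComonHom_counit S).hom_comul.symm
    rw [one_def, one_def, ← tensorHom_comp_tensorHom, reassoc_of% h, tensor_one]

theorem isComonHom_pair {C X Y : M} [ComonObj C] [BimonObj X] [BimonObj Y] (f : C ⟶ X) (g : C ⟶ Y)
    [IsComonHom f] [IsComonHom g] (h : Coc f g) : IsComonHom (pair f g) := by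
  rw [pair_eq_mul]
  exact isComonHom_mul' _ _ (h.post _ _)

/-! ### Composites with comultiplications -/

/-- Turns the diagonal action into a `pair`, so that the module monoid axiom becomes a convolution
identity. The next lemma does the same for `exchange` and the Peiffer condition. -/
theorem comul_shuffle (X Y Z : M) [ComonObj X] [ComonObj Y] [ComonObj Z] :
    Δ[X] ▷ (Y ⊗ Z) ≫ tensorμ X X Y Z = pair (X ◁ fst Y Z) (X ◁ snd Y Z) := by
  rw [pair, Comon.tensorObj_comul, Category.assoc, ← id_tensorHom, ← id_tensorHom,
    ← tensorμ_natural, tensorHom_comp_tensorHom_assoc, ← pair.eq_def (fst Y Z), pair_fst_snd, id_tensorHom_id,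
    Category.comp_id, tensorHom_id]

theorem comul_shuffle' (X Y : M) [ComonObj X] [ComonObj Y] :
    Δ[X] ▷ Y ≫ (α_ _ _ _).hom ≫ X ◁ (β_ X Y).hom ≫ (α_ _ _ _).inv =
      pair (𝟙 (X ⊗ Y)) (fst X Y) := by
  rw [pair, Comon.tensorObj_comul, Category.assoc, fst]
  have h : (𝟙 (X ⊗ Y) ⊗ₘ X ◁ ε[Y] ≫ (ρ_ X).hom) =
      ((𝟙 X ⊗ₘ 𝟙 Y) ⊗ₘ (𝟙 X ⊗ₘ ε[Y])) ≫ (X ⊗ Y) ◁ (ρ_ X).hom := by simp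
  rw [h, ← tensorμ_natural_assoc, tensorHom_comp_tensorHom_assoc, ComonObj.comul_counit_hom]
  rw [MonoidalCategory.tensorHom_def, tensorμ, id_tensorHom_id, Category.comp_id,
    Category.id_comp]
  monoidal

theorem associator_fst_assoc (X Y Z : M) [ComonObj Y] [ComonObj Z] {W : M}
    (k : X ⟶ W) : (α_ X Y Z).hom ≫ fst X (Y ⊗ Z) ≫ k = fst (X ⊗ Y) Z ≫ fst X Y ≫ k := by
  simpa only [Category.assoc, Category.id_comp] using congrArg (· ≫ k) (associator_fst X Y Z)

theorem associator_snd_snd_assoc (X Y Z : M) [ComonObj X] [ComonObj Y] {W : M}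
    (k : Z ⟶ W) : (α_ X Y Z).hom ≫ snd X (Y ⊗ Z) ≫ snd Y Z ≫ k = snd (X ⊗ Y) Z ≫ k := by
  simpa only [Category.assoc, Category.id_comp] using congrArg (· ≫ k) (associator_snd_snd X Y Z)

end Calculus

/-! ### Equalizers and their behaviour under the tensor product -/

section Equalizers

variable {M : Type u} [Category.{v} M]

/-- `e` is an equalizer of `a` and `b`. -/
structure IsEq {E X Y : M} (e : E ⟶ X) (a b : X ⟶ Y) : Prop where
  w : e ≫ a = e ≫ b
  mono : Mono e
  exists_lift : ∀ {Z : M} (f : Z ⟶ X), f ≫ a = f ≫ b → ∃ g : Z ⟶ E, g ≫ e = f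

theorem isEq_of_isLimit {E X Y : M} {e : E ⟶ X} {a b : X ⟶ Y} (w : e ≫ a = e ≫ b)
    (h : IsLimit (Fork.ofι e w)) : IsEq e a b where
  w := w
  mono := ⟨fun _ _ hfg => Fork.IsLimit.hom_ext h hfg⟩
  exists_lift f hf := ⟨Fork.IsLimit.lift h f hf, Fork.IsLimit.lift_ι h⟩

theorem isEq_equalizer {X Y : M} (a b : X ⟶ Y) [HasEqualizer a b] : IsEq (equalizer.ι a b) a b :=
  isEq_of_isLimit (equalizer.condition a b) (equalizerIsEqualizer a b)

theorem IsEq.isLimit {E X Y : M} {e : E ⟶ X} {a b : X ⟶ Y} (h : IsEq e a b) :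
    Nonempty (IsLimit (Fork.ofι e h.w)) :=
  have := h.mono
  ⟨Fork.IsLimit.mk' _ fun s => ⟨(h.exists_lift s.ι s.condition).choose,
    (h.exists_lift s.ι s.condition).choose_spec, fun {_} hm => by
      rw [← cancel_mono e]
      exact hm.trans (h.exists_lift s.ι s.condition).choose_spec.symm⟩⟩

variable [MonoidalCategory M]
  [∀ X : M, PreservesLimitsOfShape WalkingParallelPair (tensorLeft X)]

theorem IsEq.whiskerLeft {E X Y : M} {e : E ⟶ X} {a b : X ⟶ Y} (h : IsEq e a b) (Z : M) :
    IsEq (Z ◁ e) (Z ◁ a) (Z ◁ b) :=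
  isEq_of_isLimit _ (isLimitForkMapOfIsLimit (tensorLeft Z) h.w h.isLimit.some)

variable [SymmetricCategory M]

theorem IsEq.whiskerRight {E X Y : M} {e : E ⟶ X} {a b : X ⟶ Y} (h : IsEq e a b) (Z : M) :
    IsEq (e ▷ Z) (a ▷ Z) (b ▷ Z) where
  w := by rw [← comp_whiskerRight, ← comp_whiskerRight, h.w]
  mono := by
    have := (h.whiskerLeft Z).mono
    have h' : e ▷ Z = (β_ E Z).hom ≫ Z ◁ e ≫ (β_ Z X).hom := by
      simp
    rw [h']
    infer_instance
  exists_lift f hf := by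
    obtain ⟨g, hg⟩ := (h.whiskerLeft Z).exists_lift (f ≫ (β_ X Z).hom) (by
      simp [← BraidedCategory.braiding_naturality_left, reassoc_of% hf])
    refine ⟨g ≫ (β_ Z E).hom, ?_⟩
    rw [Category.assoc, ← BraidedCategory.braiding_naturality_right, reassoc_of% hg]
    simp

theorem IsEq.mono_tensorHom {E X Y E' X' Y' : M} {e : E ⟶ X} {a b : X ⟶ Y} (h : IsEq e a b)
    {e' : E' ⟶ X'} {a' b' : X' ⟶ Y'} (h' : IsEq e' a' b') : Mono (e ⊗ₘ e') := by
  have := (h.whiskerRight E').mono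
  have := (h'.whiskerLeft X).mono
  rw [MonoidalCategory.tensorHom_def]
  infer_instance

/-- `E ⊗ E'` is the intersection of `X ⊗ E'` and `E ⊗ X'` inside `X ⊗ X'`: lift to the former, then
check the remaining equation after the monomorphism `Y ◁ e'`. -/
theorem IsEq.exists_lift_tensorHom {E X Y E' X' Y' : M} {e : E ⟶ X} {a b : X ⟶ Y} (h : IsEq e a b)
    {e' : E' ⟶ X'} {a' b' : X' ⟶ Y'} (h' : IsEq e' a' b') {Z : M} (f : Z ⟶ X ⊗ X')
    (hf : f ≫ a ▷ X' = f ≫ b ▷ X') (hf' : f ≫ X ◁ a' = f ≫ X ◁ b') :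
    ∃ g : Z ⟶ E ⊗ E', g ≫ (e ⊗ₘ e') = f := by
  obtain ⟨g, hg⟩ := (h'.whiskerLeft X).exists_lift f hf'
  have := (h'.whiskerLeft Y).mono
  obtain ⟨k, hk⟩ := (h.whiskerRight E').exists_lift g (by
    rw [← cancel_mono (Y ◁ e'), Category.assoc, Category.assoc, ← whisker_exchange,
      ← whisker_exchange, reassoc_of% hg, hf, reassoc_of% hg])
  exact ⟨k, by rw [MonoidalCategory.tensorHom_def, reassoc_of% hk, hg]⟩

theorem Coc.of_comp_mono {C E X Y Z : M} [ComonObj C] {e : E ⟶ X} {a b : X ⟶ Y} (h : IsEq e a b)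
    {f : C ⟶ E} {g : C ⟶ Z} (hc : Coc (f ≫ e) g) : Coc f g := by
  have := (h.whiskerRight Z).mono
  rw [Coc, ← cancel_mono (e ▷ Z), Category.assoc, ← BraidedCategory.braiding_naturality_right,
    ← tensorHom_id, ← id_tensorHom, pair_tensorHom, ← Category.assoc, pair_tensorHom,
    Category.comp_id]
  exact hc

end Equalizers

/-! ### Bimonoid structures on subobjects -/

section Subobjects

variable {M : Type u} [Category.{v} M] [MonoidalCategory M]

/-- The monoid structure on a subobject that is closed under the operations. -/
abbrev subMon {R E : M} [MonObj R] (e : E ⟶ R) (h₁ : Mono e) (one : 𝟙_ M ⟶ E) (mul : E ⊗ E ⟶ E)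
    (hone : one ≫ e = η[R]) (hmul : mul ≫ e = (e ⊗ₘ e) ≫ μ[R]) : MonObj E where
  one := one
  mul := mul
  one_mul := by
    rw [← cancel_mono e, Category.assoc, hmul, ← leftUnitor_naturality, ← tensorHom_id,
      tensorHom_comp_tensorHom_assoc, hone, Category.id_comp, MonoidalCategory.tensorHom_def',
      Category.assoc, MonObj.one_mul]
  mul_one := by
    rw [← cancel_mono e, Category.assoc, hmul, ← rightUnitor_naturality, ← id_tensorHom,
      tensorHom_comp_tensorHom_assoc, hone, Category.id_comp, MonoidalCategory.tensorHom_def,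
      Category.assoc, MonObj.mul_one]
  mul_assoc := by
    have h : ((e ⊗ₘ e) ≫ μ[R] ⊗ₘ e) = ((e ⊗ₘ e) ⊗ₘ e) ≫ μ[R] ▷ R := by
      rw [← tensorHom_id, tensorHom_comp_tensorHom, Category.comp_id]
    have h' : (e ⊗ₘ (e ⊗ₘ e) ≫ μ[R]) = (e ⊗ₘ e ⊗ₘ e) ≫ R ◁ μ[R] := by
      rw [← id_tensorHom, tensorHom_comp_tensorHom, Category.comp_id]
    rw [← cancel_mono e, Category.assoc, Category.assoc, Category.assoc, hmul, ← tensorHom_id,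
      ← id_tensorHom, tensorHom_comp_tensorHom_assoc, tensorHom_comp_tensorHom_assoc, hmul,
      Category.id_comp, h, h', Category.assoc, Category.assoc, MonObj.mul_assoc,
      associator_naturality_assoc]

/-- The comonoid structure on a subobject that is closed under the operations. -/
abbrev subComon {R E : M} [ComonObj R] (e : E ⟶ R) (h₁ : Mono e) (h₃ : Mono (e ⊗ₘ e ⊗ₘ e))
    (comul : E ⟶ E ⊗ E) (hcomul : comul ≫ (e ⊗ₘ e) = e ≫ Δ[R]) : ComonObj E where
  counit := e ≫ ε[R]
  comul := comul
  counit_comul := by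
    have h : (e ≫ ε[R]) ▷ E ≫ (λ_ E).hom ≫ e = (e ⊗ₘ e) ≫ ε[R] ▷ R ≫ (λ_ R).hom := by
      rw [← leftUnitor_naturality, ← tensorHom_id, ← tensorHom_id, ← id_tensorHom,
        tensorHom_comp_tensorHom_assoc, tensorHom_comp_tensorHom_assoc]
      simp
    rw [← cancel_mono (λ_ E).hom, ← cancel_mono e, Category.assoc, Category.assoc, h,
      reassoc_of% hcomul]
    simp
  comul_counit := by
    have h : E ◁ (e ≫ ε[R]) ≫ (ρ_ E).hom ≫ e = (e ⊗ₘ e) ≫ R ◁ ε[R] ≫ (ρ_ R).hom := by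
      rw [← rightUnitor_naturality, ← tensorHom_id, ← id_tensorHom, ← id_tensorHom,
        tensorHom_comp_tensorHom_assoc, tensorHom_comp_tensorHom_assoc]
      simp
    rw [← cancel_mono (ρ_ E).hom, ← cancel_mono e, Category.assoc, Category.assoc, h,
      reassoc_of% hcomul]
    simp
  comul_assoc := by
    have h : (e ⊗ₘ e ≫ Δ[R]) = (e ⊗ₘ e) ≫ R ◁ Δ[R] := by
      rw [← id_tensorHom, tensorHom_comp_tensorHom, Category.comp_id]
    have h' : (e ≫ Δ[R] ⊗ₘ e) = (e ⊗ₘ e) ≫ Δ[R] ▷ R := by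
      rw [← tensorHom_id, tensorHom_comp_tensorHom, Category.comp_id]
    rw [← cancel_mono (e ⊗ₘ e ⊗ₘ e), Category.assoc, Category.assoc, Category.assoc,
      ← associator_naturality, ← id_tensorHom, ← tensorHom_id, tensorHom_comp_tensorHom,
      tensorHom_comp_tensorHom_assoc, hcomul, Category.id_comp, h, h', reassoc_of% hcomul,
      Category.assoc, reassoc_of% hcomul, ComonObj.comul_assoc]

/-- The bimonoid structure on a subobject that is closed under the operations. -/
abbrev subBimon [BraidedCategory M] {R E : M} [BimonObj R] (e : E ⟶ R) (h₁ : Mono e)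
    (h₂ : Mono (e ⊗ₘ e)) (h₃ : Mono (e ⊗ₘ e ⊗ₘ e)) (one : 𝟙_ M ⟶ E) (mul : E ⊗ E ⟶ E)
    (comul : E ⟶ E ⊗ E) (hone : one ≫ e = η[R]) (hmul : mul ≫ e = (e ⊗ₘ e) ≫ μ[R])
    (hcomul : comul ≫ (e ⊗ₘ e) = e ≫ Δ[R]) : BimonObj E where
  __ := subMon e h₁ one mul hone hmul
  __ := subComon e h₁ h₃ comul hcomul
  mul_comul := by
    change mul ≫ comul = (comul ⊗ₘ comul) ≫ tensorμ E E E E ≫ (mul ⊗ₘ mul)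
    rw [← cancel_mono (e ⊗ₘ e), Category.assoc, hcomul, reassoc_of% hmul, BimonObj.mul_comul,
      Category.assoc, Category.assoc, tensorHom_comp_tensorHom, hmul, ← tensorHom_comp_tensorHom,
      ← tensorμ_natural_assoc, tensorHom_comp_tensorHom_assoc,
      tensorHom_comp_tensorHom_assoc, hcomul]
  one_comul := by
    change one ≫ comul = (λ_ _).inv ≫ (one ⊗ₘ one)
    rw [← cancel_mono (e ⊗ₘ e), Category.assoc, hcomul, reassoc_of% hone, BimonObj.one_comul,
      Category.assoc, tensorHom_comp_tensorHom, hone, Mon.one_def]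
  mul_counit := by
    change mul ≫ e ≫ ε[R] = (e ≫ ε[R] ⊗ₘ e ≫ ε[R]) ≫ (λ_ _).hom
    rw [reassoc_of% hmul, BimonObj.mul_counit, Comon.tensorObj_counit,
      tensorHom_comp_tensorHom_assoc]
  one_counit := by
    change one ≫ e ≫ ε[R] = _
    rw [reassoc_of% hone, BimonObj.one_counit]

end Subobjects

section

variable {M : Type u} [Category.{v} M] [MonoidalCategory M] [SymmetricCategory M]
  [∀ X : M, PreservesLimitsOfShape WalkingParallelPair (tensorLeft X)]

/-- An equalizer of monoid morphisms is closed under unit and product. The hypotheses `hl` and `hr`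
say that each leg of the comultiplication stays in `E`, and together they make it restrict to `E ⊗
E`. -/
theorem IsEq.exists_bimonObj {R T E : M} [BimonObj R] [MonObj T] {a b : R ⟶ T} [IsMonHom a]
    [IsMonHom b] {e : E ⟶ R} (h : IsEq e a b) (hl : e ≫ Δ[R] ≫ a ▷ R = e ≫ Δ[R] ≫ b ▷ R)
    (hr : e ≫ Δ[R] ≫ R ◁ a = e ≫ Δ[R] ≫ R ◁ b) : ∃ _ : BimonObj E, IsBimonHom e := by
  obtain ⟨one, hone⟩ := h.exists_lift η[R] (by rw [IsMonHom.one_hom, IsMonHom.one_hom])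
  obtain ⟨mul, hmul⟩ := h.exists_lift ((e ⊗ₘ e) ≫ μ[R]) (by
    rw [Category.assoc, Category.assoc, IsMonHom.mul_hom, IsMonHom.mul_hom,
      tensorHom_comp_tensorHom_assoc, tensorHom_comp_tensorHom_assoc, h.w])
  obtain ⟨comul, hcomul⟩ := h.exists_lift_tensorHom h (e ≫ Δ[R]) (by simpa using hl)
    (by simpa using hr)
  -- Coassociativity on `E` is tested after this threefold tensor power.
  have h₃ : Mono (e ⊗ₘ e ⊗ₘ e) := by
    have := (h.whiskerRight (E ⊗ E)).mono
    have := ((h.whiskerRight E).whiskerLeft R).mono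
    have := ((h.whiskerLeft R).whiskerLeft R).mono
    rw [MonoidalCategory.tensorHom_def e, MonoidalCategory.tensorHom_def e,
      MonoidalCategory.whiskerLeft_comp]
    infer_instance
  let _ := subBimon e h.mono (h.mono_tensorHom h) h₃ one mul comul hone hmul hcomul
  refine ⟨inferInstance, ?_⟩
  exact
    { one_hom := hone
      mul_hom := hmul
      hom_counit := rfl
      hom_comul := hcomul.symm }

end

/-! ### Antipodes as convolution inverses -/

section Hopf

variable {M : Type u} [Category.{v} M] [MonoidalCategory M] [SymmetricCategory M]

instance isMonHom_of_isBimonHom {A B : M} [BimonObj A] [BimonObj B] (f : A ⟶ B) [h : IsBimonHom f] :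
    IsMonHom f := h.toIsMonHom

instance isBimonHom_comp {A B C : M} [BimonObj A] [BimonObj B] [BimonObj C] (f : A ⟶ B) (g : B ⟶ C)
    [IsBimonHom f] [IsBimonHom g] : IsBimonHom (f ≫ g) where

/-- `z` is a convolution inverse of the identity. -/
structure IsInv {B : M} [BimonObj B] (z : B ⟶ B) : Prop where
  left : z * 𝟙 B = 1
  right : 𝟙 B * z = 1

theorem isAntipode_iff {B : Bimon M} {z : car B ⟶ car B} : IsAntipode B z ↔ IsInv z := by
  rw [IsAntipode, ← id_tensorHom, ← tensorHom_id, ← mul_def, ← mul_def, ← one_def]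
  exact ⟨fun h => ⟨h.1, h.2⟩, fun h => ⟨h.1, h.2⟩⟩

variable {B : M} [BimonObj B] {z : B ⟶ B} (hz : IsInv z)
include hz

theorem IsInv.inv_mul {C R : M} [ComonObj C] [MonObj R] (f : C ⟶ B) (g : B ⟶ R) [IsComonHom f]
    [IsMonHom g] : (f ≫ z ≫ g) * (f ≫ g) = 1 := by
  rw [← comp_mul, ← Category.id_comp g, ← Category.assoc z, ← mul_comp, Category.comp_id, hz.left,
    one_comp, comp_one]

theorem IsInv.mul_inv {C R : M} [ComonObj C] [MonObj R] (f : C ⟶ B) (g : B ⟶ R) [IsComonHom f]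
    [IsMonHom g] : (f ≫ g) * (f ≫ z ≫ g) = 1 := by
  rw [← comp_mul, ← Category.id_comp g, ← Category.assoc z, ← mul_comp, Category.comp_id, hz.right,
    one_comp, comp_one]

/-- Both composites are convolution inverses of `f`. -/
theorem IsInv.comp_eq {B' : M} [BimonObj B'] {z' : B' ⟶ B'} (hz' : IsInv z') (f : B ⟶ B')
    [IsBimonHom f] : f ≫ z' = z ≫ f := by
  have h₁ := hz.mul_inv (𝟙 B) f
  have h₂ := hz'.inv_mul f (𝟙 B')
  rw [Category.id_comp, Category.id_comp] at h₁
  rw [Category.comp_id, Category.comp_id] at h₂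
  exact left_inv_eq_right_inv h₂ h₁

/-- Both sides of the comultiplication identity invert `Δ`; cocommutativity lets the two tensor legs
of `z` be matched with those of `Δ = inl * inr`. -/
theorem IsInv.isComonHom (hB : Coc (𝟙 B) (𝟙 B)) : IsComonHom z := by
  refine isComonHom_of_comul _ ?_ ?_
  · have h₁ := hz.inv_mul (𝟙 B) ε[B]
    -- The counit is itself the unit of the convolution monoid of morphisms to `𝟙_ M`, so its
    -- inverse is trivial.
    have h : ε[B] = (1 : B ⟶ 𝟙_ M) := (Category.comp_id _).symm
    rw [Category.id_comp, Category.id_comp, h, mul_one, ← h] at h₁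
    rw [h₁, h]
  · have h₁ := hz.inv_mul (𝟙 B) Δ[B]
    rw [Category.id_comp, Category.id_comp] at h₁
    refine left_inv_eq_right_inv h₁ ?_
    have h₂ := hz.mul_inv (𝟙 B) (inl B B)
    have h₃ := hz.mul_inv (𝟙 B) (inr B B)
    have h₄ : Commute (𝟙 B ≫ inr B B) (z ≫ inl B B) := by
      have := (hB.post_left z).commute (comIm_inl_inr B B)
      simpa using this.symm
    simp only [Category.id_comp] at h₂ h₃ h₄
    rw [comul_eq_inl_mul_inr, h₄.mul_mul_mul_comm, h₂, h₃, one_mul]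

theorem IsInv.one_comp : η[B] ≫ z = η[B] := by
  have h : η[B] ≫ (z * 𝟙 B) = η[B] ≫ 1 := by rw [hz.left]
  rw [mul_def, BimonObj.one_comul_assoc, tensorHom_id, Mon.one_def, one_def,
    BimonObj.one_counit_assoc] at h
  refine Eq.trans ?_ h
  rw [← tensorHom_id, Category.assoc, tensorHom_comp_tensorHom_assoc, Category.comp_id,
    MonoidalCategory.tensorHom_def, Category.assoc, MonObj.mul_one,
    rightUnitor_naturality, ← unitors_equal, Iso.inv_hom_id_assoc]

/-- Both sides invert `μ = fst * snd`, whence the reversed order. -/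
theorem IsInv.mul_comp : μ[B] ≫ z = (snd B B ≫ z) * (fst B B ≫ z) := by
  have h₁ := hz.inv_mul μ[B] (𝟙 B)
  simp only [Category.comp_id] at h₁
  refine left_inv_eq_right_inv h₁ ?_
  have h₂ := hz.mul_inv (fst B B) (𝟙 B)
  have h₃ := hz.mul_inv (snd B B) (𝟙 B)
  simp only [Category.comp_id] at h₂ h₃
  rw [mul_eq_fst_mul_snd, mul_assoc, mul_cancel_left h₃, h₂]

end Hopf

/-! ### The kernel of a split bimonoid morphism and the map `sArr` onto it -/

section Kernel

variable {M : Type u} [Category.{v} M] [MonoidalCategory M] [SymmetricCategory M]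
  {A B : M} [BimonObj A] [BimonObj B]

instance isMonHom_pair_id (s : A ⟶ B) [IsBimonHom s] : IsMonHom (pair (𝟙 A) s) := by
  rw [pair_eq_mul, Category.id_comp]
  exact isMonHom_mul _ _ ((comIm_inl_inr A B).pre_right s)

/-- On the kernel y₁ ⊗ s(y₂) = y ⊗ 1, so a trailing factor that depends only on `s` can be dropped.
-/
theorem comp_mul_comp_of_pair_eq {E R : M} [MonObj R] {s : A ⟶ B} {j : E ⟶ A}
    (hj : j ≫ pair (𝟙 A) s = j ≫ inl A B) (a : A ⟶ R) (b : B ⟶ R) (hb : η[B] ≫ b = η[R]) :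
    j ≫ (a * (s ≫ b)) = j ≫ a := by
  have h : inl A B ≫ copair a b = a := by
    simp [copair, inl, ← id_tensorHom, hb]
  rw [← Category.id_comp a, ← pair_copair, reassoc_of% hj, h, Category.id_comp]

theorem comp_eq_one_of_pair_eq {E : M} [BimonObj E] {s : A ⟶ B} {j : E ⟶ A} [IsBimonHom j]
    (hj : j ≫ pair (𝟙 A) s = j ≫ inl A B) : j ≫ s = 1 := by
  have h := comp_mul_comp_of_pair_eq hj (1 : A ⟶ B) (𝟙 B) (Category.comp_id _)
  rwa [Category.comp_id, one_mul, comp_one] at h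

/-- For the right leg, y₁ ⊗ y₂ ⊗ s(y₃) has its `s` factor last and it drops out. For the left leg,
y₁ ⊗ s(y₂) ⊗ y₃ needs the hypothesis `hs` to move s(y₂) to the end first. -/
theorem exists_bimonObj_of_isEq [∀ X : M, PreservesLimitsOfShape WalkingParallelPair (tensorLeft X)]
    {E : M} {s : A ⟶ B} [IsBimonHom s] (hs : Coc (𝟙 A) s) {j : E ⟶ A}
    (hj : IsEq j (pair (𝟙 A) s) (inl A B)) : ∃ _ : BimonObj E, IsBimonHom j := by
  refine hj.exists_bimonObj ?_ ?_
  · rw [← tensorHom_id, ← tensorHom_id, ← pair.eq_def, ← pair.eq_def, pair_eq_mul, pair_eq_mul,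
      pair_eq_mul, mul_comp]
    have h : Commute ((s ≫ inr A B) ≫ inl (A ⊗ B) A) (𝟙 A ≫ inr (A ⊗ B) A) := by
      rw [Category.assoc]
      exact hs.symm.commute ((comIm_inl_inr (A ⊗ B) A).pre_left _)
    rw [mul_assoc, h.eq, ← mul_assoc, Category.assoc s, comp_mul_comp_of_pair_eq hj.w,
      Category.id_comp, Category.id_comp]
    rw [IsMonHom.one_hom]
  · rw [← id_tensorHom, ← id_tensorHom, ← pair.eq_def, ← pair.eq_def, pair_eq_mul, pair_eq_mul,
      pair_eq_mul, mul_comp, ← mul_assoc, Category.assoc s, comp_mul_comp_of_pair_eq hj.w,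
      Category.id_comp, Category.id_comp]
    rw [IsMonHom.one_hom]

/-- The morphism `m ∘ (1 ⊗ i) ∘ (1 ⊗ z) ∘ (1 ⊗ s) ∘ δ`. -/
def sArr (s : A ⟶ B) (z : B ⟶ B) (i : B ⟶ A) : A ⟶ A := 𝟙 A * (s ≫ z ≫ i)

/-- The morphism `m ∘ (i ⊗ 1) ∘ (z ⊗ 1) ∘ (t ⊗ 1) ∘ δ`. -/
def tArr (t : A ⟶ B) (z : B ⟶ B) (i : B ⟶ A) : A ⟶ A := (t ≫ z ≫ i) * 𝟙 A

/-- Restricting the span along the section `i` shows that `B` is cocommutative; this need not be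
assumed for graphs. -/
theorem coc_id_of_section {s : A ⟶ B} {i : B ⟶ A} [IsBimonHom i] (hi : i ≫ s = 𝟙 B)
    (hs : Coc (𝟙 A) s) : Coc (𝟙 B) (𝟙 B) := by
  have h := (hs.pre i).post_left s
  rwa [Category.comp_id, hi] at h

variable {s : A ⟶ B} {i : B ⟶ A} [IsBimonHom s] [IsBimonHom i] (hi : i ≫ s = 𝟙 B)
  (hs : Coc (𝟙 A) s) {z : B ⟶ B} (hz : IsInv z)
include hi hs hz

omit [IsBimonHom s] in
theorem isComonHom_antipode : IsComonHom z := hz.isComonHom (coc_id_of_section hi hs)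

theorem isComonHom_sArr : IsComonHom (sArr s z i) := by
  have := isComonHom_antipode hi hs hz
  exact isComonHom_mul' _ _ (hs.post_right _)

/-- Applying the monoid morphism `pair (𝟙 A) s` to a₁ · izs(a₂) produces two factors in the `B` leg,
s and zs. Cocommutativity of `B` brings them together and they cancel. -/
theorem sArr_pair : sArr s z i ≫ pair (𝟙 A) s = sArr s z i ≫ inl A B := by
  have := isComonHom_antipode hi hs hz
  have h : (s ≫ z ≫ i) ≫ pair (𝟙 A) s = (s ≫ z ≫ i ≫ inl A B) * (s ≫ z ≫ inr A B) := by
    rw [Category.assoc, Category.assoc, comp_pair, hi, Category.comp_id, pair_eq_mul, comp_mul,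
      comp_mul, Category.id_comp]
  have h₁ : Commute (s ≫ inr A B) (s ≫ z ≫ i ≫ inl A B) := by
    have hB := (((coc_id_of_section hi hs).pre s).post_right (z ≫ i)).commute
      (comIm_inl_inr A B).symm
    simpa using hB
  rw [sArr, mul_comp, h, Category.id_comp, pair_eq_mul, h₁.mul_mul_mul_comm, hz.mul_inv, mul_one,
    Category.id_comp, mul_comp, Category.id_comp, Category.assoc, Category.assoc]

omit hs [IsBimonHom i] in
theorem sArr_comp_s : sArr s z i ≫ s = 1 := by
  rw [sArr, mul_comp, Category.assoc, Category.assoc, hi]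
  have h := hz.mul_inv s (𝟙 B)
  simpa using h

omit hs [IsBimonHom s] in
theorem comp_sArr : i ≫ sArr s z i = 1 := by
  rw [sArr, comp_mul, reassoc_of% hi, Category.comp_id]
  have h := hz.mul_inv (𝟙 B) i
  simpa using h

omit hi hs in
theorem sArr_mul : sArr s z i * (s ≫ i) = 𝟙 A := by
  rw [sArr, mul_assoc, hz.inv_mul, mul_one]

omit hi hs [IsBimonHom s] in
theorem comp_sArr_of_pair_eq {E : M} {j : E ⟶ A} (hj : j ≫ pair (𝟙 A) s = j ≫ inl A B) :
    j ≫ sArr s z i = j := by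
  rw [sArr, comp_mul_comp_of_pair_eq hj, Category.comp_id]
  rw [← Category.assoc, hz.one_comp, IsMonHom.one_hom]

omit hi hs in
theorem mul_comp_antipode : μ[A] ≫ s ≫ z ≫ i = (snd A A ≫ s ≫ z ≫ i) * (fst A A ≫ s ≫ z ≫ i) := by
  rw [IsMonHom.mul_hom_assoc, ← Category.assoc μ[B], hz.mul_comp, ← Category.assoc, comp_mul,
    mul_comp, tensorHom_fst_assoc, tensorHom_snd_assoc]
  simp

omit hi hs in
-- Twisted multiplicativity σ(aa') = a₁ · σ(a') · izs(a₂), owing to the antipode reversing products.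
theorem mul_comp_sArr :
    μ[A] ≫ sArr s z i = fst A A * ((snd A A ≫ sArr s z i) * (fst A A ≫ s ≫ z ≫ i)) := by
  rw [sArr, comp_mul, Category.comp_id, mul_comp_antipode hz, comp_mul, mul_eq_fst_mul_snd,
    Category.comp_id]
  simp only [mul_assoc]

/-- The inverse is `pair π s`, with `π` the corestriction of `sArr` to the kernel. One composite is
`sArr_mul`; in the other, the `B` factor of j(y) i(b) is cancelled by the antipode. -/
theorem isIso_copair {E : M} [BimonObj E] {j : E ⟶ A} [IsBimonHom j]
    (hj : IsEq j (pair (𝟙 A) s) (inl A B)) : IsIso (copair j i) := by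
  obtain ⟨π, hπ⟩ := hj.exists_lift _ (sArr_pair hi hs hz)
  have := hj.mono
  refine ⟨pair π s, ?_, ?_⟩
  · have : IsComonHom (copair j i) := by
      rw [copair_eq_mul]; exact isComonHom_mul' _ _ ((coc_fst_snd E B).post j i)
    rw [comp_pair, ← pair_fst_snd]
    congr 1
    · rw [← cancel_mono j, Category.assoc, hπ, sArr, comp_mul, Category.comp_id, ← Category.assoc,
        copair_comp, comp_eq_one_of_pair_eq hj.w, hi, copair_eq_mul, copair_eq_mul, comp_one,
        one_mul, Category.comp_id, mul_assoc, hz.mul_inv, mul_one]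
    · rw [copair_comp, comp_eq_one_of_pair_eq hj.w, hi, copair_eq_mul, comp_one,
        one_mul, Category.comp_id]
  · rw [pair_copair, hπ, sArr_mul hz]

end Kernel

/-! ### Relative pullbacks of bimonoids as equalizers -/

section Cotensor

variable {M : Type u} [Category.{v} M] [MonoidalCategory M] [SymmetricCategory M]

section

variable {A B D : M} [BimonObj A] [BimonObj B] [BimonObj D]

/-- In terms of elements, `a ⊗ d ↦ ∑ a₁ ⊗ f(a₂) ⊗ d`. -/
def cotensorLeft (D : M) [BimonObj D] (f : A ⟶ B) : A ⊗ D ⟶ A ⊗ B ⊗ D :=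
  pair (fst A D) (pair (fst A D ≫ f) (snd A D))

/-- In terms of elements, `a ⊗ d ↦ ∑ a ⊗ g(d₁) ⊗ d₂`. -/
def cotensorRight (A : M) [BimonObj A] (g : D ⟶ B) : A ⊗ D ⟶ A ⊗ B ⊗ D :=
  pair (fst A D) (pair (snd A D ≫ g) (snd A D))

instance isMonHom_cotensorLeft (f : A ⟶ B) [IsBimonHom f] : IsMonHom (cotensorLeft D f) := by
  have : IsMonHom (pair (fst A D ≫ f) (snd A D)) := by
    rw [pair_eq_mul]
    exact isMonHom_mul _ _ ((comIm_inl_inr B D).pre _ _)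
  rw [cotensorLeft, pair_eq_mul]
  exact isMonHom_mul _ _ ((comIm_inl_inr A (B ⊗ D)).pre _ _)

theorem isMonHom_pair_comp_snd (g : D ⟶ B) [IsBimonHom g] :
    IsMonHom (pair g (𝟙 D)) := by
  rw [pair_eq_mul, Category.id_comp]
  exact isMonHom_mul _ _ ((comIm_inl_inr B D).pre_left _)

instance isMonHom_cotensorRight (g : D ⟶ B) [IsBimonHom g] : IsMonHom (cotensorRight A g) := by
  have : IsMonHom (pair (snd A D ≫ g) (snd A D)) := by
    have := isMonHom_pair_comp_snd g
    rw [← Category.comp_id (snd A D), Category.assoc, Category.id_comp, ← comp_pair]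
    infer_instance
  rw [cotensorRight, pair_eq_mul]
  exact isMonHom_mul _ _ ((comIm_inl_inr A (B ⊗ D)).pre _ _)

omit [BimonObj B] in
-- On the cotensor product, a middle factor computed from the first leg through `f` may be
-- recomputed from the second leg through `g`.
theorem cotensor_apply {E R : M} [MonObj R] {f : A ⟶ B} {g : D ⟶ B} {e : E ⟶ A ⊗ D}
    (he : e ≫ cotensorLeft D f = e ≫ cotensorRight A g) (φ : A ⟶ R) (ψ : B ⟶ R) (χ : D ⟶ R) :
    e ≫ ((fst A D ≫ φ) * ((fst A D ≫ f ≫ ψ) * (snd A D ≫ χ))) =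
      e ≫ ((fst A D ≫ φ) * ((snd A D ≫ g ≫ ψ) * (snd A D ≫ χ))) := by
  have h := congrArg (· ≫ copair φ (copair ψ χ)) he
  simpa only [cotensorLeft, cotensorRight, Category.assoc, pair_copair] using h

/-- Both coideal conditions are brought to the shape of `cotensor_apply`: a factor depending on `A`,
then one factor through `B`, then one depending on `D`. The hypotheses on `f` and `g` let the `B`
factor pass the extra copies created by comultiplying. -/
theorem exists_bimonObj_cotensor
    [∀ X : M, PreservesLimitsOfShape WalkingParallelPair (tensorLeft X)]
    {E : M} {f : A ⟶ B} {g : D ⟶ B} [IsBimonHom f] [IsBimonHom g] (hf : Coc (𝟙 A) f)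
    (hg : Coc g (𝟙 D)) {e : E ⟶ A ⊗ D} (he : IsEq e (cotensorLeft D f) (cotensorRight A g)) :
    ∃ _ : BimonObj E, IsBimonHom e := by
  have hf' := hf.pre (fst A D)
  have hg' := hg.pre (snd A D)
  rw [Category.comp_id] at hf' hg'
  have hid : ∀ {R : M} [MonObj R] (b : A ⊗ D ⟶ R) [IsMonHom b],
      b = (fst A D ≫ inl A D ≫ b) * (snd A D ≫ inr A D ≫ b) := by
    intro R _ b _
    conv_lhs => rw [← Category.id_comp b, ← pair_fst_snd, pair_eq_mul, mul_comp]
    simp only [Category.assoc]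
  have hpr : ∀ {R : M} [MonObj R] (a : A ⊗ B ⊗ D ⟶ R) [IsMonHom a] (m : A ⊗ D ⟶ B),
      pair (fst A D) (pair m (snd A D)) ≫ a = (fst A D ≫ inl A (B ⊗ D) ≫ a) *
        ((m ≫ inl B D ≫ inr A (B ⊗ D) ≫ a) * (snd A D ≫ inr B D ≫ inr A (B ⊗ D) ≫ a)) := by
    intro R _ a _ m
    simp only [pair_eq_mul, mul_comp, Category.assoc]
  -- Here `m` stands for the middle leg, `fst ≫ f` or `snd ≫ g`; gathering the `A` and `D` factors
  -- around it treats both sides of the equation at once.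
  have key : ∀ {R : M} [MonObj R] (a : A ⊗ B ⊗ D ⟶ R) (b : A ⊗ D ⟶ R) [IsMonHom a]
      [IsMonHom b] (_ : ComIm a b) (m : A ⊗ D ⟶ B) (_ : Coc m (fst A D)),
      (pair (fst A D) (pair m (snd A D)) ≫ a) * b =
        (fst A D ≫ ((inl A (B ⊗ D) ≫ a) * (inl A D ≫ b))) *
          ((m ≫ inl B D ≫ inr A (B ⊗ D) ≫ a) *
            (snd A D ≫ ((inr B D ≫ inr A (B ⊗ D) ≫ a) * (inr A D ≫ b)))) := by
    intro R _ a b _ _ hab m hm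
    have h₁ : Commute (snd A D ≫ inr B D ≫ inr A (B ⊗ D) ≫ a) (fst A D ≫ inl A D ≫ b) :=
      (coc_fst_snd A D).symm.commute (((hab.pre_left _).pre_left _).pre_right _)
    have h₂ : Commute (m ≫ inl B D ≫ inr A (B ⊗ D) ≫ a) (fst A D ≫ inl A D ≫ b) :=
      hm.commute (((hab.pre_left _).pre_left _).pre_right _)
    conv_lhs => rw [hpr, hid b]
    rw [comp_mul, comp_mul, mul_assoc, mul_assoc, mul_assoc, h₁.left_comm, h₂.left_comm]
  have key' : ∀ {R : M} [MonObj R] (a : A ⊗ B ⊗ D ⟶ R) (b : A ⊗ D ⟶ R) [IsMonHom a]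
      [IsMonHom b] (_ : ComIm b a) (m : A ⊗ D ⟶ B) (_ : Coc (snd A D) m),
      b * (pair (fst A D) (pair m (snd A D)) ≫ a) =
        (fst A D ≫ ((inl A D ≫ b) * (inl A (B ⊗ D) ≫ a))) *
          ((m ≫ inl B D ≫ inr A (B ⊗ D) ≫ a) *
            (snd A D ≫ ((inr A D ≫ b) * (inr B D ≫ inr A (B ⊗ D) ≫ a)))) := by
    intro R _ a b _ _ hab m hm
    have h₁ : Commute (snd A D ≫ inr A D ≫ b) (fst A D ≫ inl A (B ⊗ D) ≫ a) :=
      (coc_fst_snd A D).symm.commute ((hab.pre_left _).pre_right _)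
    have h₂ : Commute (snd A D ≫ inr A D ≫ b) (m ≫ inl B D ≫ inr A (B ⊗ D) ≫ a) :=
      hm.commute ((((hab.pre_left _).pre_right _)).pre_right _)
    conv_lhs => rw [hpr, hid b]
    rw [comp_mul, comp_mul, mul_assoc, mul_assoc, h₁.left_comm, h₂.left_comm]
  refine he.exists_bimonObj ?_ ?_
  · rw [← tensorHom_id, ← tensorHom_id, ← pair.eq_def, ← pair.eq_def, pair_eq_mul, pair_eq_mul,
      Category.id_comp]
    have h₁ := key (inl (A ⊗ B ⊗ D) (A ⊗ D)) (inr _ _) (comIm_inl_inr _ _) _ hf'.symm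
    have h₂ := key (inl (A ⊗ B ⊗ D) (A ⊗ D)) (inr _ _) (comIm_inl_inr _ _) _
      ((coc_fst_snd A D).post_right g).symm
    rw [cotensorLeft, cotensorRight, h₁, h₂, Category.assoc, Category.assoc]
    exact cotensor_apply he.w _ _ _
  · rw [← id_tensorHom, ← id_tensorHom, ← pair.eq_def, ← pair.eq_def, pair_eq_mul, pair_eq_mul,
      Category.id_comp]
    have h₁ := key' (inr (A ⊗ D) (A ⊗ B ⊗ D)) (inl _ _) (comIm_inl_inr _ _) _
      ((coc_fst_snd A D).post_left f).symm
    have h₂ := key' (inr (A ⊗ D) (A ⊗ B ⊗ D)) (inl _ _) (comIm_inl_inr _ _) _ hg'.symm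
    rw [cotensorLeft, cotensorRight, h₁, h₂, Category.assoc, Category.assoc]
    exact cotensor_apply he.w _ _ _

end

theorem coSpans_mem_iff {A X Y : Bimon M} {f : A ⟶ X} {g : A ⟶ Y} :
    (coSpans M).mem f g ↔ Coc (und f) (und g) := by
  rw [Coc, pair, pair, Category.assoc, BraidedCategory.braiding_naturality]
  rfl

theorem exists_bimon {E R : M} [inst : BimonObj E] [BimonObj R] (e : E ⟶ R) [h : IsBimonHom e]
    {T : M} {a b : R ⟶ T} (he : IsEq e a b) :
    ∃ (P : Bimon M) (κ : car P ⟶ R), IsBimonHom κ ∧ IsEq κ a b :=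
  ⟨Bimon.mk' E, e, h, he⟩

theorem isBimonHom_of_comp_mono {X E R : M} [BimonObj X] [BimonObj E] [BimonObj R] (h : X ⟶ E)
    (e : E ⟶ R) [IsBimonHom e] [IsBimonHom (h ≫ e)] (h₁ : Mono e) (h₂ : Mono (e ⊗ₘ e)) :
    IsBimonHom h where
  one_hom := by
    rw [← cancel_mono e, Category.assoc, IsMonHom.one_hom e]
    exact IsMonHom.one_hom (h ≫ e)
  mul_hom := by
    rw [← cancel_mono e, Category.assoc, Category.assoc, IsMonHom.mul_hom e,
      tensorHom_comp_tensorHom_assoc]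
    exact IsMonHom.mul_hom (h ≫ e)
  hom_counit := by
    rw [← IsComonHom.hom_counit e, ← Category.assoc, IsComonHom.hom_counit (h ≫ e)]
  hom_comul := by
    rw [← cancel_mono (e ⊗ₘ e), Category.assoc, Category.assoc, ← IsComonHom.hom_comul e,
      tensorHom_comp_tensorHom, ← Category.assoc]
    exact IsComonHom.hom_comul (h ≫ e)

instance isBimonHom_fst (X Y : M) [BimonObj X] [BimonObj Y] : IsBimonHom (fst X Y) where
instance isBimonHom_snd (X Y : M) [BimonObj X] [BimonObj Y] : IsBimonHom (snd X Y) where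

theorem isBimonHom_pair {C X Y : M} [BimonObj C] [BimonObj X] [BimonObj Y] (f : C ⟶ X) (g : C ⟶ Y)
    [IsBimonHom f] [IsBimonHom g] (h : Coc f g) : IsBimonHom (pair f g) := by
  have := isComonHom_pair f g h
  have : IsMonHom (pair f g) := by
    rw [pair_eq_mul]
    exact isMonHom_mul _ _ ((comIm_inl_inr X Y).pre _ _)
  constructor

/-- A span in the class induces a bimonoid morphism to `A ⊗ D`, and the commuting square makes it
factor through the cotensor equalizer. The projections reflect the class since `Coc` can be tested
after the equalizer inclusion. -/
theorem exists_relPullback [HasEqualizers M]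
    [∀ X : M, PreservesLimitsOfShape WalkingParallelPair (tensorLeft X)]
    {A B D : Bimon M} (f : A ⟶ B) (g : D ⟶ B) (hf : (coSpans M).mem (𝟙 A) f)
    (hg : (coSpans M).mem g (𝟙 D)) :
    ∃ P : RelPullback (coSpans M) f g, Mono (pair (und P.fst) (und P.snd)) := by
  rw [coSpans_mem_iff] at hf hg
  obtain ⟨_, _⟩ := exists_bimonObj_cotensor hf hg
    (isEq_equalizer (cotensorLeft (car D) (und f)) (cotensorRight (car A) (und g)))
  obtain ⟨P, e, hbim, he⟩ := exists_bimon _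
    (isEq_equalizer (cotensorLeft (car D) (und f)) (cotensorRight (car A) (und g)))
  let p₁ : P ⟶ A := ofUnd (e ≫ fst _ _)
  let p₂ : P ⟶ D := ofUnd (e ≫ snd _ _)
  have hp₁ : und p₁ = e ≫ fst _ _ := rfl
  have hp₂ : und p₂ = e ≫ snd _ _ := rfl
  have hp : pair (und p₁) (und p₂) = e := by
    rw [hp₁, hp₂, ← comp_pair, pair_fst_snd, Category.comp_id]
  have he₁ := he.mono
  have he₂ := he.mono_tensorHom he
  have hcoc : Coc (und p₁) (und p₂) := (coc_fst_snd _ _).pre e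
  have hw : und p₁ ≫ und f = und p₂ ≫ und g := by
    -- Collapsing the two outer legs by counits leaves the equation of the square.
    have h := cotensor_apply he.w (1 : car A ⟶ car B) (𝟙 _) (1 : car D ⟶ car B)
    simp only [comp_one, one_mul, mul_one, Category.comp_id] at h
    rw [hp₁, hp₂, Category.assoc, Category.assoc, h]
  have hcomp : ∀ {X : Bimon M} (h : X ⟶ P), und h ≫ e = pair (und (h ≫ p₁)) (und (h ≫ p₂)) := by
    intro X h
    rw [← hp, comp_pair]
    rfl
  have hrefl : ∀ {X E' : Bimon M} (h : X ⟶ P) (k : X ⟶ E'),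
      (coSpans M).mem (h ≫ p₁) k → (coSpans M).mem (h ≫ p₂) k → (coSpans M).mem h k := by
    intro X E' h k h₁ h₂
    rw [coSpans_mem_iff] at *
    refine Coc.of_comp_mono he ?_
    rw [hcomp]
    exact h₁.pair_left h₂
  refine ⟨{
    pt := P
    fst := p₁
    snd := p₂
    condition := Bimon.ext hw
    mem := coSpans_mem_iff.2 hcoc
    existsUnique := ?_
    reflect_left := hrefl
    reflect_right := ?_ }, by rw [hp]; exact he₁⟩
  · intro X a c hS w
    rw [coSpans_mem_iff] at hS
    have hw' : und a ≫ und f = und c ≫ und g := congrArg und w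
    have hbi := isBimonHom_pair _ _ hS
    obtain ⟨h, hh⟩ := he.exists_lift (pair (und a) (und c)) (by
      rw [cotensorLeft, cotensorRight, comp_pair, comp_pair, comp_pair, comp_pair, ← Category.assoc,
        ← Category.assoc _ (snd _ _), pair_fst, pair_snd, hw'])
    have : IsBimonHom (h ≫ e) := by rwa [hh]
    have := isBimonHom_of_comp_mono h e he₁ he₂
    refine ⟨ofUnd h, ⟨Bimon.ext ?_, Bimon.ext ?_⟩, ?_⟩
    · change h ≫ und p₁ = und a
      rw [hp₁, reassoc_of% hh, pair_fst]
    · change h ≫ und p₂ = und c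
      rw [hp₂, reassoc_of% hh, pair_snd]
    · rintro k ⟨hk₁, hk₂⟩
      refine Bimon.ext ?_
      change und k = h
      rw [← cancel_mono e, hcomp, hh, hk₁, hk₂]
  · intro X E' k h h₁ h₂
    rw [coSpans_mem_iff] at *
    exact (coSpans_mem_iff.1 (hrefl h k (coSpans_mem_iff.2 h₁.symm)
      (coSpans_mem_iff.2 h₂.symm))).symm

/-- The pullbacks in a relative category are arbitrary choices, so the property is transported from
the constructed one along the comparison morphism. -/
theorem RelPullback.mono_pair [HasEqualizers M]
    [∀ X : M, PreservesLimitsOfShape WalkingParallelPair (tensorLeft X)]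
    {A B D : Bimon M} {f : A ⟶ B} {g : D ⟶ B} (hf : (coSpans M).mem (𝟙 A) f)
    (hg : (coSpans M).mem g (𝟙 D)) (P : RelPullback (coSpans M) f g) :
    Mono (pair (und P.fst) (und P.snd)) := by
  obtain ⟨Q, hQ⟩ := exists_relPullback f g hf hg
  let a : P.pt ⟶ Q.pt := Q.lift P.fst P.snd P.mem P.condition
  let b : Q.pt ⟶ P.pt := P.lift Q.fst Q.snd Q.mem Q.condition
  have ha₁ : a ≫ Q.fst = P.fst := Q.lift_fst _ _ _ _
  have ha₂ : a ≫ Q.snd = P.snd := Q.lift_snd _ _ _ _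
  have hb₁ : b ≫ P.fst = Q.fst := P.lift_fst _ _ _ _
  have hb₂ : b ≫ P.snd = Q.snd := P.lift_snd _ _ _ _
  have hab : a ≫ b = 𝟙 _ := P.hom_ext (by rw [Category.assoc, hb₁, ha₁, Category.id_comp])
    (by rw [Category.assoc, hb₂, ha₂, Category.id_comp])
  have hab' : und a ≫ und b = 𝟙 _ := congrArg und hab
  have h : pair (und P.fst) (und P.snd) = und a ≫ pair (und Q.fst) (und Q.snd) := by
    rw [comp_pair, ← ha₁, ← ha₂]; rfl
  have : Mono (und a) := mono_of_mono_fac hab'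
  rw [h]
  infer_instance

end Cotensor

/-! ### Relative categories: the composition is forced and the commutation condition holds -/

section Compositions

variable {M : Type u} [Category.{v} M] [MonoidalCategory M] [SymmetricCategory M]

theorem ComIm.of_comp_mono {X Y R S : M} [MonObj R] [MonObj S] {f : X ⟶ R} {g : Y ⟶ R} (e : R ⟶ S)
    [IsMonHom e] [Mono e] (h : ComIm (f ≫ e) (g ≫ e)) : ComIm f g := by
  rw [ComIm, ← cancel_mono e, Category.assoc, copair_comp, copair_comp]
  exact h

omit [SymmetricCategory M] in
theorem inl_tensorHom {X Y X' Y' : M} [MonObj Y] [MonObj Y'] (f : X ⟶ X') (g : Y ⟶ Y')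
    [IsMonHom g] : inl X Y ≫ (f ⊗ₘ g) = f ≫ inl X' Y' := by
  simp [inl, ← id_tensorHom]
  simp [MonoidalCategory.tensorHom_def]

omit [SymmetricCategory M] in
theorem inr_tensorHom {X Y X' Y' : M} [MonObj X] [MonObj X'] (f : X ⟶ X') (g : Y ⟶ Y')
    [IsMonHom f] : inr X Y ≫ (f ⊗ₘ g) = g ≫ inr X' Y' := by
  simp [inr, ← tensorHom_id]
  simp [MonoidalCategory.tensorHom_def']

theorem tArr_pair {A B : M} [BimonObj A] [BimonObj B] {t : A ⟶ B} {i : B ⟶ A} [IsBimonHom t]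
    [IsBimonHom i] (hi : i ≫ t = 𝟙 B) (ht : Coc t (𝟙 A)) {z : B ⟶ B} (hz : IsInv z) :
    tArr t z i ≫ pair t (𝟙 A) = tArr t z i ≫ inr B A := by
  have := isComonHom_antipode hi ht.symm hz
  have h : (t ≫ z ≫ i) ≫ pair t (𝟙 A) = (t ≫ z ≫ inl B A) * (t ≫ z ≫ i ≫ inr B A) := by
    rw [Category.assoc, Category.assoc, comp_pair, hi, Category.comp_id, pair_eq_mul, comp_mul,
      comp_mul, Category.id_comp]
  have h₁ : Commute (t ≫ z ≫ i ≫ inr B A) (t ≫ inl B A) := by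
    have hB := (((coc_id_of_section hi ht.symm).pre t).post_left (z ≫ i)).commute
      (comIm_inl_inr B A).symm
    simpa using hB
  have := isMonHom_pair_comp_snd t
  rw [tArr, mul_comp, h, Category.id_comp, pair_eq_mul, h₁.mul_mul_mul_comm, hz.inv_mul, one_mul,
    Category.id_comp, mul_comp, Category.id_comp, Category.assoc, Category.assoc]

theorem sArr_pair_comp {A B : M} [BimonObj A] [BimonObj B] {s : A ⟶ B} {i : B ⟶ A} [IsBimonHom s]
    [IsBimonHom i] (hi : i ≫ s = 𝟙 B) (hs : Coc (𝟙 A) s) {z : B ⟶ B} (hz : IsInv z) :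
    sArr s z i ≫ pair (𝟙 A) (s ≫ i) = sArr s z i ≫ inl A A := by
  have h := congrArg (· ≫ (𝟙 A ⊗ₘ i)) (sArr_pair hi hs hz)
  simpa only [Category.assoc, pair_tensorHom, inl_tensorHom, Category.id_comp] using h

theorem tArr_pair_comp {A B : M} [BimonObj A] [BimonObj B] {t : A ⟶ B} {i : B ⟶ A} [IsBimonHom t]
    [IsBimonHom i] (hi : i ≫ t = 𝟙 B) (ht : Coc t (𝟙 A)) {z : B ⟶ B} (hz : IsInv z) :
    tArr t z i ≫ pair (t ≫ i) (𝟙 A) = tArr t z i ≫ inr A A := by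
  have h := congrArg (· ≫ (i ⊗ₘ 𝟙 A)) (tArr_pair hi ht hz)
  simpa only [Category.assoc, pair_tensorHom, inr_tensorHom, Category.id_comp] using h

/-- The conditions on a reflexive graph of bimonoids with `B` a Hopf monoid, apart from the
invertibility of `q`. -/
structure IsHopfGraph (G : ReflGraph (Bimon M)) (z : car G.B ⟶ car G.B) : Prop where
  inv : IsInv z
  coc_s : Coc (𝟙 (car G.A)) (und G.s)
  coc_t : Coc (und G.t) (𝟙 (car G.A))
  comIm : ComIm (sArr (und G.s) z (und G.i)) (tArr (und G.t) z (und G.i))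

theorem sArrow_eq (G : ReflGraph (Bimon M)) (z : car G.B ⟶ car G.B) :
    sArrow G z = sArr (und G.s) z (und G.i) := by
  simp [sArrow, sArr, mul_def]

theorem tArrow_eq (G : ReflGraph (Bimon M)) (z : car G.B ⟶ car G.B) :
    tArrow G z = tArr (und G.t) z (und G.i) := by
  simp [tArrow, tArr, mul_def]

theorem villanueva_iff {G : ReflGraph (Bimon M)} : Villanueva G ↔ ∃ z : car G.B ⟶ car G.B,
    IsInv z ∧ Coc (und G.t) (𝟙 (car G.A)) ∧
      ComIm (sArr (und G.s) z (und G.i)) (tArr (und G.t) z (und G.i)) := by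
  refine exists_congr fun z => ?_
  rw [isAntipode_iff, ← tensorHom_id, ← sArrow_eq, ← tArrow_eq,
    BraidedCategory.braiding_naturality_assoc]
  refine and_congr_right fun _ => and_congr ?_ ?_
  · rw [Coc, pair, pair, Category.assoc, BraidedCategory.braiding_naturality]
  · exact eq_comm

theorem und_i_s (G : ReflGraph (Bimon M)) : und G.i ≫ und G.s = 𝟙 _ := congrArg und G.i_s

theorem und_i_t (G : ReflGraph (Bimon M)) : und G.i ≫ und G.t = 𝟙 _ := congrArg und G.i_t

theorem und_comp {X Y Z : Bimon M} (f : X ⟶ Y) (g : Y ⟶ Z) : und (f ≫ g) = und f ≫ und g := rfl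

theorem und_id (X : Bimon M) : und (𝟙 X) = 𝟙 (car X) := rfl

theorem und_injective {X Y : Bimon M} {f g : X ⟶ Y} (h : und f = und g) : f = g := Bimon.ext h

section Lift

variable {A B D : Bimon M} {f : A ⟶ B} {g : D ⟶ B} (P : RelPullback (coSpans M) f g)

theorem und_comp_pair {X : Bimon M} (h : X ⟶ P.pt) :
    und h ≫ pair (und P.fst) (und P.snd) = pair (und (h ≫ P.fst)) (und (h ≫ P.snd)) := by
  rw [comp_pair]; rfl

instance isBimonHom_pair_relPullback : IsBimonHom (pair (und P.fst) (und P.snd)) :=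
  isBimonHom_pair _ _ (coSpans_mem_iff.1 P.mem)

theorem und_lift_mul {X : Bimon M} (a : X ⟶ A) (c : X ⟶ D) (hS : (coSpans M).mem a c)
    (w : a ≫ f = c ≫ g) {R : M} [MonObj R] (x : car A ⟶ R) (y : car D ⟶ R) :
    und (P.lift a c hS w) ≫ ((und P.fst ≫ x) * (und P.snd ≫ y)) = (und a ≫ x) * (und c ≫ y) := by
  rw [comp_mul, ← Category.assoc, ← Category.assoc, ← und_comp, ← und_comp, P.lift_fst, P.lift_snd]

end Lift

section RelCategory

theorem PreRelCategory.unitRight_pair (X : PreRelCategory (coSpans M)) :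
    und X.unitRight ≫ pair (und X.sq.fst) (und X.sq.snd) =
      pair (𝟙 (car X.A)) (und X.s ≫ und X.i) := by
  rw [und_comp_pair, PreRelCategory.unitRight, X.sq.lift_fst, X.sq.lift_snd]; rfl

theorem PreRelCategory.unitLeft_pair (X : PreRelCategory (coSpans M)) :
    und X.unitLeft ≫ pair (und X.sq.fst) (und X.sq.snd) =
      pair (und X.t ≫ und X.i) (𝟙 (car X.A)) := by
  rw [und_comp_pair, PreRelCategory.unitLeft, X.sq.lift_fst, X.sq.lift_snd]; rfl

theorem RelCategory.und_unitRight_d (X : RelCategory (coSpans M)) :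
    und X.unitRight ≫ und X.d = 𝟙 _ := congrArg und X.unitRight_d

theorem RelCategory.und_unitLeft_d (X : RelCategory (coSpans M)) :
    und X.unitLeft ≫ und X.d = 𝟙 _ := congrArg und X.unitLeft_d

variable [HasEqualizers M] [∀ X : M, PreservesLimitsOfShape WalkingParallelPair (tensorLeft X)]

/-- Inside `A ⊗ A`, σ followed by `1 □ i` lies in the first factor and τ followed by `i □ 1` in the
second, so they commute in `A □ A`. The monoid morphism `d` carries this to σ and τ by the unit
laws. -/
theorem RelCategory.isHopfGraph (X : RelCategory (coSpans M)) {z : car X.B ⟶ car X.B}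
    (hz : IsInv z) : IsHopfGraph X.toReflGraph z := by
  have hs := coSpans_mem_iff.1 X.mem_s
  have ht := coSpans_mem_iff.1 X.mem_t
  have := RelPullback.mono_pair X.mem_s X.mem_t X.sq
  refine ⟨hz, hs, ht, ?_⟩
  have h : ComIm (sArr (und X.s) z (und X.i) ≫ und X.unitRight)
      (tArr (und X.t) z (und X.i) ≫ und X.unitLeft) := by
    refine ComIm.of_comp_mono (pair (und X.sq.fst) (und X.sq.snd)) ?_
    rw [Category.assoc, Category.assoc, PreRelCategory.unitRight_pair,
      PreRelCategory.unitLeft_pair, sArr_pair_comp (und_i_s _) hs hz,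
      tArr_pair_comp (und_i_t _) ht hz]
    exact (comIm_inl_inr _ _).pre _ _
  have h' := h.post (und X.d)
  rwa [Category.assoc, Category.assoc, X.und_unitRight_d, X.und_unitLeft_d, Category.comp_id,
    Category.comp_id] at h'

/-- The identity of `A □ A` is a product of two morphisms that factor through the units `1 □ i` and
`i □ 1`; applying `d` leaves no freedom. -/
theorem RelCategory.und_d (X : RelCategory (coSpans M)) {z : car X.B ⟶ car X.B}
    (hz : IsInv z) :
    und X.d = (und X.sq.fst ≫ sArr (und X.s) z (und X.i)) * und X.sq.snd := by
  have hs := coSpans_mem_iff.1 X.mem_s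
  have := RelPullback.mono_pair X.mem_s X.mem_t X.sq
  have hw : und X.sq.fst ≫ und X.s = und X.sq.snd ≫ und X.t := congrArg und X.sq.condition
  have h : (und X.sq.fst ≫ sArr (und X.s) z (und X.i) ≫ und X.unitRight) *
      (und X.sq.snd ≫ und X.unitLeft) = 𝟙 _ := by
    -- In the first tensor leg, `hw` turns `it` of the second projection into `is` of the first, and
    -- `sArr_mul` recombines the result.
    rw [← cancel_mono (pair (und X.sq.fst) (und X.sq.snd)), mul_comp, Category.assoc,
      Category.assoc, Category.assoc, PreRelCategory.unitRight_pair,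
      PreRelCategory.unitLeft_pair, sArr_pair_comp (und_i_s _) hs hz, pair_eq_mul, comp_mul,
      Category.id_comp, ← mul_assoc, Category.assoc, ← Category.assoc _ (und X.t), ← hw,
      Category.id_comp, pair_eq_mul]
    congr 1
    rw [Category.assoc, ← comp_mul, ← Category.assoc (und X.s), ← mul_comp, sArr_mul hz,
      Category.id_comp]
  have h' := congrArg (· ≫ und X.d) h
  simp only [mul_comp, Category.assoc, X.und_unitRight_d, X.und_unitLeft_d, Category.comp_id,
    Category.id_comp] at h'
  exact h'.symm

end RelCategory

end Compositions

/-! ### Constructing the composition from the commutation condition -/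

section Composition

variable {M : Type u} [Category.{v} M] [MonoidalCategory M] [SymmetricCategory M]

theorem one_comp_mul {S R : M} [BimonObj S] [MonObj R] {f g : S ⟶ R} (hf : η[S] ≫ f = η[R])
    (hg : η[S] ≫ g = η[R]) : η[S] ≫ (f * g) = η[R] := by
  rw [mul_def, BimonObj.one_comul_assoc, Mon.one_def]
  simp [← unitors_equal, hf, hg]

section

variable {P A B : M} [BimonObj P] [BimonObj A] [BimonObj B] {s t : A ⟶ B} {i : B ⟶ A} {z : B ⟶ B}
  [IsBimonHom s] [IsBimonHom t] [IsBimonHom i] {p₁ p₂ : P ⟶ A} [IsBimonHom p₁] [IsBimonHom p₂]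

omit [IsBimonHom t] in
-- In σ(xx') yy' = x₁ σ(x') · izs(x₂) y · y', the condition `hw` turns izs(x₂) y into τ(y). By `hV`
-- this commutes with σ(x'), and after the swap the product is σ(x) y · σ(x') y'.
theorem isBimonHom_comp_sArr_mul (hi : i ≫ s = 𝟙 B) (hs : Coc (𝟙 A) s) (hz : IsInv z)
    (hV : ComIm (sArr s z i) (tArr t z i)) (hp : Coc p₁ p₂) (hw : p₁ ≫ s = p₂ ≫ t) :
    IsBimonHom ((p₁ ≫ sArr s z i) * p₂) := by
  have := isComonHom_sArr hi hs hz
  have h₁ : IsComonHom ((p₁ ≫ sArr s z i) * p₂) := isComonHom_mul' _ _ (hp.post_left _)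
  have h₂ : IsMonHom ((p₁ ≫ sArr s z i) * p₂) := by
    refine isMonHom_of_mul _ (one_comp_mul ?_ (IsMonHom.one_hom p₂)) ?_
    · rw [IsMonHom.one_hom_assoc]
      refine one_comp_mul (Category.comp_id _) ?_
      rw [IsMonHom.one_hom_assoc, ← Category.assoc, hz.one_comp, IsMonHom.one_hom]
    · have e₁ : μ[P] ≫ p₁ ≫ sArr s z i = (fst P P ≫ p₁) *
          ((snd P P ≫ p₁ ≫ sArr s z i) * (fst P P ≫ p₁ ≫ s ≫ z ≫ i)) := by
        rw [IsMonHom.mul_hom_assoc, mul_comp_sArr hz, comp_mul, comp_mul, tensorHom_fst_assoc,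
          tensorHom_snd_assoc, tensorHom_fst]
      have e₂ : (fst P P ≫ p₁ ≫ s ≫ z ≫ i) * (fst P P ≫ p₂) = (fst P P ≫ p₂) ≫ tArr t z i := by
        rw [tArr, comp_mul, Category.comp_id, reassoc_of% hw, Category.assoc]
      have e₃ : Commute ((snd P P ≫ p₁) ≫ sArr s z i) ((fst P P ≫ p₂) ≫ tArr t z i) :=
        ((coc_fst_snd P P).symm.post p₁ p₂).commute hV
      have e₄ : fst P P ≫ p₁ ≫ sArr s z i = (fst P P ≫ p₁) * (fst P P ≫ p₁ ≫ s ≫ z ≫ i) := by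
        rw [sArr, comp_mul, comp_mul, Category.comp_id]
      rw [comp_mul, e₁, mul_comp_eq, comp_mul, comp_mul, e₄]
      calc _ = (fst P P ≫ p₁) * (((snd P P ≫ p₁) ≫ sArr s z i) *
            ((fst P P ≫ p₁ ≫ s ≫ z ≫ i) * (fst P P ≫ p₂))) * (snd P P ≫ p₂) := by
            simp only [mul_assoc, Category.assoc]
        _ = _ := by rw [e₂, e₃.eq, ← e₂]; simp only [mul_assoc, Category.assoc]
  constructor

omit [BimonObj B] [IsBimonHom s] [IsBimonHom i] in
theorem comp_sArr_eq_mul (k : P ⟶ A) [IsComonHom k] :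
    k ≫ sArr s z i = k * (k ≫ s ≫ z ≫ i) := by
  rw [sArr, comp_mul, Category.comp_id]

omit [IsBimonHom i] [IsBimonHom p₂] in
theorem comp_sArr_mul_comp_s (hi : i ≫ s = 𝟙 B) (hz : IsInv z) :
    ((p₁ ≫ sArr s z i) * p₂) ≫ s = p₂ ≫ s := by
  rw [mul_comp, Category.assoc, sArr_comp_s hi hz, comp_one, one_mul]

omit [IsBimonHom i] [IsBimonHom p₂] in
theorem comp_sArr_mul_comp_t (hi : i ≫ t = 𝟙 B) (hz : IsInv z)
    (hw : p₁ ≫ s = p₂ ≫ t) : ((p₁ ≫ sArr s z i) * p₂) ≫ t = p₁ ≫ t := by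
  have h := hz.inv_mul (p₁ ≫ s) (𝟙 B)
  rw [Category.comp_id, Category.comp_id, Category.assoc] at h
  rw [mul_comp, ← hw, Category.assoc, sArr, mul_comp, comp_mul, mul_assoc, Category.assoc,
    Category.assoc, hi, Category.comp_id, h, mul_one, Category.id_comp]

/-- The composite has the same `s` as its second factor, so the correction term in σ only affects
that factor. This is the source of associativity. -/
theorem comp_sArr_mul_comp_sArr (hi : i ≫ s = 𝟙 B) (hs : Coc (𝟙 A) s) (hz : IsInv z)
    (hp : Coc p₁ p₂) :
    ((p₁ ≫ sArr s z i) * p₂) ≫ sArr s z i = (p₁ ≫ sArr s z i) * (p₂ ≫ sArr s z i) := by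
  have := isComonHom_sArr hi hs hz
  have : IsComonHom ((p₁ ≫ sArr s z i) * p₂) := isComonHom_mul' _ _ (hp.post_left _)
  have h' : ((p₁ ≫ sArr s z i) * p₂) ≫ s ≫ z ≫ i = p₂ ≫ s ≫ z ≫ i := by
    rw [← Category.assoc, comp_sArr_mul_comp_s hi hz, Category.assoc]
  rw [comp_sArr_eq_mul, h', comp_sArr_eq_mul p₂, mul_assoc]

end

section

theorem und_lift_comp_sArr_mul {D B : Bimon M} {s t : D ⟶ B} {P : RelPullback (coSpans M) s t}
    {X : Bimon M} (a : X ⟶ D) (c : X ⟶ D) (hS : (coSpans M).mem a c) (w : a ≫ s = c ≫ t)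
    (x : car D ⟶ car D) : und (P.lift a c hS w) ≫ ((und P.fst ≫ x) * und P.snd) =
      (und a ≫ x) * und c := by
  have h := und_lift_mul P a c hS w x (𝟙 _)
  rwa [Category.comp_id, Category.comp_id] at h

theorem sArr_naturality {A B A' B' : M} [BimonObj A] [BimonObj B] [BimonObj A'] [BimonObj B']
    {s : A ⟶ B} {i : B ⟶ A} {z : B ⟶ B} {s' : A' ⟶ B'} {i' : B' ⟶ A'} {z' : B' ⟶ B'}
    (hz : IsInv z) (hz' : IsInv z') (a : A ⟶ A') (b : B ⟶ B') [IsBimonHom a] [IsBimonHom b]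
    (h₁ : a ≫ s' = s ≫ b) (h₂ : b ≫ i' = i ≫ a) :
    a ≫ sArr s' z' i' = sArr s z i ≫ a := by
  have h := hz.comp_eq hz' b
  rw [sArr, comp_mul, sArr, mul_comp, Category.comp_id, Category.id_comp, reassoc_of% h₁,
    reassoc_of% h, h₂]
  simp only [Category.assoc]

variable {G : ReflGraph (Bimon M)} {z : car G.B ⟶ car G.B}
variable [HasEqualizers M] [∀ X : M, PreservesLimitsOfShape WalkingParallelPair (tensorLeft X)]

/-- The formula for `d` is stated for every antipode, which avoids transporting `z` along the
equality of graphs; antipodes are unique. -/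
theorem IsHopfGraph.exists_preRelCategory (hG : IsHopfGraph G z) :
    ∃ X : PreRelCategory (coSpans M), X.toReflGraph = G ∧
      ∀ z : car X.B ⟶ car X.B, IsInv z →
        und X.d = (und X.sq.fst ≫ sArr (und X.s) z (und X.i)) * und X.sq.snd := by
  have hs : (coSpans M).mem (𝟙 G.A) G.s := coSpans_mem_iff.2 hG.coc_s
  have ht : (coSpans M).mem G.t (𝟙 G.A) := coSpans_mem_iff.2 hG.coc_t
  obtain ⟨P, -⟩ := exists_relPullback G.s G.t hs ht
  have hP := coSpans_mem_iff.1 P.mem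
  have hw : und P.fst ≫ und G.s = und P.snd ≫ und G.t := congrArg und P.condition
  have := isBimonHom_comp_sArr_mul (und_i_s G) hG.coc_s hG.inv hG.comIm hP hw
  have hPs : (coSpans M).mem (𝟙 P.pt) (P.snd ≫ G.s) := by
    refine P.reflect_left _ _ ?_ ?_
    · rw [Category.id_comp]
      exact (coSpans M).post_right G.s P.mem
    · have h := (coSpans M).pre P.snd hs
      rwa [Category.comp_id, ← Category.id_comp P.snd, Category.assoc, Category.id_comp (P.snd ≫ _)]
        at h
  obtain ⟨Q, -⟩ := exists_relPullback (P.snd ≫ G.s) G.t hPs ht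
  refine ⟨{
    toReflGraph := G
    mem_s := hs
    mem_t := ht
    sq := P
    cube := Q
    d := ofUnd ((und P.fst ≫ sArr (und G.s) z (und G.i)) * und P.snd)
    d_s := und_injective (comp_sArr_mul_comp_s (und_i_s G) hG.inv)
    d_t := und_injective (comp_sArr_mul_comp_t (und_i_t G) hG.inv hw) }, rfl, ?_⟩
  intro z' hz'
  have : z' = z := left_inv_eq_right_inv hz'.left hG.inv.right
  rw [this, und_ofUnd]

omit [HasEqualizers M] [∀ (X : M), PreservesLimitsOfShape WalkingParallelPair (tensorLeft X)] in
theorem PreRelCategory.exists_relCategory (X : PreRelCategory (coSpans M)) {z : car X.B ⟶ car X.B}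
    (hz : IsInv z)
    (hd : und X.d = (und X.sq.fst ≫ sArr (und X.s) z (und X.i)) * und X.sq.snd) :
    ∃ X' : RelCategory (coSpans M), X'.toPreRelCategory = X := by
  have hs := coSpans_mem_iff.1 X.mem_s
  have hdd : und X.d ≫ sArr (und X.s) z (und X.i) =
      (und X.sq.fst ≫ sArr (und X.s) z (und X.i)) *
        (und X.sq.snd ≫ sArr (und X.s) z (und X.i)) := by
    rw [hd]
    exact comp_sArr_mul_comp_sArr (und_i_s _) hs hz (coSpans_mem_iff.1 X.sq.mem)
  have hL : ∀ {Y : Bimon M} (a c : Y ⟶ X.A) (hS : (coSpans M).mem a c) (w : a ≫ X.s = c ≫ X.t),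
      und (X.sq.lift a c hS w) ≫ und X.d = (und a ≫ sArr (und X.s) z (und X.i)) * und c := by
    intro Y a c hS w
    rw [hd]
    exact und_lift_comp_sArr_mul a c hS w _
  have hS : ∀ {Y : Bimon M} {a : X.cube.pt ⟶ X.sq.pt} {c : X.cube.pt ⟶ X.A} (f : X.sq.pt ⟶ Y),
      (coSpans M).mem a c → (coSpans M).mem (a ≫ f) c := fun f h => (coSpans M).post_left f h
  refine ⟨{
    toPreRelCategory := X
    unitLeft_d := und_injective ?_
    unitRight_d := und_injective ?_
    assoc := und_injective ?_ }, rfl⟩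
  · rw [und_comp, PreRelCategory.unitLeft, hL, und_comp, Category.assoc, comp_sArr (und_i_s X.toReflGraph) hz, comp_one, one_mul]
  · rw [und_comp, PreRelCategory.unitRight, hL, und_id, Category.id_comp, und_comp, sArr_mul hz]
  -- Both bracketings reduce to σ(p₁) · σ(p₂) · p₃.
  · rw [und_comp, und_comp]
    have h₁ := hL (X.cube.fst ≫ X.d) X.cube.snd (hS _ X.cube.mem) (by
      rw [Category.assoc, X.d_s, X.cube.condition])
    have h₂ := hL (X.cube.fst ≫ X.sq.snd) X.cube.snd (hS _ X.cube.mem) (by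
      rw [Category.assoc, X.cube.condition])
    have h₃ := hL (X.cube.fst ≫ X.sq.fst) (X.lastTwo ≫ X.d)
      ((coSpans M).post_right X.d X.mem_lastTwo) (by
        rw [Category.assoc, Category.assoc, X.d_t, X.sq.condition, ← Category.assoc,
          ← Category.assoc, PreRelCategory.lastTwo, X.sq.lift_fst])
    refine h₁.trans (Eq.trans ?_ h₃.symm)
    rw [und_comp, und_comp X.lastTwo, Category.assoc, hdd, PreRelCategory.lastTwo, h₂, comp_mul,
      mul_assoc, und_comp, und_comp, Category.assoc, Category.assoc]

theorem IsHopfGraph.exists_relCategory (hG : IsHopfGraph G z) :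
    ∃ X : RelCategory (coSpans M), X.toReflGraph = G := by
  obtain ⟨X, rfl, hX⟩ := hG.exists_preRelCategory
  obtain ⟨X', rfl⟩ := X.exists_relCategory hG.inv (hX z hG.inv)
  exact ⟨X', rfl⟩

/-- Both compositions are given by σ, which is natural because bimonoid morphisms respect antipodes.
Hence the forgetful functor is full. -/
theorem RelCategory.mapSq_d {X Y : RelCategory (coSpans M)} (hX : IsHopf X.B) (hY : IsHopf Y.B)
    (f : X.toReflGraph ⟶ Y.toReflGraph) :
    RelCategory.mapSq (X := X) (Y := Y) f ≫ Y.d = X.d ≫ f.a := by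
  obtain ⟨z, hz⟩ := hX
  obtain ⟨z', hz'⟩ := hY
  rw [isAntipode_iff] at hz hz'
  apply und_injective
  rw [und_comp, und_comp, X.und_d hz, Y.und_d hz', RelCategory.mapSq]
  refine (und_lift_comp_sArr_mul _ _ _ _ _).trans ?_
  rw [mul_comp, und_comp, und_comp, Category.assoc, Category.assoc,
    sArr_naturality hz hz' (und f.a) (und f.b) (congrArg und f.a_s) (congrArg und f.b_i)]

end

/-! ### The equivalence between relative categories and graphs -/

section Equivalence

variable (M) [HasEqualizers M]
  [∀ X : M, PreservesLimitsOfShape WalkingParallelPair (tensorLeft X)]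

theorem hopfGraph_forget (X : (hopfCat M).FullSubcategory) :
    hopfGraph M ((hopfCat M).ι ⋙ RelCategory.forget (coSpans M) |>.obj X) := by
  obtain ⟨X, hq, z, hz⟩ := X
  have h := X.isHopfGraph (isAntipode_iff.1 hz)
  exact ⟨⟨X.mem_s, hq⟩, villanueva_iff.2 ⟨z, h.inv, h.coc_t, h.comIm⟩⟩

/-- Forgetting the composition. -/
def forgetHopf : (hopfCat M).FullSubcategory ⥤ (hopfGraph M).FullSubcategory :=
  (hopfGraph M).lift ((hopfCat M).ι ⋙ RelCategory.forget (coSpans M)) (hopfGraph_forget M)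

instance : (forgetHopf M).Faithful where
  map_injective {X Y f g} h := by
    apply ObjectProperty.hom_ext
    apply RelCategory.Hom.ext
    exact congrArg (fun k => k.hom) h

instance : (forgetHopf M).Full where
  map_surjective {X Y} f := by
    refine ⟨ObjectProperty.homMk ⟨f.hom, RelCategory.mapSq_d X.property.2 Y.property.2 f.hom⟩, rfl⟩

omit [∀ (X : M), PreservesLimitsOfShape WalkingParallelPair (tensorLeft X)] in
theorem hopfGraph_iff {G : ReflGraph (Bimon M)} :
    hopfGraph M G ↔ IsIso (q G) ∧ ∃ z, IsHopfGraph G z := by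
  rw [hopfGraph, reflGraphMon, coSpans_mem_iff, villanueva_iff]
  constructor
  · rintro ⟨⟨hs, hq⟩, z, hz, ht, hV⟩
    exact ⟨hq, z, hz, hs, ht, hV⟩
  · rintro ⟨hq, z, hz, hs, ht, hV⟩
    exact ⟨⟨hs, hq⟩, z, hz, ht, hV⟩

instance : (forgetHopf M).EssSurj where
  mem_essImage G := by
    obtain ⟨G, hG⟩ := G
    obtain ⟨hq, z, hz⟩ := (hopfGraph_iff M).1 hG
    obtain ⟨X, rfl⟩ := hz.exists_relCategory
    exact ⟨⟨X, hq, z, isAntipode_iff.2 hz.inv⟩, ⟨Iso.refl _⟩⟩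

instance : (forgetHopf M).IsEquivalence where

end Equivalence

end Composition

/-! ### The adjoint action on the kernel -/

section Action

variable {M : Type u} [Category.{v} M] [MonoidalCategory M] [SymmetricCategory M]

omit [SymmetricCategory M] in
theorem isComonHom_of_comp_mono {X E R : M} [ComonObj X] [ComonObj E] [ComonObj R] (h : X ⟶ E)
    (e : E ⟶ R) [IsComonHom e] (h₁ : IsComonHom (h ≫ e)) (h₂ : Mono (e ⊗ₘ e)) :
    IsComonHom h where
  hom_counit := by
    rw [← IsComonHom.hom_counit e, ← Category.assoc, IsComonHom.hom_counit (h ≫ e)]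
  hom_comul := by
    rw [← cancel_mono (e ⊗ₘ e), Category.assoc, Category.assoc, ← IsComonHom.hom_comul e,
      tensorHom_comp_tensorHom, ← Category.assoc]
    exact IsComonHom.hom_comul (h ≫ e)

section

variable {A B Y : M} [BimonObj A] [BimonObj B] [BimonObj Y] {s : A ⟶ B} {i : B ⟶ A} {z : B ⟶ B}
  [IsBimonHom s] [IsBimonHom i]

/-- `j` is the equalizer of `(1 ⊗ s) ∘ δ` and `1 ⊗ u`, and `i(b) j(y) = ∑ j(b₁ y) i(b₂)`. -/
structure IsKer (s : A ⟶ B) (i : B ⟶ A) (j : Y ⟶ A) (l : B ⊗ Y ⟶ Y) : Prop where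
  isEq : IsEq j (pair (𝟙 A) s) (inl A B)
  act : (fst B Y ≫ i) * (snd B Y ≫ j) = (l ≫ j) * (fst B Y ≫ i)

/-- The adjoint action, in terms of elements `b ⊗ y ↦ ∑ i(b₁) j(y) i(z(b₂))`. -/
def adj (i : B ⟶ A) (z : B ⟶ B) (j : Y ⟶ A) : B ⊗ Y ⟶ A :=
  (fst B Y ≫ i) * ((snd B Y ≫ j) * (fst B Y ≫ z ≫ i))

omit [IsBimonHom s] in
theorem isComonHom_adj (hi : i ≫ s = 𝟙 B) (hs : Coc (𝟙 A) s) (hz : IsInv z) (j : Y ⟶ A)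
    [IsBimonHom j] : IsComonHom (adj i z j) := by
  have := isComonHom_antipode hi hs hz
  have : IsComonHom ((snd B Y ≫ j) * (fst B Y ≫ z ≫ i)) :=
    isComonHom_mul' _ _ ((coc_fst_snd B Y).symm.post _ _)
  refine isComonHom_mul' _ _ (((coc_fst_snd B Y).post _ _).mul_right ?_)
  have h := ((coc_id_of_section hi hs).pre (fst B Y)).post i (z ≫ i)
  simpa using h

/-- The conjugate i(b₁) j(y) iz(b₂) is a comonoid morphism on which `s` is trivial, so it factors
through the kernel. -/
theorem exists_isKer (hi : i ≫ s = 𝟙 B) (hs : Coc (𝟙 A) s) (hz : IsInv z) {j : Y ⟶ A}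
    [IsBimonHom j] (hj : IsEq j (pair (𝟙 A) s) (inl A B)) : ∃ l : B ⊗ Y ⟶ Y, IsKer s i j l := by
  have := isComonHom_adj hi hs hz j
  have h₁ : adj i z j ≫ s = 1 := by
    have h := hz.mul_inv (fst B Y) (𝟙 B)
    rw [Category.comp_id, Category.comp_id] at h
    rw [adj, mul_comp, mul_comp]
    simp only [Category.assoc, hi, Category.comp_id, comp_eq_one_of_pair_eq hj.w, comp_one,
      one_mul, h]
  obtain ⟨l, hl⟩ := hj.exists_lift (adj i z j) (by
    rw [comp_pair, inl_eq_pair, comp_pair, h₁, comp_one])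
  refine ⟨l, hj, ?_⟩
  rw [hl, adj, mul_assoc, mul_assoc, hz.inv_mul, mul_one]

variable {j : Y ⟶ A} [IsBimonHom j] {l : B ⊗ Y ⟶ Y} (hl : IsKer s i j l)
include hl

omit [IsBimonHom j] [IsBimonHom s] in
theorem IsKer.comp_eq (hz : IsInv z) : l ≫ j = adj i z j := by
  rw [adj, ← mul_assoc, hl.act, mul_assoc, hz.mul_inv, mul_one]

omit [IsBimonHom s] in
theorem IsKer.isComonHom [∀ X : M, PreservesLimitsOfShape WalkingParallelPair (tensorLeft X)]
    (hi : i ≫ s = 𝟙 B) (hs : Coc (𝟙 A) s) (hz : IsInv z) :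
    IsComonHom l :=
  isComonHom_of_comp_mono l j (hl.comp_eq hz ▸ isComonHom_adj hi hs hz j)
    (hl.isEq.mono_tensorHom hl.isEq)

omit [IsBimonHom s] [IsBimonHom j] in
theorem IsKer.inr_act (hz : IsInv z) : inr B Y ≫ l = 𝟙 Y := by
  have := hl.isEq.mono
  rw [← cancel_mono j, Category.assoc, hl.comp_eq hz, adj, comp_mul, comp_mul]
  have h : (1 : Y ⟶ B) ≫ z = 1 := by rw [one_def, Category.assoc, hz.one_comp]
  simp only [← Category.assoc, inr_fst, inr_snd, h, one_comp, one_mul, mul_one]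

omit [IsBimonHom s] in
theorem IsKer.inl_act (hz : IsInv z) : inl B Y ≫ l = 1 := by
  have := hl.isEq.mono
  have h := hz.mul_inv (𝟙 B) i
  rw [← cancel_mono j, Category.assoc, hl.comp_eq hz, adj, comp_mul, comp_mul]
  simp only [← Category.assoc, inl_fst, inl_snd, one_comp, one_mul]
  rwa [Category.assoc]

omit [IsBimonHom s] in
theorem IsKer.mul_act [∀ X : M, PreservesLimitsOfShape WalkingParallelPair (tensorLeft X)]
    (hi : i ≫ s = 𝟙 B) (hs : Coc (𝟙 A) s) (hz : IsInv z) : μ[B] ▷ Y ≫ l = (α_ B B Y).hom ≫ B ◁ l ≫ l := by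
  have := hl.isEq.mono
  rw [← cancel_mono j]
  simp only [Category.assoc]
  have hμ : μ[B] ≫ z ≫ i = (snd B B ≫ z ≫ i) * (fst B B ≫ z ≫ i) := by
    rw [← Category.assoc, hz.mul_comp, RelXMod.mul_comp, Category.assoc, Category.assoc]
  have := hl.isComonHom hi hs hz
  have e : (B ◁ l ≫ snd B Y) ≫ j = snd B (B ⊗ Y) ≫ l ≫ j := by
    rw [whiskerLeft_snd, Category.assoc]
  rw [hl.comp_eq hz] at e ⊢
  rw [adj]
  simp only [comp_mul, whiskerRight_fst_assoc, whiskerRight_snd_assoc, whiskerLeft_fst_assoc]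
  rw [← Category.assoc (B ◁ l), e, mul_comp_eq, comp_mul, hμ, adj]
  simp only [comp_mul, associator_fst_assoc, associator_snd_fst_assoc, associator_snd_snd_assoc,
    mul_assoc]

omit [IsBimonHom s] in
-- Conjugation is multiplicative: the factors `iz` and `i` between the two conjugates cancel.
theorem IsKer.act_mul (hz : IsInv z) :
    B ◁ μ[Y] ≫ l = (B ◁ fst Y Y ≫ l) * (B ◁ snd Y Y ≫ l) := by
  have := hl.isEq.mono
  have h := hz.inv_mul (fst B (Y ⊗ Y)) i
  rw [← cancel_mono j, mul_comp]
  simp only [Category.assoc]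
  rw [hl.comp_eq hz, adj]
  simp only [comp_mul, whiskerLeft_fst_assoc, whiskerLeft_snd_assoc]
  rw [← mul_assoc, mul_comp_eq, comp_mul]
  simp only [mul_assoc, mul_cancel_left h]

omit [IsBimonHom s] [IsBimonHom j] in
theorem IsKer.act_comp (hz : IsInv z) {t : A ⟶ B} [IsBimonHom t] (ht : i ≫ t = 𝟙 B) :
    (l ≫ j ≫ t) * fst B Y = fst B Y * (snd B Y ≫ j ≫ t) := by
  have h := hz.inv_mul (fst B Y) (𝟙 B)
  rw [Category.comp_id, Category.comp_id] at h
  rw [← Category.assoc, hl.comp_eq hz, adj, mul_comp, mul_comp]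
  simp only [Category.assoc, ht, Category.comp_id]
  rw [mul_assoc, mul_assoc, h, mul_one]

omit [IsBimonHom s] in
-- After `j`, the left side reads itj(y₁) · j(y') · τ(j(y₂)). As j(y') is fixed by σ, it commutes
-- with τ(j(y₂)); then itj(y₁) τ(j(y₂)) collapses to j(y).
theorem IsKer.peiffer (hz : IsInv z) {t : A ⟶ B} [IsBimonHom t]
    (hV : ComIm (sArr s z i) (tArr t z i)) :
    ((j ≫ t) ▷ Y ≫ l) * fst Y Y = fst Y Y * snd Y Y := by
  have := hl.isEq.mono
  have h₁ := hz.mul_inv (fst Y Y ≫ j ≫ t) i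
  have h₂ : Commute ((snd Y Y ≫ j) ≫ sArr s z i) ((fst Y Y ≫ j) ≫ tArr t z i) :=
    ((coc_fst_snd Y Y).symm.post j j).commute hV
  rw [Category.assoc, comp_sArr_of_pair_eq hz hl.isEq.w, tArr, comp_mul, Category.comp_id] at h₂
  simp only [Category.assoc] at h₁ h₂
  rw [← cancel_mono j, mul_comp, mul_comp, Category.assoc, hl.comp_eq hz, adj, comp_mul, comp_mul]
  simp only [whiskerRight_fst_assoc, whiskerRight_snd_assoc, Category.assoc]
  rw [mul_assoc, mul_assoc, h₂.eq, mul_assoc, ← mul_assoc, h₁, one_mul]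

end

end Action

/-! ### Crossed module axioms in convolution form -/

section Translation

variable {M : Type u} [Category.{v} M] [MonoidalCategory M] [SymmetricCategory M]

theorem isCommComonObj_iff {B : M} [ComonObj B] : IsCommComonObj B ↔ Coc (𝟙 B) (𝟙 B) := by
  have h : Coc (𝟙 B) (𝟙 B) ↔ Δ[B] = Δ[B] ≫ (β_ B B).hom := by
    rw [Coc, pair, id_tensorHom_id, Category.comp_id]
  rw [h]
  exact ⟨fun h => (h.comul_comm).symm, fun h => ⟨h.symm⟩⟩

section

variable {B Y : Bimon M} {l : car B ⊗ car Y ⟶ car Y}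

theorem one_act_iff : η[car B] ▷ car Y ≫ l = (λ_ (car Y)).hom ↔ inr (car B) (car Y) ≫ l = 𝟙 _ := by
  rw [inr, Category.assoc, Iso.inv_comp_eq, Category.comp_id]

theorem act_one_iff : car B ◁ η[car Y] ≫ l = (ρ_ (car B)).hom ≫ ε[car B] ≫ η[car Y] ↔
    inl (car B) (car Y) ≫ l = 1 := by
  rw [inl, Category.assoc, Iso.inv_comp_eq, one_def]

theorem diagonal_comp_mul : diagonal l ≫ μ[car Y] =
    (car B ◁ fst (car Y) (car Y) ≫ l) * (car B ◁ snd (car Y) (car Y) ≫ l) := by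
  rw [diagonal, Category.assoc, Category.assoc, ← Category.assoc (tensorμ _ _ _ _),
    ← Category.assoc (Δ[car B] ▷ _), ← Category.assoc (Δ[car B] ▷ _), comul_shuffle,
    pair_tensorHom, pair_mul]

theorem comul_comp_diagonal : car B ◁ Δ[car Y] ≫ diagonal l = Δ[car B ⊗ car Y] ≫ (l ⊗ₘ l) := by
  rw [diagonal, Comon.tensorObj_comul, MonoidalCategory.tensorHom_def' Δ[car B] Δ[car Y],
    Category.assoc, Category.assoc]

theorem isComonHom_act_iff : IsComonHom l ↔
    l ≫ ε[car Y] = (ε[car B] ⊗ₘ ε[car Y]) ≫ (λ_ (𝟙_ M)).hom ∧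
      l ≫ Δ[car Y] = car B ◁ Δ[car Y] ≫ diagonal l := by
  rw [comul_comp_diagonal, ← Comon.tensorObj_counit]
  exact ⟨fun h => ⟨h.hom_counit, h.hom_comul⟩, fun h => ⟨h.1, h.2⟩⟩

theorem k_comul_iff {k : car Y ⟶ car B} :
    Δ[car Y] ≫ (β_ (car Y) (car Y)).hom ≫ k ▷ car Y = Δ[car Y] ≫ k ▷ car Y ↔
      Coc k (𝟙 (car Y)) := by
  rw [Coc, pair, pair, Category.assoc, BraidedCategory.braiding_naturality, tensorHom_id]
  exact eq_comm

theorem exchange_eq : exchange l = pair l (fst (car B) (car Y)) := by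
  have h : exchange l = (Δ[car B] ▷ car Y ≫ (α_ _ _ _).hom ≫ car B ◁ (β_ (car B) (car Y)).hom ≫
      (α_ _ _ _).inv) ≫ l ▷ car B := by simp only [exchange, Category.assoc]
  rw [h, comul_shuffle', ← tensorHom_id, pair_tensorHom, Category.id_comp, Category.comp_id]

theorem k_act_iff {k : car Y ⟶ car B} :
    exchange l ≫ k ▷ car B ≫ μ[car B] = car B ◁ k ≫ μ[car B] ↔
      (l ≫ k) * fst (car B) (car Y) = fst (car B) (car Y) * (snd (car B) (car Y) ≫ k) := by
  have h : car B ◁ k ≫ μ[car B] = copair (𝟙 (car B)) k := by rw [copair, id_tensorHom]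
  rw [exchange_eq, ← tensorHom_id, ← Category.assoc, pair_tensorHom, pair_mul, h, copair_eq_mul,
    Category.comp_id]

theorem peiffer_iff {k : car Y ⟶ car B} :
    Δ[car Y] ▷ car Y ≫ (α_ _ _ _).hom ≫ car Y ◁ (β_ (car Y) (car Y)).hom ≫
      (α_ _ _ _).inv ≫ (k ▷ car Y) ▷ car Y ≫ l ▷ car Y ≫ μ[car Y] = μ[car Y] ↔
    (k ▷ car Y ≫ l) * fst (car Y) (car Y) = fst (car Y) (car Y) * snd (car Y) (car Y) := by
  have h : Δ[car Y] ▷ car Y ≫ (α_ _ _ _).hom ≫ car Y ◁ (β_ (car Y) (car Y)).hom ≫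
      (α_ _ _ _).inv ≫ (k ▷ car Y) ▷ car Y ≫ l ▷ car Y ≫ μ[car Y] =
      ((Δ[car Y] ▷ car Y ≫ (α_ _ _ _).hom ≫ car Y ◁ (β_ (car Y) (car Y)).hom ≫
        (α_ _ _ _).inv) ≫ (k ▷ car Y ≫ l) ▷ car Y) ≫ μ[car Y] := by
    simp only [comp_whiskerRight, Category.assoc]
  rw [h, comul_shuffle', ← tensorHom_id, pair_tensorHom, pair_mul, Category.id_comp,
    Category.comp_id, ← mul_eq_fst_mul_snd]

end

/-- The crossed module determined by a kernel of a reflexive graph. -/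
def IsKer.xmod [∀ X : M, PreservesLimitsOfShape WalkingParallelPair (tensorLeft X)]
    {G : ReflGraph (Bimon M)} {z : car G.B ⟶ car G.B} (hG : IsHopfGraph G z)
    {Y : Bimon M} {j : Y ⟶ G.A} {l : car G.B ⊗ car Y ⟶ car Y}
    (hl : IsKer (und G.s) (und G.i) (und j) l) : XMod M where
  B := G.B
  Y := Y
  l := l
  k := j ≫ G.t
  cocomm := isCommComonObj_iff.2 (coc_id_of_section (und_i_s G) hG.coc_s)
  one_act := one_act_iff.2 (hl.inr_act hG.inv)
  mul_act := hl.mul_act (und_i_s G) hG.coc_s hG.inv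
  act_one := act_one_iff.2 (hl.inl_act hG.inv)
  act_mul := (hl.act_mul hG.inv).trans diagonal_comp_mul.symm
  act_counit := (isComonHom_act_iff.1 (hl.isComonHom (und_i_s G) hG.coc_s hG.inv)).1
  act_comul := (isComonHom_act_iff.1 (hl.isComonHom (und_i_s G) hG.coc_s hG.inv)).2
  k_comul := k_comul_iff.2 (by
    have h := hG.coc_t.pre (und j)
    rw [Category.comp_id] at h
    refine (Coc.of_comp_mono hl.isEq ?_).symm
    rw [Category.id_comp]
    exact h.symm)
  k_act := k_act_iff.2 (hl.act_comp hG.inv (und_i_t G))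
  peiffer := peiffer_iff.2 (hl.peiffer hG.inv hG.comIm)

end Translation

/-! ### Morphisms out of a smash product -/

section Smash

variable {M : Type u} [Category.{v} M] [MonoidalCategory M] [SymmetricCategory M]

omit [SymmetricCategory M] in
theorem pair_pair_associator {C X Y Z : M} [ComonObj C] (f : C ⟶ X) (g : C ⟶ Y) (h : C ⟶ Z) :
    pair (pair f g) h ≫ (α_ X Y Z).hom = pair f (pair g h) := by
  have e : ((Δ[C] ≫ (f ⊗ₘ g)) ⊗ₘ h) = (Δ[C] ▷ C) ≫ ((f ⊗ₘ g) ⊗ₘ h) := by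
    rw [← tensorHom_id, tensorHom_comp_tensorHom, Category.id_comp]
  have e' : (f ⊗ₘ (Δ[C] ≫ (g ⊗ₘ h))) = (C ◁ Δ[C]) ≫ (f ⊗ₘ (g ⊗ₘ h)) := by
    rw [← id_tensorHom, tensorHom_comp_tensorHom, Category.id_comp]
  rw [pair, pair, pair, pair, e, e', Category.assoc, Category.assoc, associator_naturality,
    ComonObj.comul_assoc_assoc]

section

variable {B Y : M} [BimonObj B] [BimonObj Y] (l : B ⊗ Y ⟶ Y)

/-- The composite of `(f, g)` with an action `l`. -/
def act {C : M} [ComonObj C] (f : C ⟶ B) (g : C ⟶ Y) : C ⟶ Y := pair f g ≫ l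

/-- The multiplication `(y ⊗ b) ⊗ (y' ⊗ b') ↦ ∑ y (b₁ y') ⊗ b₂ b'` of the smash product. -/
def smashMul : (Y ⊗ B) ⊗ (Y ⊗ B) ⟶ Y ⊗ B :=
  pair ((fst (Y ⊗ B) (Y ⊗ B) ≫ fst Y B) *
      act l (fst (Y ⊗ B) (Y ⊗ B) ≫ snd Y B) (snd (Y ⊗ B) (Y ⊗ B) ≫ fst Y B))
    ((fst (Y ⊗ B) (Y ⊗ B) ≫ snd Y B) * (snd (Y ⊗ B) (Y ⊗ B) ≫ snd Y B))

omit [SymmetricCategory M] [BimonObj B] [BimonObj Y] in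
theorem comp_act {C D : M} [ComonObj C] [ComonObj D] (h : D ⟶ C) [IsComonHom h] (f : C ⟶ B)
    (g : C ⟶ Y) : h ≫ act l f g = act l (h ≫ f) (h ≫ g) := by
  rw [act, act, ← comp_pair, Category.assoc]

variable {l} {A : M} [BimonObj A] {f : Y ⟶ A} {g : B ⟶ A}

/-- The exchange rule rewrites the middle of f(y) g(b) f(y') g(b') as f(b₁y') g(b₂). -/
theorem smash_copair [IsMonHom f] [IsMonHom g]
    (h : (fst B Y ≫ g) * (snd B Y ≫ f) = (l ≫ f) * (fst B Y ≫ g)) :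
    (copair f g ⊗ₘ copair f g) ≫ μ[A] = smashMul l ≫ copair f g := by
  have : IsComonHom (pair (fst (Y ⊗ B) (Y ⊗ B) ≫ snd Y B) (snd (Y ⊗ B) (Y ⊗ B) ≫ fst Y B)) :=
    isComonHom_pair _ _ ((coc_fst_snd _ _).post _ _)
  have e := congrArg (pair (fst (Y ⊗ B) (Y ⊗ B) ≫ snd Y B) (snd (Y ⊗ B) (Y ⊗ B) ≫ fst Y B) ≫ ·) h
  simp only [comp_mul, ← Category.assoc, pair_fst, pair_snd] at e
  rw [smashMul, pair_copair, mul_comp, mul_comp, act, mul_assoc, ← mul_assoc _ _ (_ ≫ g), ← e,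
    ← copair.eq_def, copair_eq_mul, copair_eq_mul, comp_mul, comp_mul]
  simp only [Category.assoc, mul_assoc]

/-- Universal property of the smash product: since `copair j i` is invertible, multiplicativity of
`h` can be tested on `Y ⊗ B`, where both products are computed by `smashMul`. -/
theorem isMonHom_of_smash {j : Y ⟶ A} {i : B ⟶ A} [IsMonHom j] [IsMonHom i]
    (hij : (fst B Y ≫ i) * (snd B Y ≫ j) = (l ≫ j) * (fst B Y ≫ i)) (hQ : IsIso (copair j i))
    {R : M} [BimonObj R] {f : Y ⟶ R} {g : B ⟶ R} [IsMonHom f] [IsMonHom g]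
    (hfg : (fst B Y ≫ g) * (snd B Y ≫ f) = (l ≫ f) * (fst B Y ≫ g)) (h : A ⟶ R)
    (hh : copair j i ≫ h = copair f g) : IsMonHom h where
  one_hom := by
    rw [← IsMonHom.one_hom i, ← inr_copair j i, Category.assoc, Category.assoc, hh, inr_copair,
      IsMonHom.one_hom]
  mul_hom := by
    rw [← cancel_epi (copair j i ⊗ₘ copair j i), ← Category.assoc, smash_copair hij,
      tensorHom_comp_tensorHom_assoc, hh, smash_copair hfg, Category.assoc, hh]

end

section

variable {A B Y A' B' Y' : M} [BimonObj A] [BimonObj B] [BimonObj Y] [BimonObj A'] [BimonObj B']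
  [BimonObj Y'] {s : A ⟶ B} {i : B ⟶ A} {z : B ⟶ B} {j : Y ⟶ A} {l : B ⊗ Y ⟶ Y}
  {s' : A' ⟶ B'} {i' : B' ⟶ A'} {z' : B' ⟶ B'} {j' : Y' ⟶ A'} {l' : B' ⊗ Y' ⟶ Y'}
  [IsBimonHom s] [IsBimonHom i] [IsBimonHom j] [IsBimonHom s'] [IsBimonHom i'] [IsBimonHom j']

omit [IsBimonHom s] [IsBimonHom s'] in
-- The restriction of `a` to kernels respects the actions because both are conjugation and `b`
-- respects antipodes.
theorem IsKer.exists_map [∀ X : M, PreservesLimitsOfShape WalkingParallelPair (tensorLeft X)]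
    (hl : IsKer s i j l) (hl' : IsKer s' i' j' l') (hz : IsInv z) (hz' : IsInv z')
    {a : A ⟶ A'} {b : B ⟶ B'} [IsBimonHom a] [IsBimonHom b] (h₁ : a ≫ s' = s ≫ b)
    (h₂ : b ≫ i' = i ≫ a) :
    ∃ y : Y ⟶ Y', IsBimonHom y ∧ y ≫ j' = j ≫ a ∧ (b ⊗ₘ y) ≫ l' = l ≫ y := by
  have := hl'.isEq.mono
  obtain ⟨y, hy⟩ := hl'.isEq.exists_lift (j ≫ a) (by
    have h := congrArg (· ≫ (a ⊗ₘ b)) hl.isEq.w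
    simp only [Category.assoc, pair_tensorHom, inl_tensorHom, Category.id_comp] at h
    rw [Category.assoc, Category.assoc, comp_pair, Category.comp_id, h₁, h])
  have hyj : IsBimonHom (y ≫ j') := by rw [hy]; infer_instance
  have := isBimonHom_of_comp_mono y j' hl'.isEq.mono (hl'.isEq.mono_tensorHom hl'.isEq)
  refine ⟨y, this, hy, ?_⟩
  have hbz := hz.comp_eq hz' b
  rw [← cancel_mono j', Category.assoc, Category.assoc, hl'.comp_eq hz', hy, ← Category.assoc l,
    hl.comp_eq hz, adj, adj, comp_mul, comp_mul, mul_comp, mul_comp]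
  simp only [tensorHom_fst_assoc, tensorHom_snd_assoc, hy, Category.assoc, h₂, reassoc_of% hbz]

/-- As `A` is the smash product of `Y` and `B`, the only candidate is j(y) i(b) ↦ j'(y) i'(b), and
compatibility with the actions is the exchange rule it needs. -/
theorem exists_of_ker (hQ : IsIso (copair j i)) (hl : IsKer s i j l) (hl' : IsKer s' i' j' l')
    (hi : i ≫ s = 𝟙 B) (hi' : i' ≫ s' = 𝟙 B')
    {y : Y ⟶ Y'} {b : B ⟶ B'} [IsBimonHom y] [IsBimonHom b] (h : (b ⊗ₘ y) ≫ l' = l ≫ y) :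
    ∃ a : A ⟶ A', IsBimonHom a ∧ j ≫ a = y ≫ j' ∧ i ≫ a = b ≫ i' ∧ a ≫ s' = s ≫ b := by
  have hcm : IsComonHom (copair j i) := by
    rw [copair_eq_mul]; exact isComonHom_mul' _ _ ((coc_fst_snd Y B).post j i)
  have hcm' : IsComonHom (copair (y ≫ j') (b ≫ i')) := by
    rw [copair_eq_mul]; exact isComonHom_mul' _ _ ((coc_fst_snd Y B).post _ _)
  obtain ⟨a, ha⟩ : ∃ a : A ⟶ A', copair j i ≫ a = copair (y ≫ j') (b ≫ i') :=
    ⟨inv (copair j i) ≫ copair (y ≫ j') (b ≫ i'), IsIso.hom_inv_id_assoc _ _⟩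
  have h₁ : IsMonHom a := by
    refine isMonHom_of_smash hl.act hQ ?_ a ha
    have e := congrArg ((b ⊗ₘ y) ≫ ·) hl'.act
    simp only [comp_mul, tensorHom_fst_assoc, tensorHom_snd_assoc, reassoc_of% h] at e
    exact e
  have h₂ : IsComonHom a := {
    hom_counit := by
      rw [← cancel_epi (copair j i), reassoc_of% ha, IsComonHom.hom_counit,
        IsComonHom.hom_counit]
    hom_comul := by
      rw [← cancel_epi (copair j i), reassoc_of% ha, IsComonHom.hom_comul,
        IsComonHom.hom_comul_assoc, tensorHom_comp_tensorHom, ha] }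
  have hja : j ≫ a = y ≫ j' := by
    rw [← inl_copair j i, Category.assoc, ha, inl_copair]
  have hia : i ≫ a = b ≫ i' := by
    rw [← inr_copair j i, Category.assoc, ha, inr_copair]
  refine ⟨a, ⟨⟩, hja, hia, ?_⟩
  rw [← cancel_epi (copair j i), reassoc_of% ha, ← Category.assoc, copair_comp, copair_comp,
    copair_comp, comp_eq_one_of_pair_eq hl.isEq.w, hi, Category.id_comp, one_comp]
  simp only [Category.assoc, hi', comp_eq_one_of_pair_eq hl'.isEq.w, comp_one, Category.comp_id]

end

end Smash

/-! ### The fully faithful functor from graphs to crossed modules -/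

section Functor

variable {M : Type u} [Category.{v} M] [MonoidalCategory M] [SymmetricCategory M]

/-- An antipode and a kernel of a reflexive graph of bimonoids. -/
structure KernelData (G : ReflGraph (Bimon M)) where
  z : car G.B ⟶ car G.B
  isHopfGraph : IsHopfGraph G z
  Y : Bimon M
  j : Y ⟶ G.A
  l : car G.B ⊗ car Y ⟶ car Y
  isKer : IsKer (und G.s) (und G.i) (und j) l

theorem pair_id_eq {G : ReflGraph (Bimon M)} :
    pair (𝟙 (car G.A)) (und G.s) = Δ[car G.A] ≫ car G.A ◁ und G.s := by
  rw [pair, id_tensorHom]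

variable [HasEqualizers M] [∀ X : M, PreservesLimitsOfShape WalkingParallelPair (tensorLeft X)]

theorem IsHopfGraph.isIso_q {G : ReflGraph (Bimon M)} {z : car G.B ⟶ car G.B}
    (hG : IsHopfGraph G z) : IsIso (q G) := by
  have h : IsEq (equalizer.ι (Δ[car G.A] ≫ car G.A ◁ und G.s)
      ((ρ_ (car G.A)).inv ≫ car G.A ◁ η[car G.B])) (pair (𝟙 (car G.A)) (und G.s))
      (inl (car G.A) (car G.B)) := by
    rw [pair_id_eq]
    exact isEq_equalizer _ _
  obtain ⟨_, _⟩ := exists_bimonObj_of_isEq hG.coc_s h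
  exact isIso_copair (und_i_s G) hG.coc_s hG.inv h

theorem hopfGraph_iff_exists {G : ReflGraph (Bimon M)} :
    hopfGraph M G ↔ ∃ z, IsHopfGraph G z := by
  rw [hopfGraph_iff]
  exact ⟨fun h => h.2, fun ⟨z, hz⟩ => ⟨hz.isIso_q, z, hz⟩⟩

theorem nonempty_kernelData {G : ReflGraph (Bimon M)} (hG : hopfGraph M G) :
    Nonempty (KernelData G) := by
  obtain ⟨z, hz⟩ := hopfGraph_iff_exists.1 hG
  obtain ⟨_, _⟩ := exists_bimonObj_of_isEq hz.coc_s (isEq_equalizer _ _)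
  obtain ⟨Y, j, hj, he⟩ := exists_bimon _
    (isEq_equalizer (pair (𝟙 (car G.A)) (und G.s)) (inl (car G.A) (car G.B)))
  obtain ⟨l, hl⟩ := exists_isKer (und_i_s G) hz.coc_s hz.inv he
  exact ⟨⟨z, hz, Y, ofUnd j, l, hl⟩⟩

/-- A choice of an antipode and a kernel. -/
noncomputable def kernelData (G : (hopfGraph M).FullSubcategory) : KernelData G.obj :=
  (nonempty_kernelData G.property).some

namespace KernelData

variable {G G' G'' : ReflGraph (Bimon M)} (K : KernelData G) (K' : KernelData G')
  (K'' : KernelData G'')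

/-- The crossed module determined by a kernel. -/
def xmod : XMod M := K.isKer.xmod K.isHopfGraph

omit [HasEqualizers M] in
omit [∀ (X : M), PreservesLimitsOfShape WalkingParallelPair (tensorLeft X)] in
theorem mono : Mono (und K.j) := K.isKer.isEq.mono

omit [HasEqualizers M] in
omit [∀ (X : M), PreservesLimitsOfShape WalkingParallelPair (tensorLeft X)] in
theorem eq_of_comp_j {Z : Bimon M} {f g : Z ⟶ K.Y} (h : f ≫ K.j = g ≫ K.j) : f = g := by
  have := K.mono
  apply und_injective
  rw [← cancel_mono (und K.j)]
  exact congrArg und h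

omit [HasEqualizers M] in
theorem exists_mapY (f : G ⟶ G') : ∃ y : K.Y ⟶ K'.Y, y ≫ K'.j = K.j ≫ f.a ∧
    (und f.b ⊗ₘ und y) ≫ K'.l = K.l ≫ und y := by
  obtain ⟨y, hy, hj, hl⟩ := K.isKer.exists_map K'.isKer K.isHopfGraph.inv K'.isHopfGraph.inv
    (a := und f.a) (b := und f.b) (congrArg und f.a_s) (congrArg und f.b_i)
  exact ⟨ofUnd y, und_injective hj, hl⟩

/-- The morphism of kernels induced by a morphism of reflexive graphs. -/
noncomputable def mapY (f : G ⟶ G') : K.Y ⟶ K'.Y := (K.exists_mapY K' f).choose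

omit [HasEqualizers M] in
theorem mapY_j (f : G ⟶ G') : K.mapY K' f ≫ K'.j = K.j ≫ f.a :=
  (K.exists_mapY K' f).choose_spec.1

/-- The morphism of crossed modules induced by a morphism of reflexive graphs. -/
noncomputable def map (f : G ⟶ G') : K.xmod ⟶ K'.xmod where
  b := f.b
  y := K.mapY K' f
  k_comp := by
    change K.mapY K' f ≫ K'.j ≫ G'.t = (K.j ≫ G.t) ≫ f.b
    rw [← Category.assoc, mapY_j, Category.assoc, Category.assoc, f.a_t]
  l_comp := (K.exists_mapY K' f).choose_spec.2

omit [HasEqualizers M] in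
theorem map_id : K.map K (𝟙 G) = 𝟙 K.xmod := by
  refine XMod.Hom.ext rfl (K.eq_of_comp_j ?_)
  exact (K.mapY_j K _).trans ((Category.comp_id _).trans (Category.id_comp _).symm)

omit [HasEqualizers M] in
theorem map_comp (f : G ⟶ G') (g : G' ⟶ G'') :
    K.map K'' (f ≫ g) = K.map K' f ≫ K'.map K'' g := by
  refine XMod.Hom.ext rfl (K''.eq_of_comp_j ?_)
  have h : (K.mapY K' f ≫ K'.mapY K'' g) ≫ K''.j = K.j ≫ f.a ≫ g.a := by
    rw [Category.assoc, mapY_j, ← Category.assoc, mapY_j, Category.assoc]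
  exact (K.mapY_j K'' _).trans h.symm

omit [HasEqualizers M] in
omit [∀ (X : M), PreservesLimitsOfShape WalkingParallelPair (tensorLeft X)] in
theorem isIso_copair : IsIso (copair (und K.j) (und G.i)) :=
  RelXMod.isIso_copair (und_i_s G) K.isHopfGraph.coc_s K.isHopfGraph.inv K.isKer.isEq

omit [HasEqualizers M] in
omit [∀ (X : M), PreservesLimitsOfShape WalkingParallelPair (tensorLeft X)] in
theorem arrow_ext {Z : Bimon M} {f g : G.A ⟶ Z} (hj : K.j ≫ f = K.j ≫ g)
    (hi : G.i ≫ f = G.i ≫ g) : f = g := by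
  have := K.isIso_copair
  apply und_injective
  rw [← cancel_epi (copair (und K.j) (und G.i)), copair_comp, copair_comp]
  exact congrArg₂ copair (congrArg und hj) (congrArg und hi)

omit [HasEqualizers M] in
theorem map_injective {f g : G ⟶ G'} (h : K.map K' f = K.map K' g) : f = g := by
  have hb : f.b = g.b := congrArg XMod.Hom.b h
  have hy : K.mapY K' f = K.mapY K' g := congrArg XMod.Hom.y h
  refine ReflGraph.Hom.ext hb (K.arrow_ext ?_ ?_)
  · rw [← K.mapY_j K', hy, K.mapY_j K']
  · rw [← f.b_i, ← g.b_i, hb]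

omit [HasEqualizers M] in
omit [∀ (X : M), PreservesLimitsOfShape WalkingParallelPair (tensorLeft X)] in
theorem exists_graphHom (b : G.B ⟶ G'.B) (y : K.Y ⟶ K'.Y) (hk : y ≫ K'.j ≫ G'.t = (K.j ≫ G.t) ≫ b)
    (hl : (und b ⊗ₘ und y) ≫ K'.l = K.l ≫ und y) :
    ∃ g : G ⟶ G', g.b = b ∧ K.j ≫ g.a = y ≫ K'.j := by
  obtain ⟨a, ha, hj, hi, hs⟩ := exists_of_ker K.isIso_copair K.isKer K'.isKer (und_i_s G)
    (und_i_s G') hl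
  have hj' : K.j ≫ (ofUnd a : G.A ⟶ G'.A) = y ≫ K'.j := und_injective hj
  have hi' : G.i ≫ (ofUnd a : G.A ⟶ G'.A) = b ≫ G'.i := und_injective hi
  have ht : ofUnd a ≫ G'.t = G.t ≫ b := by
    apply K.arrow_ext
    · rw [← Category.assoc, hj', Category.assoc, hk, Category.assoc]
    · rw [← Category.assoc, hi', Category.assoc, G'.i_t, ← Category.assoc, G.i_t,
        Category.comp_id, Category.id_comp]
  exact ⟨⟨b, ofUnd a, und_injective hs, ht, hi'.symm⟩, rfl, hj'⟩

omit [HasEqualizers M] in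
theorem map_surjective (f : K.xmod ⟶ K'.xmod) : ∃ g : G ⟶ G', K.map K' g = f := by
  obtain ⟨g, hb, hj⟩ := K.exists_graphHom K' f.b f.y f.k_comp f.l_comp
  exact ⟨g, XMod.Hom.ext hb (K'.eq_of_comp_j ((K.mapY_j K' g).trans hj))⟩

end KernelData

variable (M) in
/-- The functor sending a reflexive graph to the crossed module determined by its kernel. -/
noncomputable def toXMod : (hopfGraph M).FullSubcategory ⥤ (hopfXMod M).FullSubcategory where
  obj G := ⟨(kernelData G).xmod, (kernelData G).z,
    isAntipode_iff.2 (kernelData G).isHopfGraph.inv⟩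
  map {G G'} f := ObjectProperty.homMk ((kernelData G).map (kernelData G') f.hom)
  map_id G := ObjectProperty.hom_ext _ (kernelData G).map_id
  map_comp {G G' G''} _ _ := ObjectProperty.hom_ext _
    ((kernelData G).map_comp (kernelData G') (kernelData G'') _ _)

instance : (toXMod M).Faithful where
  map_injective {G G' _ _} h := ObjectProperty.hom_ext _
    ((kernelData G).map_injective (kernelData G') (congrArg (fun k => k.hom) h))

instance : (toXMod M).Full where
  map_surjective {G G'} f := by
    obtain ⟨g, hg⟩ := (kernelData G).map_surjective (kernelData G') f.hom
    exact ⟨ObjectProperty.homMk g, ObjectProperty.hom_ext _ hg⟩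

end Functor

/-! ### The smash product bimonoid of an action -/

section SmashProduct

variable {M : Type u} [Category.{v} M] [MonoidalCategory M] [SymmetricCategory M]
  {B Y : M} [BimonObj B] [BimonObj Y]

/-- `l` makes `Y` a `B`-module monoid and a `B`-module comonoid. -/
structure IsAction (l : B ⊗ Y ⟶ Y) : Prop where
  isComonHom : IsComonHom l
  inr_act : inr B Y ≫ l = 𝟙 Y
  inl_act : inl B Y ≫ l = 1
  mul_act : μ[B] ▷ Y ≫ l = (α_ B B Y).hom ≫ B ◁ l ≫ l
  act_mul : B ◁ μ[Y] ≫ l = (B ◁ fst Y Y ≫ l) * (B ◁ snd Y Y ≫ l)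

variable {l : B ⊗ Y ⟶ Y} {C : M} [ComonObj C]

omit [SymmetricCategory M] in
theorem pair_whiskerLeft {X Z Z' : M} (f : C ⟶ X) (g : C ⟶ Z) (h : Z ⟶ Z') :
    pair f g ≫ X ◁ h = pair f (g ≫ h) := by
  rw [← id_tensorHom, pair_tensorHom, Category.comp_id]

omit [SymmetricCategory M] in
theorem pair_whiskerRight {X X' Z : M} (f : C ⟶ X) (g : C ⟶ Z) (h : X ⟶ X') :
    pair f g ≫ h ▷ Z = pair (f ≫ h) g := by
  rw [← tensorHom_id, pair_tensorHom, Category.comp_id]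

theorem Coc.act_right {X : M} [MonObj X] {h : C ⟶ X} {f : C ⟶ B} {g : C ⟶ Y} (h₁ : Coc h f)
    (h₂ : Coc h g) : Coc h (act l f g) :=
  (h₁.pair_right h₂).post_right l

namespace IsAction

variable (hl : IsAction l)
include hl

theorem isComonHom_act {f : C ⟶ B} {g : C ⟶ Y} [IsComonHom f] [IsComonHom g] (h : Coc f g) :
    IsComonHom (act l f g) := by
  have := isComonHom_pair f g h
  have := hl.isComonHom
  unfold act
  infer_instance

theorem one_act (g : C ⟶ Y) [IsComonHom g] : act l 1 g = g := by
  have h : pair (1 : C ⟶ B) g = g ≫ inr B Y := by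
    rw [inr_eq_pair, comp_pair, comp_one, Category.comp_id]
  rw [act, h, Category.assoc, hl.inr_act, Category.comp_id]

theorem act_one (f : C ⟶ B) [IsComonHom f] : act l f 1 = 1 := by
  have h : pair f (1 : C ⟶ Y) = f ≫ inl B Y := by
    rw [inl_eq_pair, comp_pair, comp_one, Category.comp_id]
  rw [act, h, Category.assoc, hl.inl_act, comp_one]

theorem mul_act' (f f' : C ⟶ B) (g : C ⟶ Y) : act l (f * f') g = act l f (act l f' g) := by
  rw [act, act, act, ← pair_mul, ← pair_whiskerRight, Category.assoc, hl.mul_act,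
    ← Category.assoc, pair_pair_associator, ← Category.assoc, pair_whiskerLeft]

theorem act_mul' {f : C ⟶ B} {g g' : C ⟶ Y} [IsComonHom f] [IsComonHom g] [IsComonHom g']
    (h : Coc f g) (h' : Coc f g') (h'' : Coc g g') :
    act l f (g * g') = act l f g * act l f g' := by
  have := isComonHom_pair g g' h''
  have := isComonHom_pair f (pair g g') (h.pair_right h')
  rw [act, act, act, ← pair_mul, ← pair_whiskerLeft, Category.assoc, hl.act_mul, comp_mul,
    ← Category.assoc, ← Category.assoc, pair_whiskerLeft, pair_whiskerLeft, pair_fst, pair_snd]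

end IsAction

variable (l) in
theorem tensorHom_smashMul {D : M} [ComonObj D] (u : C ⟶ Y ⊗ B) (v : D ⟶ Y ⊗ B) [IsComonHom u]
    [IsComonHom v] : (u ⊗ₘ v) ≫ smashMul l =
      pair ((fst C D ≫ u ≫ fst Y B) * act l (fst C D ≫ u ≫ snd Y B) (snd C D ≫ v ≫ fst Y B))
        ((fst C D ≫ u ≫ snd Y B) * (snd C D ≫ v ≫ snd Y B)) := by
  rw [smashMul, comp_pair, comp_mul, comp_mul, comp_act]
  simp only [tensorHom_fst_assoc, tensorHom_snd_assoc]

variable (hl : IsAction l) (hB : Coc (𝟙 B) (𝟙 B))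
include hl hB

/-- The first factor's `B` part enters both components of the product, once acting and once
surviving; cocommutativity of `B` makes the components a span in the class. -/
theorem coc_smashMul :
    IsComonHom ((fst (Y ⊗ B) (Y ⊗ B) ≫ fst Y B) *
      act l (fst (Y ⊗ B) (Y ⊗ B) ≫ snd Y B) (snd (Y ⊗ B) (Y ⊗ B) ≫ fst Y B)) ∧
    IsComonHom ((fst (Y ⊗ B) (Y ⊗ B) ≫ snd Y B) * (snd (Y ⊗ B) (Y ⊗ B) ≫ snd Y B)) ∧
    IsComonHom (smashMul l) := by
  have hb : Coc (fst (Y ⊗ B) (Y ⊗ B) ≫ snd Y B) (fst (Y ⊗ B) (Y ⊗ B) ≫ snd Y B) := by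
    have h := hB.pre (fst (Y ⊗ B) (Y ⊗ B) ≫ snd Y B)
    rwa [Category.comp_id] at h
  have h₁₂ := coc_fst_snd (Y ⊗ B) (Y ⊗ B)
  have h₁ := (coc_fst_snd Y B).pre (fst (Y ⊗ B) (Y ⊗ B))
  have h₂ := (coc_fst_snd Y B).pre (snd (Y ⊗ B) (Y ⊗ B))
  have := hl.isComonHom_act (h₁₂.post (snd Y B) (fst Y B))
  have i₁ := isComonHom_mul' (fst (Y ⊗ B) (Y ⊗ B) ≫ fst Y B)
    (act l (fst (Y ⊗ B) (Y ⊗ B) ≫ snd Y B) (snd (Y ⊗ B) (Y ⊗ B) ≫ fst Y B))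
    (h₁.act_right (h₁₂.post _ _))
  have i₂ := isComonHom_mul' (fst (Y ⊗ B) (Y ⊗ B) ≫ snd Y B) (snd (Y ⊗ B) (Y ⊗ B) ≫ snd Y B)
    (h₁₂.post _ _)
  refine ⟨i₁, i₂, isComonHom_pair _ _ ?_⟩
  refine (h₁.mul_right (h₁₂.post _ _)).mul_left (Coc.symm ?_)
  exact (hb.act_right (h₁₂.post _ _)).mul_left ((h₁₂.post _ _).symm.act_right h₂.symm)

theorem isComonHom_smashMul : IsComonHom (smashMul l) := (coc_smashMul hl hB).2.2

theorem smashMul_assoc : smashMul l ▷ (Y ⊗ B) ≫ smashMul l =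
    (α_ (Y ⊗ B) (Y ⊗ B) (Y ⊗ B)).hom ≫ (Y ⊗ B) ◁ smashMul l ≫ smashMul l := by
  obtain ⟨h₁, h₂, h₃⟩ := coc_smashMul hl hB
  have e₁ : smashMul l ≫ fst Y B = _ := pair_fst _ _
  have e₂ : smashMul l ≫ snd Y B = _ := pair_snd _ _
  have hc := (coc_fst_snd (Y ⊗ B) (Y ⊗ B)).pre (fst ((Y ⊗ B) ⊗ (Y ⊗ B)) (Y ⊗ B))
  have hc' := coc_fst_snd ((Y ⊗ B) ⊗ (Y ⊗ B)) (Y ⊗ B)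
  have hc₁ := (hc'.post_left (fst (Y ⊗ B) (Y ⊗ B)))
  have hc₂ := (hc'.post_left (snd (Y ⊗ B) (Y ⊗ B)))
  rw [← tensorHom_id, ← id_tensorHom, tensorHom_smashMul, tensorHom_smashMul, comp_pair, e₁, e₂]
  simp only [comp_mul, comp_act, Category.id_comp, associator_fst_assoc, associator_snd_fst_assoc,
    associator_snd_snd_assoc]
  congr 1
  -- In the `Y` component both sides equal y · (b₁y') · (b₂(b'y'')), by the module law and by
  -- distributing the action over the product y'(b'y'').
  · have := hl.isComonHom_act (hc₂.post (snd Y B) (fst Y B))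
    have a₁ := hc.post (snd Y B) (fst Y B)
    have a₂ := (hc₁.post (snd Y B) (fst Y B))
    have a₃ := (hc₂.post (fst Y B) (fst Y B))
    have a₄ := hc.post (snd Y B) (snd Y B)
    have a₅ := ((coc_fst_snd Y B).pre (snd (Y ⊗ B) (Y ⊗ B))).pre
      (fst ((Y ⊗ B) ⊗ (Y ⊗ B)) (Y ⊗ B))
    simp only [Category.assoc] at this a₁ a₂ a₃ a₄ a₅
    rw [hl.mul_act', mul_assoc, hl.act_mul' a₁ (a₄.act_right a₂) (a₅.act_right a₃)]
  · rw [mul_assoc]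

section

attribute [local instance] ComonObj.instTensorUnit

omit hB in
theorem one_smashMul : η[Y ⊗ B] ▷ (Y ⊗ B) ≫ smashMul l = (λ_ (Y ⊗ B)).hom := by
  have := isComonHom_one (Y ⊗ B)
  have h₁ : fst (𝟙_ M) (Y ⊗ B) ≫ η[Y] = 1 := by
    rw [one_def, ← IsComonHom.hom_counit (fst (𝟙_ M) (Y ⊗ B)), Category.assoc]
    exact congrArg _ (Category.id_comp _).symm
  have h₂ : fst (𝟙_ M) (Y ⊗ B) ≫ η[B] = 1 := by
    rw [one_def, ← IsComonHom.hom_counit (fst (𝟙_ M) (Y ⊗ B)), Category.assoc]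
    exact congrArg _ (Category.id_comp _).symm
  have h₃ : snd (𝟙_ M) (Y ⊗ B) = (λ_ (Y ⊗ B)).hom := by simp [snd]
  rw [← tensorHom_id, tensorHom_smashMul, IsMonHom.one_hom, IsMonHom.one_hom, h₁, h₂, one_mul,
    one_mul, Category.id_comp, Category.id_comp, hl.one_act, ← comp_pair, pair_fst_snd,
    Category.comp_id, h₃]

omit hB in
theorem smashMul_one : (Y ⊗ B) ◁ η[Y ⊗ B] ≫ smashMul l = (ρ_ (Y ⊗ B)).hom := by
  have := isComonHom_one (Y ⊗ B)
  have h₁ : snd (Y ⊗ B) (𝟙_ M) ≫ η[Y] = 1 := by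
    rw [one_def, ← IsComonHom.hom_counit (snd (Y ⊗ B) (𝟙_ M)), Category.assoc]
    exact congrArg _ (Category.id_comp _).symm
  have h₂ : snd (Y ⊗ B) (𝟙_ M) ≫ η[B] = 1 := by
    rw [one_def, ← IsComonHom.hom_counit (snd (Y ⊗ B) (𝟙_ M)), Category.assoc]
    exact congrArg _ (Category.id_comp _).symm
  have h₃ : fst (Y ⊗ B) (𝟙_ M) = (ρ_ (Y ⊗ B)).hom := by simp [fst]
  rw [← id_tensorHom, tensorHom_smashMul, IsMonHom.one_hom, IsMonHom.one_hom, h₁, h₂, mul_one,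
    Category.id_comp, Category.id_comp, hl.act_one, mul_one, ← comp_pair, pair_fst_snd,
    Category.comp_id, h₃]

end

/-- The object `Y ⊗ B` already carries the tensor product bimonoid structure. Presenting the smash
product as another object `S` with a comparison `Q` keeps the two multiplications apart. -/
theorem exists_smash : ∃ (S : M) (_ : BimonObj S) (Q : Y ⊗ B ⟶ S), IsIso Q ∧ IsComonHom Q ∧
    η[Y ⊗ B] ≫ Q = η[S] ∧ (Q ⊗ₘ Q) ≫ μ[S] = smashMul l ≫ Q := by
  have h := isComonHom_smashMul hl hB
  let mon : MonObj (Y ⊗ B) := {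
    one := η[Y ⊗ B]
    mul := smashMul l
    one_mul := one_smashMul hl
    mul_one := smashMul_one hl
    mul_assoc := smashMul_assoc hl hB }
  let bim : BimonObj (Y ⊗ B) := {
    __ := mon
    __ := (inferInstance : ComonObj (Y ⊗ B))
    mul_comul := by
      have e := h.hom_comul
      rw [Comon.tensorObj_comul (Y ⊗ B) (Y ⊗ B), Category.assoc] at e
      exact e
    one_comul := BimonObj.one_comul (Y ⊗ B)
    mul_counit := h.hom_counit
    one_counit := BimonObj.one_counit (Y ⊗ B) }
  refine ⟨Y ⊗ B, bim, 𝟙 _, inferInstance, ⟨Category.id_comp _, ?_⟩, Category.comp_id _, ?_⟩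
  · exact (Category.id_comp _).trans (by rw [id_tensorHom_id, Category.comp_id])
  · rw [id_tensorHom_id, Category.id_comp, Category.comp_id]; rfl

end SmashProduct

/-! ### The reflexive graph carried by a smash product -/

section Split

variable {M : Type u} [Category.{v} M] [MonoidalCategory M] [SymmetricCategory M]

/-- The maps `j` and `i` exhibit `A` as a smash product of `Y` and `B`, with coprojections `j`, `i`
and projections `π`, `s`. -/
structure IsSmash {A B Y : M} [BimonObj A] [BimonObj B] [BimonObj Y] (l : B ⊗ Y ⟶ Y)
    (j : Y ⟶ A) (i : B ⟶ A) (π : A ⟶ Y) (s : A ⟶ B) : Prop where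
  isBimonHom_j : IsBimonHom j
  isBimonHom_i : IsBimonHom i
  isBimonHom_s : IsBimonHom s
  isComonHom_π : IsComonHom π
  isIso : IsIso (copair j i)
  copair_π : copair j i ≫ π = fst Y B
  copair_s : copair j i ≫ s = snd Y B
  act : (fst B Y ≫ i) * (snd B Y ≫ j) = (l ≫ j) * (fst B Y ≫ i)

omit [SymmetricCategory M] in
theorem isComonHom_inv {C D : M} [ComonObj C] [ComonObj D] (f : C ⟶ D) [IsComonHom f] [IsIso f] :
    IsComonHom (inv f) where
  hom_counit := by rw [IsIso.inv_comp_eq, IsComonHom.hom_counit]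
  hom_comul := by
    rw [IsIso.inv_comp_eq, IsComonHom.hom_comul_assoc, tensorHom_comp_tensorHom,
      IsIso.hom_inv_id, id_tensorHom_id, Category.comp_id]

section

variable {B Y : M} [BimonObj B] [BimonObj Y] {l : B ⊗ Y ⟶ Y}

theorem isSmash_of_iso (hl : IsAction l) (hB : Coc (𝟙 B) (𝟙 B)) {S : M} [BimonObj S] (Q : Y ⊗ B ⟶ S) [IsIso Q]
    [IsComonHom Q] (h₁ : η[Y ⊗ B] ≫ Q = η[S])
    (hm : (Q ⊗ₘ Q) ≫ μ[S] = smashMul l ≫ Q) :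
    IsSmash l (inl Y B ≫ Q) (inr Y B ≫ Q) (inv Q ≫ fst Y B) (inv Q ≫ snd Y B) := by
  have := isComonHom_inv Q
  have hQ : copair (inl Y B ≫ Q) (inr Y B ≫ Q) = Q := by
    rw [← tensorHom_copair, copair, hm, ← Category.assoc, tensorHom_smashMul]
    simp only [inl_fst, inl_snd, inr_fst, inr_snd, comp_one, Category.comp_id, hl.one_act, mul_one,
      one_mul, pair_fst_snd, Category.id_comp]
  have hj : IsMonHom (inl Y B ≫ Q) := {
    one_hom := by rw [IsMonHom.one_hom_assoc, h₁]
    mul_hom := by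
      rw [← tensorHom_comp_tensorHom, Category.assoc, hm, ← Category.assoc (_ ⊗ₘ _),
        tensorHom_smashMul]
      simp only [inl_fst, inl_snd, comp_one, Category.comp_id, hl.one_act, mul_one]
      rw [← mul_eq_fst_mul_snd, inl_eq_pair, ← Category.assoc, comp_pair, Category.comp_id,
        comp_one] }
  have hi : IsMonHom (inr Y B ≫ Q) := {
    one_hom := by rw [IsMonHom.one_hom_assoc, h₁]
    mul_hom := by
      rw [← tensorHom_comp_tensorHom, Category.assoc, hm, ← Category.assoc (_ ⊗ₘ _),
        tensorHom_smashMul]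
      simp only [inr_fst, inr_snd, comp_one, Category.comp_id, hl.act_one, mul_one]
      rw [← mul_eq_fst_mul_snd, inr_eq_pair, ← Category.assoc, comp_pair, Category.comp_id,
        comp_one] }
  have hs : IsMonHom (inv Q ≫ snd Y B) := {
    one_hom := by rw [← h₁, Category.assoc, IsIso.hom_inv_id_assoc, IsMonHom.one_hom]
    mul_hom := by
      have := (coc_smashMul hl hB).1
      rw [← cancel_epi (Q ⊗ₘ Q), ← Category.assoc, hm, Category.assoc, IsIso.hom_inv_id_assoc,
        tensorHom_comp_tensorHom_assoc, IsIso.hom_inv_id_assoc, smashMul, pair_snd, ← copair.eq_def,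
        copair_eq_mul] }
  refine ⟨⟨⟩, ⟨⟩, ⟨⟩, inferInstance, by rwa [hQ], ?_, ?_, ?_⟩
  · rw [hQ, IsIso.hom_inv_id_assoc]
  · rw [hQ, IsIso.hom_inv_id_assoc]
  · have h : (inr Y B ⊗ₘ inl Y B) ≫ smashMul l = pair l (fst B Y) := by
      rw [tensorHom_smashMul]
      simp only [inl_fst, inl_snd, inr_fst, inr_snd, comp_one, Category.comp_id, mul_one,
        one_mul]
      rw [RelXMod.act, pair_fst_snd, Category.id_comp]
    rw [← copair_eq_mul, ← pair_copair, hQ, ← tensorHom_copair, copair, hm, ← Category.assoc, h]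

theorem exists_isSmash {B Y : Bimon M} {l : car B ⊗ car Y ⟶ car Y} (hl : IsAction l)
    (hB : Coc (𝟙 (car B)) (𝟙 (car B))) :
    ∃ (A : Bimon M) (j : Y ⟶ A) (i : B ⟶ A) (π : car A ⟶ car Y) (s : A ⟶ B),
      IsSmash l (und j) (und i) π (und s) := by
  obtain ⟨S, _, Q, _, _, h₁, hm⟩ := exists_smash hl hB
  have h : ∃ (A : Bimon M) (Q : car Y ⊗ car B ⟶ car A), IsIso Q ∧ IsComonHom Q ∧
    η[car Y ⊗ car B] ≫ Q = η[car A] ∧ (Q ⊗ₘ Q) ≫ μ[car A] = smashMul l ≫ Q :=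
    ⟨Bimon.mk' S, Q, ‹_›, ‹_›, h₁, hm⟩
  obtain ⟨A, Q, _, _, h₁, hm⟩ := h
  have h := isSmash_of_iso hl hB Q h₁ hm
  have := h.isBimonHom_j
  have := h.isBimonHom_i
  have := h.isBimonHom_s
  exact ⟨A, ofUnd (inl _ _ ≫ Q), ofUnd (inr _ _ ≫ Q), _, ofUnd (inv Q ≫ snd _ _), h⟩

end

namespace IsSmash

variable {A B Y : M} [BimonObj A] [BimonObj B] [BimonObj Y] {l : B ⊗ Y ⟶ Y}
    {j : Y ⟶ A} {i : B ⟶ A} {π : A ⟶ Y} {s : A ⟶ B} (h : IsSmash l j i π s)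
include h

theorem j_π : j ≫ π = 𝟙 Y := by
  have := h.isBimonHom_i
  rw [← inl_copair j i, Category.assoc, h.copair_π, inl_fst]

theorem j_s : j ≫ s = 1 := by
  have := h.isBimonHom_i
  rw [← inl_copair j i, Category.assoc, h.copair_s, inl_snd]

theorem i_π : i ≫ π = 1 := by
  have := h.isBimonHom_j
  rw [← inr_copair j i, Category.assoc, h.copair_π, inr_fst]

theorem i_s : i ≫ s = 𝟙 B := by
  have := h.isBimonHom_j
  rw [← inr_copair j i, Category.assoc, h.copair_s, inr_snd]

theorem isComonHom_copair : IsComonHom (copair j i) := by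
  have := h.isBimonHom_j
  have := h.isBimonHom_i
  rw [copair_eq_mul]
  exact isComonHom_mul' _ _ ((coc_fst_snd Y B).post j i)

theorem fac : (π ≫ j) * (s ≫ i) = 𝟙 A := by
  have := h.isIso
  have := h.isComonHom_copair
  rw [← cancel_epi (copair j i), comp_mul, ← Category.assoc, ← Category.assoc, h.copair_π,
    h.copair_s, Category.comp_id, copair_eq_mul]

theorem coc_π_s : Coc π s := by
  have := h.isIso
  have := h.isComonHom_copair
  have := isComonHom_inv (copair j i)
  have e := (coc_fst_snd Y B).pre (inv (copair j i))
  rwa [← h.copair_π, ← h.copair_s, IsIso.inv_hom_id_assoc, IsIso.inv_hom_id_assoc] at e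

theorem coc_s (hB : Coc (𝟙 B) (𝟙 B)) : Coc (𝟙 A) s := by
  have := h.isBimonHom_s
  have e := hB.pre s
  rw [Category.comp_id] at e
  rw [← h.fac]
  exact (h.coc_π_s.post_left j).mul_left (e.post_left i)

/-- A morphism equalized by the two maps loses its `si` factor in the decomposition `fac`, so it
factors through `j` by its composite with `π`. -/
theorem isKer : IsKer s i j l where
  isEq := by
    have := h.isBimonHom_j
    have := h.isBimonHom_i
    have hw : j ≫ pair (𝟙 A) s = j ≫ inl A B := by
      rw [comp_pair, inl_eq_pair, comp_pair, h.j_s, comp_one]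
    have hm : Mono j := mono_of_mono_fac h.j_π
    refine ⟨hw, hm, fun f hf => ⟨f ≫ π, ?_⟩⟩
    have e := comp_mul_comp_of_pair_eq hf (π ≫ j) i (IsMonHom.one_hom i)
    rwa [h.fac, Category.comp_id, eq_comm, ← Category.assoc] at e
  act := h.act

variable {k : Y ⟶ B} [IsBimonHom k]

/-- By the universal property of the smash product applied to `k` and `𝟙 B`: the required exchange
rule is exactly the compatibility of `k` with the action. -/
theorem isBimonHom_t
    (hk : (l ≫ k) * fst B Y = fst B Y * (snd B Y ≫ k)) : IsBimonHom ((π ≫ k) * s) := by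
  have := h.isBimonHom_j
  have := h.isBimonHom_i
  have := h.isBimonHom_s
  have := h.isComonHom_π
  have := h.isComonHom_copair
  have h₁ : IsComonHom ((π ≫ k) * s) := isComonHom_mul' _ _ (h.coc_π_s.post_left k)
  have h₂ : IsMonHom ((π ≫ k) * s) := by
    refine isMonHom_of_smash (f := k) (g := 𝟙 B) h.act h.isIso ?_ _ ?_
    · simpa only [Category.comp_id] using hk.symm
    · rw [comp_mul, ← Category.assoc, h.copair_π, h.copair_s, copair_eq_mul, Category.comp_id]
  constructor

omit [IsBimonHom k] in
theorem j_t : j ≫ ((π ≫ k) * s) = k := by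
  have := h.isBimonHom_j
  rw [comp_mul, h.j_s, mul_one, ← Category.assoc, h.j_π, Category.id_comp]

theorem i_t : i ≫ ((π ≫ k) * s) = 𝟙 B := by
  have := h.isBimonHom_i
  rw [comp_mul, h.i_s, ← Category.assoc, h.i_π, RelXMod.one_comp, one_mul]

omit [IsBimonHom k] in
theorem coc_t (hB : Coc (𝟙 B) (𝟙 B)) (hk : Coc k (𝟙 Y)) : Coc ((π ≫ k) * s) (𝟙 A) := by
  have := h.isBimonHom_s
  have := h.isComonHom_π
  have e := hk.pre π
  rw [Category.comp_id] at e
  rw [← h.fac]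
  refine ((e.post_right j).mul_right (h.coc_π_s.post k i)).mul_left ?_
  rw [h.fac]
  exact (h.coc_s hB).symm

/-- Written with the adjoint action, Peiffer acquires a leading factor ik(y₁). Cancelling it by izk
on the left leaves this commutation. -/
theorem comIm_j {z : B ⟶ B} (hz : IsInv z)
    (hp : (k ▷ Y ≫ l) * fst Y Y = fst Y Y * snd Y Y) : ComIm j ((k ≫ z ≫ i) * j) := by
  have := h.isBimonHom_j
  have := h.isBimonHom_i
  have e₁ := hz.inv_mul (fst Y Y ≫ k) i
  have e₂ := congrArg (· ≫ j) hp
  simp only [RelXMod.mul_comp, Category.assoc] at e₁ e₂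
  rw [h.isKer.comp_eq hz, adj, comp_mul, comp_mul] at e₂
  simp only [whiskerRight_fst_assoc, whiskerRight_snd_assoc] at e₂
  have e₃ := congrArg ((fst Y Y ≫ k ≫ z ≫ i) * ·) e₂
  simp only [mul_assoc, mul_cancel_left e₁] at e₃
  refine ComIm.symm (comIm_iff.2 ?_)
  rw [comp_mul, Commute, SemiconjBy, mul_assoc]
  exact e₃.symm

/-- Here σ is `π ≫ j`, while τ of an element with components y and b is the element izk(y₁) j(y₂)
conjugated by b. Moving j(y') past i(b) replaces y' by its translate under b (`r₁`), which commutes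
with the inner element by `comIm_j` (`r₂`), and moving past iz(b) undoes the translation (`r₃`). -/
theorem comIm_sArr_tArr {z : B ⟶ B} (hz : IsInv z)
    (hp : (k ▷ Y ≫ l) * fst Y Y = fst Y Y * snd Y Y) :
    ComIm (sArr s z i) (tArr ((π ≫ k) * s) z i) := by
  have := h.isBimonHom_j
  have := h.isBimonHom_i
  have := h.isBimonHom_s
  have := h.isComonHom_π
  have hs : sArr s z i = π ≫ j := by
    rw [sArr, ← h.fac, mul_assoc, hz.mul_inv, mul_one]
  have ht : ((π ≫ k) * s) ≫ z ≫ i = (s ≫ z ≫ i) * (π ≫ k ≫ z ≫ i) := by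
    have := isComonHom_pair (π ≫ k) s (h.coc_π_s.post_left k)
    rw [← pair_mul, Category.assoc, ← Category.assoc μ[B], hz.mul_comp, ← Category.assoc, comp_mul,
      RelXMod.mul_comp, ← Category.assoc _ _ z, ← Category.assoc _ _ z, pair_fst, pair_snd]
    simp only [Category.assoc]
  have hT : tArr ((π ≫ k) * s) z i =
      (s ≫ z ≫ i) * ((π ≫ ((k ≫ z ≫ i) * j)) * (s ≫ i)) := by
    rw [tArr, ht, ← h.fac, comp_mul]
    simp only [mul_assoc]
  rw [hs, hT]
  refine ComIm.pre_left ?_ π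
  rw [comIm_iff, comp_mul, comp_mul]
  have hc := coc_fst_snd Y A
  have := isComonHom_pair (snd Y A ≫ s) (fst Y A) (hc.symm.post_left s)
  have r₁ := congrArg (pair (snd Y A ≫ s) (fst Y A) ≫ ·) h.act
  simp only [comp_mul, ← Category.assoc, pair_fst, pair_snd] at r₁
  rw [← RelXMod.act] at r₁
  have r₂ : Commute (RelXMod.act l (snd Y A ≫ s) (fst Y A) ≫ j)
      ((snd Y A ≫ π) ≫ ((k ≫ z ≫ i) * j)) :=
    Coc.commute (Coc.act_right (h.coc_π_s.pre (snd Y A)) (hc.symm.post_left π)).symm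
      (h.comIm_j hz hp)
  have i₁ := hz.inv_mul (snd Y A ≫ s) i
  have i₂ := hz.mul_inv (snd Y A ≫ s) i
  simp only [Category.assoc] at r₁ r₂ i₁ i₂
  have r₃ : (snd Y A ≫ s ≫ z ≫ i) * (RelXMod.act l (snd Y A ≫ s) (fst Y A) ≫ j) =
      (fst Y A ≫ j) * (snd Y A ≫ s ≫ z ≫ i) := by
    rw [← mul_one (RelXMod.act l _ _ ≫ j), ← i₂, ← mul_assoc (RelXMod.act l _ _ ≫ j), ← r₁, mul_assoc,
      mul_cancel_left i₁]
  rw [Commute, SemiconjBy, mul_assoc, mul_assoc, r₁, ← mul_assoc (snd Y A ≫ π ≫ _), ← r₂.eq,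
    mul_assoc, ← mul_assoc, ← r₃, mul_assoc]

end IsSmash

end Split

/-! ### Essential surjectivity -/

section EssSurj

variable {M : Type u} [Category.{v} M] [MonoidalCategory M] [SymmetricCategory M]

theorem XMod.isAction (X : XMod M) : IsAction X.l where
  isComonHom := isComonHom_act_iff.2 ⟨X.act_counit, X.act_comul⟩
  inr_act := one_act_iff.1 X.one_act
  inl_act := act_one_iff.1 X.act_one
  mul_act := X.mul_act
  act_mul := X.act_mul.trans diagonal_comp_mul

theorem XMod.exists_graph (X : XMod M) {z : car X.B ⟶ car X.B} (hz : IsInv z) :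
    ∃ (A : Bimon M) (s t : A ⟶ X.B) (i : X.B ⟶ A) (hs : i ≫ s = 𝟙 X.B) (ht : i ≫ t = 𝟙 X.B)
      (j : X.Y ⟶ A), IsHopfGraph ⟨X.B, A, s, t, i, hs, ht⟩ z ∧
        IsKer (und s) (und i) (und j) X.l ∧ j ≫ t = X.k := by
  have hB := isCommComonObj_iff.1 X.cocomm
  have hk := k_comul_iff.1 X.k_comul
  have hp := peiffer_iff.1 X.peiffer
  obtain ⟨A, j, i, π, s, h⟩ := exists_isSmash X.isAction hB
  have := h.isBimonHom_t (k_act_iff.1 X.k_act)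
  exact ⟨A, s, ofUnd ((π ≫ und X.k) * und s), i, und_injective h.i_s, und_injective h.i_t, j,
    ⟨hz, h.coc_s hB, h.coc_t hB hk, h.comIm_sArr_tArr hz hp⟩, h.isKer, und_injective h.j_t⟩

variable [∀ X : M, PreservesLimitsOfShape WalkingParallelPair (tensorLeft X)]

/-- Any two kernels determine isomorphic crossed modules. -/
noncomputable def KernelData.xmodIso {G : ReflGraph (Bimon M)} (K K' : KernelData G) :
    K.xmod ≅ K'.xmod where
  hom := K.map K' (𝟙 G)
  inv := K'.map K (𝟙 G)
  hom_inv_id := by rw [← map_comp, Category.comp_id, map_id]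
  inv_hom_id := by rw [← map_comp, Category.comp_id, map_id]

variable [HasEqualizers M]

instance : (toXMod M).EssSurj where
  mem_essImage X := by
    obtain ⟨X, z, hz⟩ := X
    rw [isAntipode_iff] at hz
    obtain ⟨A, s, t, i, hs, ht, j, hG, hl, hk⟩ := X.exists_graph hz
    let G : (hopfGraph M).FullSubcategory :=
      ⟨⟨X.B, A, s, t, i, hs, ht⟩, hopfGraph_iff_exists.2 ⟨z, hG⟩⟩
    -- The given `X` is the crossed module of this particular kernel; `xmodIso` compares it with the
    -- kernel chosen by the functor.
    let K : KernelData G.obj := ⟨z, hG, X.Y, j, X.l, hl⟩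
    have hl₁ : (𝟙 (car X.B) ⊗ₘ 𝟙 (car X.Y)) ≫ X.l = X.l ≫ 𝟙 (car X.Y) := by
      rw [id_tensorHom_id, Category.id_comp, Category.comp_id]
    let e : K.xmod ≅ X := {
      hom := ⟨𝟙 X.B, 𝟙 X.Y, by
        change 𝟙 X.Y ≫ X.k = (j ≫ t) ≫ 𝟙 X.B
        rw [hk, Category.id_comp, Category.comp_id], hl₁⟩
      inv := ⟨𝟙 X.B, 𝟙 X.Y, by
        change 𝟙 X.Y ≫ j ≫ t = X.k ≫ 𝟙 X.B
        rw [hk, Category.id_comp, Category.comp_id], hl₁⟩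
      hom_inv_id := XMod.Hom.ext (Category.id_comp (𝟙 X.B)) (Category.id_comp (𝟙 X.Y))
      inv_hom_id := XMod.Hom.ext (Category.id_comp (𝟙 X.B)) (Category.id_comp (𝟙 X.Y)) }
    exact ⟨G, ⟨ObjectProperty.isoMk _ ((kernelData G).xmodIso K ≪≫ e)⟩⟩

instance : (toXMod M).IsEquivalence where

end EssSurj

/-! ### Antipodes and cocommutativity of `Y` and of `A` -/

section Comparison

variable {M : Type u} [Category.{v} M] [MonoidalCategory M] [SymmetricCategory M]

section

variable {A B Y : M} [BimonObj A] [BimonObj B] [BimonObj Y] {s : A ⟶ B} {i : B ⟶ A} {z : B ⟶ B}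
  [IsBimonHom s] [IsBimonHom i] {j : Y ⟶ A} [IsBimonHom j]

omit [IsBimonHom s] in
-- As a comonoid `A` is `Y ⊗ B` with `B` cocommutative, and conversely `Y` is a subcomonoid of `A`.
theorem coc_id_iff [∀ X : M, PreservesLimitsOfShape WalkingParallelPair (tensorLeft X)]
    (hj : IsEq j (pair (𝟙 A) s) (inl A B)) (hB : Coc (𝟙 B) (𝟙 B)) (hQ : IsIso (copair j i)) :
    Coc (𝟙 Y) (𝟙 Y) ↔ Coc (𝟙 A) (𝟙 A) := by
  constructor
  · intro hY
    have : IsComonHom (copair j i) := by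
      rw [copair_eq_mul]; exact isComonHom_mul' _ _ ((coc_fst_snd Y B).post j i)
    have := isComonHom_inv (copair j i)
    have h₁ := hY.pre (fst Y B)
    have h₂ := hB.pre (snd Y B)
    have h₃ := coc_fst_snd Y B
    rw [Category.comp_id] at h₁ h₂
    have h : Coc (𝟙 (Y ⊗ B)) (𝟙 (Y ⊗ B)) := by
      rw [← pair_fst_snd]
      exact (h₁.pair_right h₃).pair_left (h₃.symm.pair_right h₂)
    have h' := (h.post (copair j i) (copair j i)).pre (inv (copair j i))
    rwa [Category.id_comp, IsIso.inv_hom_id] at h'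
  · intro hA
    have h := hA.pre j
    rw [Category.comp_id] at h
    refine Coc.of_comp_mono hj ?_
    rw [Category.id_comp]
    refine (Coc.of_comp_mono hj ?_).symm
    rw [Category.id_comp]
    exact h

/-- The antipode restricts to the kernel: `j ≫ w` followed by either of the equalized maps inverts
the same morphism, so the two composites agree. -/
theorem IsInv.of_ker (hj : IsEq j (pair (𝟙 A) s) (inl A B)) {w : A ⟶ A} (hw : IsInv w) :
    ∃ y : Y ⟶ Y, IsInv y := by
  have := hj.mono
  have e₁ := hw.inv_mul j (inl A B)
  have e₂ := hw.mul_inv j (pair (𝟙 A) s)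
  rw [hj.w] at e₂
  obtain ⟨y, hy⟩ := hj.exists_lift (j ≫ w) (by
    rw [Category.assoc, Category.assoc]
    exact (left_inv_eq_right_inv e₁ e₂).symm)
  have e₃ := hw.inv_mul j (𝟙 A)
  have e₄ := hw.mul_inv j (𝟙 A)
  rw [Category.comp_id, Category.comp_id, ← hy] at e₃ e₄
  refine ⟨y, ?_, ?_⟩
  · rw [← cancel_mono j, RelXMod.mul_comp, Category.id_comp, e₃, RelXMod.one_comp]
  · rw [← cancel_mono j, RelXMod.mul_comp, Category.id_comp, e₄, RelXMod.one_comp]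

/-- The antipode of a product j(y) i(b) is the product of the antipodes in reverse order. -/
theorem exists_isInv_of_copair (hQ : IsIso (copair j i)) (hz : IsInv z) {y : Y ⟶ Y}
    (hy : IsInv y) : ∃ w : A ⟶ A, IsInv w := by
  have : IsComonHom (copair j i) := by
    rw [copair_eq_mul]; exact isComonHom_mul' _ _ ((coc_fst_snd Y B).post j i)
  have := isComonHom_inv (copair j i)
  have e₁ := hy.inv_mul (fst Y B) j
  have e₂ := hy.mul_inv (fst Y B) j
  have e₃ := hz.inv_mul (snd Y B) i
  have e₄ := hz.mul_inv (snd Y B) i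
  have h : 𝟙 A = inv (copair j i) ≫ ((fst Y B ≫ j) * (snd Y B ≫ i)) := by
    rw [← copair_eq_mul, IsIso.inv_hom_id]
  refine ⟨inv (copair j i) ≫ ((snd Y B ≫ z ≫ i) * (fst Y B ≫ y ≫ j)), ?_, ?_⟩
  · rw [h, ← comp_mul, mul_assoc, mul_cancel_left e₁, e₃, comp_one]
  · rw [h, ← comp_mul, mul_assoc, mul_cancel_left e₄, e₂, comp_one]

end

variable {G : ReflGraph (Bimon M)} (K : KernelData G)
  [∀ X : M, PreservesLimitsOfShape WalkingParallelPair (tensorLeft X)]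

omit [∀ (X : M), PreservesLimitsOfShape WalkingParallelPair (tensorLeft X)] in
theorem KernelData.isHopf_iff : IsHopf K.Y ↔ IsHopf G.A := by
  simp only [IsHopf, isAntipode_iff]
  exact ⟨fun ⟨_, hy⟩ => exists_isInv_of_copair K.isIso_copair K.isHopfGraph.inv hy,
    fun ⟨_, hw⟩ => IsInv.of_ker K.isKer.isEq hw⟩

theorem KernelData.isCommComonObj_iff : IsCommComonObj (car K.Y) ↔ IsCommComonObj (car G.A) := by
  rw [RelXMod.isCommComonObj_iff, RelXMod.isCommComonObj_iff]
  exact coc_id_iff K.isKer.isEq (coc_id_of_section (und_i_s G) K.isHopfGraph.coc_s) K.isIso_copair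

theorem KernelData.isCrossedModuleOf : IsCrossedModuleOf G K.xmod (𝟙 G.B) K.j := by
  have h := K.isKer.isEq
  rw [pair_id_eq] at h
  refine ⟨h.w, h.isLimit, Category.comp_id _, ?_⟩
  have e := K.isKer.act
  rw [← copair_eq_mul, ← pair_copair] at e
  change copair (𝟙 _ ≫ und G.i) (und K.j) = exchange K.l ≫ copair (und K.j) (𝟙 _ ≫ und G.i)
  rw [Category.id_comp]
  rw [exchange_eq, e]

end Comparison

/-! ### Comparison of bases and of kernels, and the final statement -/

section Main

variable (M : Type u) [Category.{v} M] [MonoidalCategory M] [SymmetricCategory M]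
  [HasEqualizers M] [∀ X : M, PreservesLimitsOfShape WalkingParallelPair (tensorLeft X)]

/-- The vertices of a reflexive graph and the base of its crossed module agree. -/
noncomputable def baseIso : toXMod M ⋙ (hopfXMod M).ι ⋙ XMod.base ≅
    (hopfGraph M).ι ⋙ ReflGraph.vertices :=
  NatIso.ofComponents (fun G => Iso.refl G.obj.B)
    fun _ => (Category.comp_id _).trans (Category.id_comp _).symm

/-- The inclusion of the kernel in the bimonoid of arrows. -/
noncomputable def fibreArrows : toXMod M ⋙ (hopfXMod M).ι ⋙ XMod.fibre ⟶
    (hopfGraph M).ι ⋙ ReflGraph.arrows where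
  app G := (kernelData G).j
  naturality G G' f := (kernelData G).mapY_j (kernelData G') f.hom

end Main

end RelXMod

theorem proposition3p13 (M : Type u) [Category.{v} M] [MonoidalCategory M] [SymmetricCategory M]
    [HasEqualizers M] [∀ X : M, PreservesLimitsOfShape WalkingParallelPair (tensorLeft X)] :
    ∃ (E : (RelXMod.hopfCat M).FullSubcategory ≌ (RelXMod.hopfGraph M).FullSubcategory)
      (F : (RelXMod.hopfGraph M).FullSubcategory ≌ (RelXMod.hopfXMod M).FullSubcategory),
      Nonempty (E.functor ⋙ (RelXMod.hopfGraph M).ι ≅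
        (RelXMod.hopfCat M).ι ⋙ RelXMod.RelCategory.forget (RelXMod.coSpans M)) ∧
      ∃ (b : F.functor ⋙ (RelXMod.hopfXMod M).ι ⋙ RelXMod.XMod.base ≅
          (RelXMod.hopfGraph M).ι ⋙ RelXMod.ReflGraph.vertices)
        (j : F.functor ⋙ (RelXMod.hopfXMod M).ι ⋙ RelXMod.XMod.fibre ⟶
          (RelXMod.hopfGraph M).ι ⋙ RelXMod.ReflGraph.arrows),
        ∀ G : (RelXMod.hopfGraph M).FullSubcategory,
          RelXMod.IsCrossedModuleOf G.obj (F.functor.obj G).obj (b.hom.app G) (j.app G) ∧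
          (RelXMod.IsHopf (F.functor.obj G).obj.Y ↔ RelXMod.IsHopf G.obj.A) ∧
          (IsCommComonObj (RelXMod.car (F.functor.obj G).obj.Y) ↔
            IsCommComonObj (RelXMod.car G.obj.A)) := by
  refine ⟨(RelXMod.forgetHopf M).asEquivalence, (RelXMod.toXMod M).asEquivalence,
    ⟨Iso.refl _⟩, RelXMod.baseIso M, RelXMod.fibreArrows M, fun G => ?_⟩
  exact ⟨(RelXMod.kernelData G).isCrossedModuleOf, (RelXMod.kernelData G).isHopf_iff,
    (RelXMod.kernelData G).isCommComonObj_iff⟩
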